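/- Let $k$ be a commutative ring, $d\ge 1$ an integer, and $\mathcal E$ a $k$-linear Quillen exact category which is weakly idempotent complete (every retraction has a kernel) and has enough injectives. Let $\mathcal I\subseteq\mathcal E$ be the full subcategory of injective objects. Let $\mathcal M$ be a $d$-cluster tilting subcategory of $\mathcal E$, i.e. a full subcategory such that every object of $\mathcal E$ has a left $\mathcal M$-approximation which is an inflation and a right $\mathcal M$-approximation which is a deflation, and $$\mathcal M=\{X\mid \mathrm{Ext}^i_{\mathcal E}(\mathcal M,X)=0,\ 1\le i\le d-1\}=\{Y\mid \mathrm{Ext}^i_{\mathcal E}(Y,\mathcal M)=0,\ 1\le i\le d-1\},$$ where $\mathrm{Ext}$ denotes Yoneda extensions. Notation. Let $\mathrm{Mod}\,\mathcal M$ be the category of $k$-linear functors $\mathcal M^{op}\to k\text{-}\mathrm{Mod}$, and $M^\wedge=\mathrm{Hom}_{\mathcal M}(-,M)$. View $\mathcal M$ as a dg category concentrated in degree $0$, so that its pretriangulated hull is the dg category of bounded complexes over $\mathcal M$, with homotopy category $\mathcal H^b(\mathcal M)$ and suspension $\Sigma$. For classes of objects, $\mathcal X*\mathcal Y$ is the class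 of objects $Z$ occurring in a distinguished triangle $X\to Z\to Y\to\Sigma X$ with $X\in\mathcal X$, $Y\in\mathcal Y$. For $n\ge0$ let $\mathcal A^{(n)}_{\mathcal M,\mathcal I}$ be the full dg subcategory of the pretriangulated hull on the objects $X\in\mathcal M*\Sigma\mathcal M*\cdots*\Sigma^n\mathcal M$ such that $\mathrm{Hom}_{\mathcal H^b(\mathcal M)}(X,\Sigma^iI)=0$ for all $i\ge1$ and $I\in\mathcal I$; thus $H^0(\mathcal A^{(n)}_{\mathcal M,\mathcal I})$ is a full subcategory of $\mathcal H^b(\mathcal M)$. Let $\mathrm{mod}_{adm}(\mathcal M)\subseteq\mathrm{Mod}\,\mathcal M$ be the full subcategory of the functors $F$ which have a presentation $X^\wedge\xrightarrow{f^\wedge}Y^\wedge\to F\to0$ with $f:X\to Y$ a morphism of $\mathcal M$ which is admissible in $\mathcal E$ (a deflation followed by an inflation). Then $\mathcal M$ is an additive category containing $\mathcal I$, and the following hold. (a) The pair $(\mathcal M,\mathcal I)$ is a $d$-cluster tilting pair, i.e. $\mathcal I$ is an additive subcategory of $\mathcal M$ closed under direct summands, and every object of $H^0(\mathcal A^{(d)}_{\mathcal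 M,\mathcal I})$ has a left $\mathcal I$-approximation. Moreover: 1) $\mathcal M$ is concentrated in degree $0$, i.e. $\mathrm{Hom}_{\mathcal H^b(\mathcal M)}(M,\Sigma^iM')=0$ for all $M,M'\in\mathcal M$ and $i\ne0$; 2) for each $M\in\mathcal M$ there is a monomorphism $M^\wedge\to I^\wedge$ in $\mathrm{Mod}\,\mathcal M$ with $I\in\mathcal I$; 3) for each complex $0\to M_{d+1}\to M_d\to\cdots\to M_1\to M_0$ over $\mathcal M$, if $$\mathrm{Hom}(M_0,I)\to\mathrm{Hom}(M_1,I)\to\cdots\to\mathrm{Hom}(M_{d+1},I)\to0$$ is exact for all $I\in\mathcal I$, then $0\to M_{d+1}^\wedge\to\cdots\to M_1^\wedge\to M_0^\wedge$ is exact in $\mathrm{Mod}\,\mathcal M$. (b) The category $H^0(\mathcal A^{(d+1)}_{\mathcal M,\mathcal I})$, with the sequences $X\to Y\to Z$ that can be completed to a distinguished triangle $X\to Y\to Z\to\Sigma X$ of $\mathcal H^b(\mathcal M)$ as conflations, and the category $\mathrm{mod}_{adm}(\mathcal M)$, with the short exact sequences of $\mathrm{Mod}\,\mathcal M$ with terms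 in $\mathrm{mod}_{adm}(\mathcal M)$ as conflations, are exact categories, and there is a $k$-linear equivalence between them which preserves and reflects conflations. -/

import Mathlib

open CategoryTheory CategoryTheory.Limits

noncomputable section

namespace ExactCT

universe w v u

/-! ### Quillen exact categories -/

section ExactCategories

variable {E : Type u} [Category.{v} E] [Preadditive E]

/-- `i` is an inflation (admissible monomorphism) for the class `conf` of conflations. -/
def IsInflation (conf : ObjectProperty (ShortComplex E)) {X Y : E} (i : X ⟶ Y) : Prop :=
  ∃ (Z : E) (p : Y ⟶ Z) (zero : i ≫ p = 0), conf (ShortComplex.mk i p zero)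

/-- `p` is a deflation (admissible epimorphism) for the class `conf` of conflations. -/
def IsDeflation (conf : ObjectProperty (ShortComplex E)) {Y Z : E} (p : Y ⟶ Z) : Prop :=
  ∃ (X : E) (i : X ⟶ Y) (zero : i ≫ p = 0), conf (ShortComplex.mk i p zero)

/-- `(E, conf)` is an exact category in the sense of Quillen: `E` is additive and `conf` is a
class of kernel-cokernel pairs, closed under isomorphisms, such that identities are inflations and
deflations, inflations and deflations are closed under composition, push-outs of inflations
along arbitrary morphisms exist and are inflations, and dually for deflations. -/
structure IsExactStructure (conf : ObjectProperty (ShortComplex E)) : Prop where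
  hasZeroObject : HasZeroObject E
  hasBinaryBiproducts : HasBinaryBiproducts E
  of_iso : ∀ {S T : ShortComplex E}, (S ≅ T) → conf S → conf T
  isKernel : ∀ {S : ShortComplex E}, conf S → Nonempty (IsLimit (KernelFork.ofι S.f S.zero))
  isCokernel : ∀ {S : ShortComplex E}, conf S →
    Nonempty (IsColimit (CokernelCofork.ofπ S.g S.zero))
  inflation_id : ∀ X : E, IsInflation conf (𝟙 X)
  deflation_id : ∀ X : E, IsDeflation conf (𝟙 X)
  inflation_comp : ∀ {X Y Z : E} (i : X ⟶ Y) (j : Y ⟶ Z),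
    IsInflation conf i → IsInflation conf j → IsInflation conf (i ≫ j)
  deflation_comp : ∀ {X Y Z : E} (p : X ⟶ Y) (q : Y ⟶ Z),
    IsDeflation conf p → IsDeflation conf q → IsDeflation conf (p ≫ q)
  inflation_pushout : ∀ {A B A' : E} (i : A ⟶ B) (f : A ⟶ A'), IsInflation conf i →
    ∃ (B' : E) (f' : B ⟶ B') (i' : A' ⟶ B'), IsPushout i f f' i' ∧ IsInflation conf i'
  deflation_pullback : ∀ {B C C' : E} (p : B ⟶ C) (f : C' ⟶ C), IsDeflation conf p →
    ∃ (B' : E) (f' : B' ⟶ B) (p' : B' ⟶ C'), IsPullback f' p' p f ∧ IsDeflation conf p'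

variable (E) in
/-- `E` is weakly idempotent complete: every retraction has a kernel. -/
def IsWeaklyIdempotentComplete : Prop :=
  ∀ {X Y : E} (r : X ⟶ Y), IsSplitEpi r → HasKernel r

/-- The morphism `f` is admissible: it is a deflation followed by an inflation. -/
def IsAdmissible (conf : ObjectProperty (ShortComplex E)) {X Y : E} (f : X ⟶ Y) : Prop :=
  ∃ (J : E) (p : X ⟶ J) (i : J ⟶ Y), IsDeflation conf p ∧ IsInflation conf i ∧ p ≫ i = f

/-- The class of injective objects of an exact category: every morphism to `J` extends along
every inflation. -/
def injectives (conf : ObjectProperty (ShortComplex E)) : ObjectProperty E := fun J =>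
  ∀ {X Y : E} (i : X ⟶ Y), IsInflation conf i → ∀ f : X ⟶ J, ∃ g : Y ⟶ J, i ≫ g = f

/-- Every object admits an inflation into an injective object. -/
def EnoughInjectives (conf : ObjectProperty (ShortComplex E)) : Prop :=
  ∀ X : E, ∃ (J : E) (i : X ⟶ J), injectives conf J ∧ IsInflation conf i

/-! ### Yoneda extension groups -/

/-- A conflation `Y ⟶ B ⟶ X`. -/
structure Extension (conf : ObjectProperty (ShortComplex E)) (X Y : E) where
  /-- the middle term -/
  B : E
  /-- the inflation -/
  i : Y ⟶ B
  /-- the deflation -/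
  p : B ⟶ X
  zero : i ≫ p = 0
  conflation : conf (ShortComplex.mk i p zero)

/-- `n`-fold Yoneda extensions of `X` by `Y`, that is, for `n ≥ 1`, acyclic complexes
`Y ⟶ Bₙ ⟶ ⋯ ⟶ B₁ ⟶ X`, given as spliced conflations
`K₁ ⟶ B₁ ⟶ X`, `K₂ ⟶ B₂ ⟶ K₁`, …, `Y ⟶ Bₙ ⟶ Kₙ₋₁`. A `0`-fold extension is a morphism `X ⟶ Y`. -/
def NExtension (conf : ObjectProperty (ShortComplex E)) : ℕ → E → E → Type (max u v)
  | 0, X, Y => ULift.{u} (X ⟶ Y)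
  | 1, X, Y => Extension conf X Y
  | n + 2, X, Y => Σ K : E, Extension conf X K × NExtension conf (n + 1) K Y

/-- `NExtension.Rel conf n a s s'` says that there is a morphism of complexes from the `n`-fold
extension `s` of `X` by `Y` to the `n`-fold extension `s'` of `X'` by `Y` which is the identity
on `Y` and which is `a : X ⟶ X'` on the other end. -/
def NExtension.Rel (conf : ObjectProperty (ShortComplex E)) :
    (n : ℕ) → {X X' Y : E} → (X ⟶ X') → NExtension conf n X Y → NExtension conf n X' Y → Prop
  | 0, _, _, _, a, f, g => a ≫ g.down = f.down
  | 1, _, _, _, a, e, e' => ∃ b : Extension.B e ⟶ Extension.B e',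
      Extension.i e ≫ b = Extension.i e' ∧ b ≫ Extension.p e' = Extension.p e ≫ a
  | n + 2, _, _, _, a, ⟨K, e, s⟩, ⟨K', e', s'⟩ => ∃ (c : K ⟶ K') (b : e.B ⟶ e'.B),
      e.i ≫ b = c ≫ e'.i ∧ b ≫ e'.p = e.p ≫ a ∧ NExtension.Rel conf (n + 1) c s s'

/-- The Yoneda extension group `Ext^n(X, Y)` (as a set): the `n`-fold extensions modulo the
equivalence relation generated by the morphisms of extensions which are the identity on both
ends. -/
def YonedaExt (conf : ObjectProperty (ShortComplex E)) (n : ℕ) (X Y : E) : Type (max u v) :=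
  Quot (NExtension.Rel conf n (𝟙 X) (Y := Y))

/-- `Ext^n(X, Y) = 0`: all `n`-fold extensions of `X` by `Y` have the same Yoneda class. -/
def ExtVanishes (conf : ObjectProperty (ShortComplex E)) (n : ℕ) (X Y : E) : Prop :=
  Subsingleton (YonedaExt conf n X Y)

/-- `M` is a `d`-cluster tilting subcategory of the exact category `(E, conf)`. -/
structure IsClusterTilting (conf : ObjectProperty (ShortComplex E)) (d : ℕ)
    (M : ObjectProperty E) : Prop where
  /-- every object has a left `M`-approximation which is an inflation -/
  left_approximation : ∀ X : E, ∃ (N : E) (i : X ⟶ N), M N ∧ IsInflation conf i ∧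
    ∀ (N' : E), M N' → ∀ f : X ⟶ N', ∃ g : N ⟶ N', i ≫ g = f
  /-- every object has a right `M`-approximation which is a deflation -/
  right_approximation : ∀ X : E, ∃ (N : E) (p : N ⟶ X), M N ∧ IsDeflation conf p ∧
    ∀ (N' : E), M N' → ∀ f : N' ⟶ X, ∃ g : N' ⟶ N, g ≫ p = f
  mem_iff_right : ∀ X : E, M X ↔
    ∀ N : E, M N → ∀ i : ℕ, 1 ≤ i → i < d → ExtVanishes conf i N X
  mem_iff_left : ∀ Y : E, M Y ↔
    ∀ N : E, M N → ∀ i : ℕ, 1 ≤ i → i < d → ExtVanishes conf i Y N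

end ExactCategories

/-! ### Cluster tilting pairs

An additive category `P` is regarded as a dg category concentrated in degree `0`, so that its
pretriangulated hull is the dg category of bounded complexes over `P`, whose homotopy category
`tr P` is the bounded homotopy category of `P`. The latter is a full triangulated subcategory of
`HomotopyCategory P (ComplexShape.up ℤ)`, closed under extensions. -/

section Pairs

variable {P : Type u} [Category.{v} P] [Preadditive P] [HasZeroObject P] [HasBinaryBiproducts P]

/-- The object of `tr P` given by `X` placed in degree `0`. -/
abbrev stalk (X : P) : HomotopyCategory P (ComplexShape.up ℤ) :=
  (HomotopyCategory.singleFunctor P 0).obj X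

variable (P) in
/-- The class `Σⁿ P` of objects of `tr P`, closed under isomorphisms. -/
def shiftedStalks (n : ℕ) : ObjectProperty (HomotopyCategory P (ComplexShape.up ℤ)) := fun X =>
  ∃ Q : P, Nonempty (X ≅ (shiftFunctor _ (n : ℤ)).obj (stalk Q))

variable (P) in
/-- The class `P ∗ ΣP ∗ ⋯ ∗ ΣⁿP` of objects of `tr P`. -/
def iteratedExtension : ℕ → ObjectProperty (HomotopyCategory P (ComplexShape.up ℤ))
  | 0 => shiftedStalks P 0
  | n + 1 => (iteratedExtension n).extensionProduct (shiftedStalks P (n + 1))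

/-- The class of objects of `𝒜^(n)_{P,I}`, i.e. `(P ∗ ΣP ∗ ⋯ ∗ ΣⁿP) ∩ ker Ext^{≥ 1}(-, I)`,
where `Ext^i(X, J) = Hom_{tr P}(X, Σⁱ J)`. -/
def classA (I : ObjectProperty P) (n : ℕ) :
    ObjectProperty (HomotopyCategory P (ComplexShape.up ℤ)) := fun X =>
  iteratedExtension P n X ∧
    ∀ J : P, I J → ∀ i : ℕ, 1 ≤ i → ∀ f : X ⟶ (shiftFunctor _ (i : ℤ)).obj (stalk J), f = 0

/-- `H⁰(𝒜^(n)_{P,I})`, a full subcategory of `tr P`. -/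
abbrev HA (I : ObjectProperty P) (n : ℕ) := (classA I n).FullSubcategory

/-- The exact structure of `H⁰(𝒜^(n)_{P,I})` inherited from the pretriangulated hull: the
sequences `X ⟶ Y ⟶ Z` which can be completed to a distinguished triangle
`X ⟶ Y ⟶ Z ⟶ ΣX` of `tr P`. -/
def conflationsHA (I : ObjectProperty P) (n : ℕ) : ObjectProperty (ShortComplex (HA I n)) :=
  fun S => ∃ δ : S.X₃.obj ⟶ (shiftFunctor _ (1 : ℤ)).obj S.X₁.obj,
    Pretriangulated.Triangle.mk S.f.hom S.g.hom δ ∈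
      (Pretriangulated.distinguishedTriangles :
        Set (Pretriangulated.Triangle (HomotopyCategory P (ComplexShape.up ℤ))))

/-- `(P, I)` is a `d`-cluster tilting pair: `I` is an additive full subcategory of `P` (closed
under direct summands), and `I` is covariantly finite in `H⁰(𝒜^(d)_{P,I})`, i.e. every object
of the latter has a left `I`-approximation. -/
structure IsClusterTiltingPair (d : ℕ) (I : ObjectProperty P) : Prop where
  zero_mem : ∀ X : P, IsZero X → I X
  biprod_mem : ∀ X Y : P, I X → I Y → I (X ⊞ Y)
  retract_mem : ∀ X Y : P, Retract X Y → I Y → I X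
  covariantly_finite : ∀ X, classA I d X → ∃ (J : P) (g : X ⟶ stalk J), I J ∧
    ∀ J' : P, I J' → ∀ f : X ⟶ stalk J', ∃ h : stalk J ⟶ stalk J', g ≫ h = f

end Pairs

/-! ### Modules over a linear category -/

section Modules

variable (k : Type w) [CommRing k]

section

variable (P : Type u) [Category.{v} P] [Preadditive P] [Linear k P]

instance linearYoneda_preservesZeroMorphisms :
    (linearYoneda k P).PreservesZeroMorphisms where
  map_zero X Y := by
    ext Z f
    exact comp_zero

/-- The `k`-linear functors `Pᵒᵖ ⥤ k-Mod`, as a property of functors. The full subcategory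
`Mod P` which they form is closed under kernels, cokernels and finite direct sums in the abelian
category of all functors, so that exactness in `Mod P` is exactness in the category of functors. -/
def linearModules : ObjectProperty (Pᵒᵖ ⥤ ModuleCat.{v} k) := fun F =>
  F.Additive ∧ ∀ {X Y : P} (r : k) (f : X ⟶ Y), F.map (r • f).op = r • F.map f.op

/-- The conditions on a pair `(P, I)` which characterize the pairs for which the corresponding
exact dg category is a Quillen exact category. -/
structure SatisfiesQuillenConditions [HasZeroObject P] [HasBinaryBiproducts P]
    (d : ℕ) (I : ObjectProperty P) : Prop where
  /-- `P` is concentrated in degree `0`. -/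
  concentrated : ∀ (X Y : P) (i : ℤ), i ≠ 0 →
    ∀ f : stalk X ⟶ (shiftFunctor _ i).obj (stalk Y), f = 0
  /-- Each representable module embeds into one represented by an object of `I`. -/
  mono : ∀ X : P, ∃ (J : P) (φ : (linearYoneda k P).obj X ⟶ (linearYoneda k P).obj J),
    I J ∧ Mono φ
  /-- For a complex `0 ⟶ P_{d+1} ⟶ ⋯ ⟶ P₁ ⟶ P₀` over `P`, if
  `Hom(P₀, J) ⟶ Hom(P₁, J) ⟶ ⋯ ⟶ Hom(P_{d+1}, J) ⟶ 0` is exact for all `J` in `I`, then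
  `0 ⟶ P_{d+1}^ ⟶ ⋯ ⟶ P₁^ ⟶ P₀^` is exact in `Mod P`. -/
  exact : ∀ K : ChainComplex P ℕ, (∀ n : ℕ, d + 1 < n → IsZero (K.X n)) →
    (∀ J : P, I J → ∀ j : ℕ, j ≤ d → ∀ g : K.X (j + 1) ⟶ J, K.d (j + 2) (j + 1) ≫ g = 0 →
      ∃ h : K.X j ⟶ J, K.d (j + 1) j ≫ h = g) →
    ∀ j : ℕ, j ≤ d → ((K.sc' (j + 2) (j + 1) j).map (linearYoneda k P)).Exact

end

variable {E : Type u} [Category.{v} E] [Preadditive E] [Linear k E]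

/-- The modules `F` in `Mod M` which have a projective presentation `X^ ⟶ Y^ ⟶ F ⟶ 0` induced
by a morphism `X ⟶ Y` of `M` which is admissible in the exact category `(E, conf)`. -/
def modAdm (conf : ObjectProperty (ShortComplex E)) (M : ObjectProperty E) :
    ObjectProperty (M.FullSubcategoryᵒᵖ ⥤ ModuleCat.{v} k) := fun F =>
  linearModules k M.FullSubcategory F ∧
    ∃ (X Y : M.FullSubcategory) (f : X ⟶ Y)
      (π : (linearYoneda k M.FullSubcategory).obj Y ⟶ F)
      (zero : (linearYoneda k M.FullSubcategory).map f ≫ π = 0),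
      IsAdmissible conf f.hom ∧ (ShortComplex.mk _ π zero).Exact ∧ Epi π

/-- The category `mod_adm(M)`. -/
abbrev ModAdm (conf : ObjectProperty (ShortComplex E)) (M : ObjectProperty E) :=
  (modAdm k conf M).FullSubcategory

/-- The exact structure of `mod_adm(M)` as an extension-closed subcategory of `Mod M`: the short
exact sequences of modules with terms in `mod_adm(M)`. -/
def conflationsModAdm (conf : ObjectProperty (ShortComplex E)) (M : ObjectProperty E) :
    ObjectProperty (ShortComplex (ModAdm k conf M)) :=
  fun S => (S.map (modAdm k conf M).ι).ShortExact

end Modules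

/-- There is a `k`-linear equivalence of categories `C ≌ D` which preserves and reflects
conflations. -/
def ExactEquivalent (k : Type w) [CommRing k]
    {C : Type*} [Category* C] [Preadditive C] [Linear k C] (confC : ObjectProperty (ShortComplex C))
    {D : Type*} [Category* D] [Preadditive D] [Linear k D]
    (confD : ObjectProperty (ShortComplex D)) : Prop :=
  ∃ (e : C ≌ D) (_ : e.functor.Additive), e.functor.Linear k ∧
    ∀ S : ShortComplex C, confC S ↔ confD (S.map e.functor)

end ExactCT

end

/-! The objects of `H⁰(𝒜^(n))` are totalizations `Y` of complexes `Xₙ ⟶ ⋯ ⟶ X₀` over `M`. As `M` is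
concentrated in degree `0`, the vanishing of `Ext^i(Y, J)` for all `i ≥ 1` means that the dual
complex `Hom(X, J)` is exact away from `X₀` (`IsTotalization.exists_extension`,
`IsTotalization.homZero_of_exists_extension`). If this holds for all injectives `J`, the complex is
spliced from conflations of `E` (`exists_isAcyclicResolution`): from the left end onwards, each map
`L' ⟶ X₀` out of a cokernel is an inflation, because an inflation of `L'` into an injective extends
over it and `E` is weakly idempotent complete. So `Y` amounts to an acyclic complex `Xₙ ⟶ ⋯ ⟶ X₀ ⟶
L`, and composing `X₀ ⟶ L` with an inflation of `L` into an injective yields the left approximation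
of `Y`.

Cluster tilting enters through the vanishing of `Ext^i(N, X_j)` for `0 < i < d` and `N` in `M`: the
functor `Hom(N, -)` stays exact, except on the right, on acyclic complexes over `M` with at most `d
+ 2` terms (`IsClusterTilting.exists_lift_of_comp_d_eq_zero`). This is condition 3), and for objects
of `H⁰(𝒜^(d+1))` it says that `Hom(N, Y⟦i⟧) = 0` for `i ≠ 0`. Hence `Y` is determined by the module
`Hom(-, Y)` on `M`, which is presented by the admissible morphism `X₁ ⟶ X₀`. Conversely, the kernel
of the deflation part of an admissible morphism has a resolution by `d` objects of `M`, obtained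
from iterated right approximations; totalizing the resulting complex gives essential surjectivity
onto `mod_adm(M)`.

Distinguished triangles then correspond to short exact sequences of modules, and the essential image
is closed under extensions in `Mod M` because an extension of modules can be realized by a triangle
(`IsTotalization.exists_distTriang_of_extension`). Both exact structures are therefore instances of
the one on an extension-closed subcategory of an abelian category
(`isExactStructure_shortExactInverseImage`). -/

noncomputable section

namespace ExactCT

universe w v u

/-! ### Elementary properties of conflations. -/

section Conflations

variable {E : Type u} [Category.{v} E] [Preadditive E]

/-- `A ⟶ B ⟶ C` is a conflation. -/
def IsConflation (conf : ObjectProperty (ShortComplex E)) {A B C : E} (i : A ⟶ B) (p : B ⟶ C) :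
    Prop :=
  ∃ zero : i ≫ p = 0, conf (ShortComplex.mk i p zero)

variable {conf : ObjectProperty (ShortComplex E)}

lemma IsInflation.exists_conflation {A B : E} {i : A ⟶ B} (hi : IsInflation conf i) :
    ∃ (C : E) (p : B ⟶ C), IsConflation conf i p := by
  obtain ⟨C, p, z, hc⟩ := hi
  exact ⟨C, p, z, hc⟩

lemma IsDeflation.exists_conflation {B C : E} {p : B ⟶ C} (hp : IsDeflation conf p) :
    ∃ (A : E) (i : A ⟶ B), IsConflation conf i p := by
  obtain ⟨A, i, z, hc⟩ := hp
  exact ⟨A, i, z, hc⟩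

namespace IsConflation

section

variable {A B C : E} {i : A ⟶ B} {p : B ⟶ C} (hc : IsConflation conf i p)

include hc

lemma zero : i ≫ p = 0 := hc.1

lemma isInflation : IsInflation conf i := ⟨C, p, hc.1, hc.2⟩

lemma isDeflation : IsDeflation conf p := ⟨A, i, hc.1, hc.2⟩

variable (h : IsExactStructure conf)

include h

lemma exists_lift {T : E} (k : T ⟶ B) (hk : k ≫ p = 0) : ∃ l : T ⟶ A, l ≫ i = k := by
  obtain ⟨hl⟩ := h.isKernel hc.2
  exact ⟨hl.lift (KernelFork.ofι k hk), hl.fac _ WalkingParallelPair.zero⟩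

lemma exists_desc {T : E} (k : B ⟶ T) (hk : i ≫ k = 0) : ∃ l : C ⟶ T, p ≫ l = k := by
  obtain ⟨hl⟩ := h.isCokernel hc.2
  exact ⟨hl.desc (CokernelCofork.ofπ k hk), hl.fac _ WalkingParallelPair.one⟩

lemma mono : Mono i := by
  obtain ⟨hl⟩ := h.isKernel hc.2
  exact mono_of_isLimit_fork hl

lemma epi : Epi p := by
  obtain ⟨hl⟩ := h.isCokernel hc.2
  exact epi_of_isColimit_cofork hl

end

end IsConflation

namespace IsExactStructure

variable (h : IsExactStructure conf)

include h

lemma isConflation_of_iso {A B C A' B' C' : E} {i : A ⟶ B} {p : B ⟶ C} {i' : A' ⟶ B'}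
    {p' : B' ⟶ C'} (hc : IsConflation conf i p) (a : A ≅ A') (b : B ≅ B') (c : C ≅ C')
    (hi : i ≫ b.hom = a.hom ≫ i') (hp : p ≫ c.hom = b.hom ≫ p') : IsConflation conf i' p' := by
  have hz : i' ≫ p' = 0 := by
    rw [← cancel_epi a.hom, ← reassoc_of% hi, ← hp, reassoc_of% hc.zero]
    simp
  exact ⟨hz, h.of_iso (ShortComplex.isoMk a b c hi.symm hp.symm) hc.2⟩

/-- Cokernels are unique up to isomorphism, and conflations are stable under isomorphism. -/
lemma isConflation_of_cokernel {A B C : E} {i : A ⟶ B} {p : B ⟶ C} (hi : IsInflation conf i)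
    (z : i ≫ p = 0) (hp : Epi p)
    (hd : ∀ {T : E} (k : B ⟶ T), i ≫ k = 0 → ∃ l : C ⟶ T, p ≫ l = k) : IsConflation conf i p := by
  obtain ⟨D, q, hq⟩ := hi.exists_conflation
  have := hq.epi h
  obtain ⟨l, hl⟩ := hq.exists_desc h p z
  obtain ⟨m, hm⟩ := hd q hq.zero
  refine h.isConflation_of_iso hq (Iso.refl _) (Iso.refl _) ⟨l, m, ?_, ?_⟩ (by simp) (by simpa)
  · rw [← cancel_epi q, reassoc_of% hl, hm, Category.comp_id]
  · rw [← cancel_epi p, reassoc_of% hm, hl, Category.comp_id]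

lemma isConflation_of_kernel {A B C : E} {i : A ⟶ B} {p : B ⟶ C} (hp : IsDeflation conf p)
    (z : i ≫ p = 0) (hi : Mono i)
    (hd : ∀ {T : E} (k : T ⟶ B), k ≫ p = 0 → ∃ l : T ⟶ A, l ≫ i = k) : IsConflation conf i p := by
  obtain ⟨D, j, hj⟩ := hp.exists_conflation
  have := hj.mono h
  obtain ⟨l, hl⟩ := hj.exists_lift h i z
  obtain ⟨m, hm⟩ := hd j hj.zero
  refine h.isConflation_of_iso hj ⟨m, l, ?_, ?_⟩ (Iso.refl _) (Iso.refl _) (by simpa using hm.symm)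
    (by simp)
  · rw [← cancel_mono j, Category.assoc, hl, hm, Category.id_comp]
  · rw [← cancel_mono i, Category.assoc, hm, hl, Category.id_comp]

lemma isInflation_of_isIso {A B : E} (f : A ⟶ B) [IsIso f] : IsInflation conf f := by
  obtain ⟨C, p, hp⟩ := (h.inflation_id A).exists_conflation
  exact (h.isConflation_of_iso hp (Iso.refl _) (asIso f) (Iso.refl _) (p' := inv f ≫ p)
    (by simp) (by simp)).isInflation

lemma isDeflation_of_isIso {A B : E} (f : A ⟶ B) [IsIso f] : IsDeflation conf f := by
  obtain ⟨C, p, hp⟩ := (h.deflation_id B).exists_conflation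
  exact (h.isConflation_of_iso hp (Iso.refl _) (asIso (inv f)) (Iso.refl _) (i' := p ≫ inv f)
    (by simp) (by simp)).isDeflation

lemma exists_pushout {A B C A' : E} {i : A ⟶ B} {p : B ⟶ C} (hc : IsConflation conf i p)
    (a : A ⟶ A') : ∃ (B' : E) (b : B ⟶ B') (i' : A' ⟶ B') (p' : B' ⟶ C),
      IsPushout i a b i' ∧ IsConflation conf i' p' ∧ b ≫ p' = p := by
  obtain ⟨B', b, i', hB, hi'⟩ := h.inflation_pushout i a hc.isInflation
  have hz : i ≫ p = a ≫ (0 : A' ⟶ C) := by rw [hc.zero, comp_zero]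
  have := hc.epi h
  have hb : b ≫ hB.desc p 0 hz = p := hB.inl_desc _ _ _
  refine ⟨B', b, i', hB.desc p 0 hz, hB, h.isConflation_of_cokernel hi' (hB.inr_desc _ _ _)
    (epi_of_epi_fac hb) fun k hk => ?_, hb⟩
  obtain ⟨l, hl⟩ := hc.exists_desc h (b ≫ k) (by rw [hB.w_assoc, hk, comp_zero])
  refine ⟨l, hB.hom_ext (by rw [reassoc_of% hb, hl]) ?_⟩
  rw [hB.inr_desc_assoc, hk, zero_comp]

lemma exists_pullback {A B C C' : E} {i : A ⟶ B} {p : B ⟶ C} (hc : IsConflation conf i p)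
    (c : C' ⟶ C) : ∃ (B' : E) (b : B' ⟶ B) (i' : A ⟶ B') (p' : B' ⟶ C'),
      IsPullback b p' p c ∧ IsConflation conf i' p' ∧ i' ≫ b = i := by
  obtain ⟨B', b, p', hB, hp'⟩ := h.deflation_pullback p c hc.isDeflation
  have hz : i ≫ p = (0 : A ⟶ C') ≫ c := by rw [hc.zero, zero_comp]
  have := hc.mono h
  have hb : hB.lift i 0 hz ≫ b = i := hB.lift_fst _ _ _
  refine ⟨B', b, hB.lift i 0 hz, p', hB, h.isConflation_of_kernel hp' (hB.lift_snd _ _ _)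
    (mono_of_mono_fac hb) fun k hk => ?_, hb⟩
  obtain ⟨l, hl⟩ := hc.exists_lift h (k ≫ b) (by rw [Category.assoc, hB.w, reassoc_of% hk, zero_comp])
  refine ⟨l, hB.hom_ext (by rw [Category.assoc, hb, hl]) ?_⟩
  rw [Category.assoc, hB.lift_snd, hk, comp_zero]

/-- The pushout of a conflation `B ⟶ I ⟶ D` along the deflation of a conflation `A ⟶ B ⟶ C`. -/
lemma exists_rotation {A B C I D : E} {i : A ⟶ B} {p : B ⟶ C} (hc : IsConflation conf i p)
    {j : B ⟶ I} {q : I ⟶ D} (hj : IsConflation conf j q) :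
    ∃ (A' : E) (u : I ⟶ A') (s : C ⟶ A') (t : A' ⟶ D), p ≫ s = j ≫ u ∧
      IsConflation conf (i ≫ j) u ∧ IsConflation conf s t ∧ u ≫ t = q := by
  obtain ⟨A', u, s, t, hA, hst, hut⟩ := h.exists_pushout hj p
  have := hc.epi h
  refine ⟨A', u, s, t, hA.w.symm, h.isConflation_of_cokernel
    (h.inflation_comp _ _ hc.isInflation hj.isInflation) ?_ ⟨fun x y hxy => ?_⟩ fun k hk => ?_,
    hst, hut⟩
  · rw [Category.assoc, hA.w, reassoc_of% hc.zero, zero_comp]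
  · refine hA.hom_ext hxy ?_
    rw [← cancel_epi p, ← hA.w_assoc, ← hA.w_assoc, hxy]
  · obtain ⟨l, hl⟩ := hc.exists_desc h (j ≫ k) (by rw [← Category.assoc, hk])
    exact ⟨hA.desc k l hl.symm, hA.inl_desc _ _ _⟩

lemma isDeflation_of_isPullback {B C B' C' : E} {p : B ⟶ C} {c : C' ⟶ C} {b : B' ⟶ B}
    {p' : B' ⟶ C'} (hp : IsDeflation conf p) (hB : IsPullback b p' p c) : IsDeflation conf p' := by
  obtain ⟨B'', b', q, hB', hq⟩ := h.deflation_pullback p c hp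
  have := h.deflation_comp _ _ (h.isDeflation_of_isIso (hB.isoIsPullback _ _ hB').hom) hq
  rwa [IsPullback.isoIsPullback_hom_snd] at this

lemma isInflation_of_isPushout {A B A' B' : E} {i : A ⟶ B} {a : A ⟶ A'} {b : B ⟶ B'}
    {i' : A' ⟶ B'} (hi : IsInflation conf i) (hB : IsPushout i a b i') : IsInflation conf i' := by
  obtain ⟨B'', b', q, hB', hq⟩ := h.inflation_pushout i a hi
  have := h.inflation_comp _ _ hq (h.isInflation_of_isIso (hB.isoIsPushout _ _ hB').inv)
  rwa [IsPushout.inr_isoIsPushout_inv] at this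

lemma isConflation_id_zero {X Z : E} (hZ : IsZero Z) : IsConflation conf (𝟙 X) (0 : X ⟶ Z) := by
  refine h.isConflation_of_cokernel (h.inflation_id X) comp_zero ⟨fun _ _ _ => hZ.eq_of_src _ _⟩
    fun k hk => ⟨0, ?_⟩
  rw [comp_zero, ← hk, Category.id_comp]

lemma isConflation_zero_id {X Z : E} (hZ : IsZero Z) : IsConflation conf (0 : Z ⟶ X) (𝟙 X) := by
  refine h.isConflation_of_kernel (h.deflation_id X) zero_comp ⟨fun _ _ _ => hZ.eq_of_tgt _ _⟩
    fun k hk => ⟨0, ?_⟩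
  rw [zero_comp, ← hk, Category.comp_id]

lemma isConflation_biprod [HasBinaryBiproducts E] (X Y : E) :
    IsConflation conf (biprod.inl : X ⟶ X ⊞ Y) (biprod.snd : X ⊞ Y ⟶ Y) := by
  have := h.hasZeroObject
  obtain ⟨Z, hZ⟩ := HasZeroObject.zero (C := E)
  have hp : IsDeflation conf (biprod.snd : X ⊞ Y ⟶ Y) := by
    refine h.isDeflation_of_isPullback (h.isConflation_id_zero (X := X) hZ).isDeflation
      (b := biprod.fst) (c := (0 : Y ⟶ Z)) ⟨⟨by simp⟩, ⟨PullbackCone.IsLimit.mk _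
        (fun s => biprod.lift s.fst s.snd) (by simp) (by simp) fun s m h₁ h₂ => ?_⟩⟩
    ext <;> simp [h₁, h₂]
  refine h.isConflation_of_kernel hp (by simp) inferInstance fun k hk => ⟨k ≫ biprod.fst, ?_⟩
  ext <;> simp [hk]

/-- In a weakly idempotent complete exact category, a morphism `f` such that `f ≫ g` is an
inflation is an inflation. -/
lemma isInflation_of_comp (hwic : IsWeaklyIdempotentComplete E) {A B C : E} (f : A ⟶ B)
    (g : B ⟶ C) (hfg : IsInflation conf (f ≫ g)) : IsInflation conf f := by
  have := h.hasBinaryBiproducts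
  -- The graph of `f` is a coordinate inclusion followed by an isomorphism `A ⊞ B ≅ B ⊞ A`.
  have h₁ : IsInflation conf (biprod.lift f (𝟙 A)) := by
    have e : biprod.lift f (𝟙 A) =
        biprod.inl ≫ biprod.desc (biprod.lift f (𝟙 A)) (biprod.inl : B ⟶ B ⊞ A) := by simp
    have : IsIso (biprod.desc (biprod.lift f (𝟙 A)) (biprod.inl : B ⟶ B ⊞ A)) :=
      ⟨biprod.lift biprod.snd (biprod.fst - biprod.snd ≫ f), by ext <;> simp, by ext <;> simp⟩
    rw [e]
    exact h.inflation_comp _ _ (h.isConflation_biprod A B).isInflation (h.isInflation_of_isIso _)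
  -- This is the pushout of `f ≫ g` along `inr`.
  have h₂ : IsInflation conf (biprod.map (𝟙 B) (f ≫ g)) := by
    refine h.isInflation_of_isPushout hfg (a := biprod.inr) (b := biprod.inr) ⟨⟨by simp⟩,
      ⟨PushoutCocone.IsColimit.mk _ (fun s => biprod.desc (biprod.inl ≫ s.inr) s.inl) (by simp)
        (fun s => ?_) fun s m h₁ h₂ => ?_⟩⟩
    · ext
      · simp
      · simpa using s.condition
    · ext
      · simp [← h₂]
      · simp [h₁]
  -- A shear of `B ⊞ C` turns `(f, f ≫ g)` into `(f, 0)`.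
  have h₃ : IsInflation conf (biprod.lift f (0 : A ⟶ C)) := by
    have e : biprod.lift f (0 : A ⟶ C) = (biprod.lift f (𝟙 A) ≫ biprod.map (𝟙 B) (f ≫ g)) ≫
        biprod.lift biprod.fst (biprod.snd - biprod.fst ≫ g) := by
      ext <;> simp
    have : IsIso (biprod.lift biprod.fst (biprod.snd - biprod.fst ≫ g) : B ⊞ C ⟶ B ⊞ C) :=
      ⟨biprod.lift biprod.fst (biprod.snd + biprod.fst ≫ g), by ext <;> simp, by ext <;> simp⟩
    rw [e]
    exact h.inflation_comp _ _ (h.inflation_comp _ _ h₁ h₂) (h.isInflation_of_isIso _)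
  obtain ⟨Q, q, hq⟩ := h₃.exists_conflation
  have := hq.epi h
  -- The cokernel of `(f, 0)` retracts onto `C` by `r`, so `r` has a kernel. The map `B ⟶ ker r` is
  -- a pullback of the deflation `q`, hence a deflation, and `f` is its kernel.
  obtain ⟨r, hr⟩ := hq.exists_desc h biprod.snd (by simp)
  have hsplit : (biprod.inr ≫ q) ≫ r = 𝟙 C := by rw [Category.assoc, hr, biprod.inr_snd]
  have := hwic r (IsSplitEpi.mk' ⟨_, hsplit⟩)
  let κ : B ⟶ kernel r := kernel.lift r (biprod.inl ≫ q) (by rw [Category.assoc, hr, biprod.inl_snd])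
  have hκ : κ ≫ kernel.ι r = biprod.inl ≫ q := kernel.lift_ι _ _ _
  have hpb : IsPullback biprod.inl κ q (kernel.ι r) := by
    refine ⟨⟨hκ.symm⟩, ⟨PullbackCone.IsLimit.mk _ (fun s => s.fst ≫ biprod.fst) (fun s => ?_)
      (fun s => ?_) fun s m h₁ h₂ => ?_⟩⟩
    · have : s.fst ≫ biprod.snd = 0 := by
        rw [← hr, reassoc_of% s.condition, kernel.condition, comp_zero]
      ext <;> simp [this]
    · have : s.fst ≫ biprod.snd = 0 := by
        rw [← hr, reassoc_of% s.condition, kernel.condition, comp_zero]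
      have e : (s.fst ≫ biprod.fst) ≫ biprod.inl = s.fst := by ext <;> simp [this]
      rw [← cancel_mono (kernel.ι r), Category.assoc, hκ, ← Category.assoc, e, s.condition]
    · simp [← h₁]
  have hinl : f ≫ biprod.inl = biprod.lift f (0 : A ⟶ C) := by ext <;> simp
  have hm := hq.mono h
  refine (h.isConflation_of_kernel (h.isDeflation_of_isPullback hq.isDeflation hpb) (i := f) ?_ ?_
    fun k hk => ?_).isInflation
  · rw [← cancel_mono (kernel.ι r), Category.assoc, hκ, reassoc_of% hinl, hq.zero, zero_comp]
  · exact mono_of_mono_fac hinl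
  · obtain ⟨l, hl⟩ := hq.exists_lift h (k ≫ biprod.inl)
      (by rw [Category.assoc, ← hκ, reassoc_of% hk, zero_comp])
    refine ⟨l, ?_⟩
    rw [← cancel_mono (biprod.inl : B ⟶ B ⊞ C), Category.assoc, hinl, hl]

end IsExactStructure

end Conflations

/-! ### Yoneda extensions computed by injective coresolutions, and their long exact sequence. -/

section YonedaExtensions

variable {E : Type u} [Category.{v} E] [Preadditive E] {conf : ObjectProperty (ShortComplex E)}

lemma Extension.isConflation {X Y : E} (e : Extension conf X Y) : IsConflation conf e.i e.p :=
  ⟨e.zero, e.conflation⟩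

/-- The extension given by a conflation. -/
def IsConflation.extension {A B C : E} {i : A ⟶ B} {p : B ⟶ C} (hc : IsConflation conf i p) :
    Extension conf C A :=
  ⟨B, i, p, hc.1, hc.2⟩

namespace NExtension

/-- All middle terms of the extension are injective. -/
def HasInjectiveTerms : (n : ℕ) → {X Y : E} → NExtension conf n X Y → Prop
  | 0, _, _, _ => True
  | 1, _, _, e => injectives conf (Extension.B e)
  | n + 2, _, _, ⟨_, e, s⟩ => injectives conf e.B ∧ HasInjectiveTerms (n + 1) s

/-- The first conflation of an extension. -/
def head : (n : ℕ) → {X Y : E} → NExtension conf (n + 1) X Y → Σ K : E, Extension conf X K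
  | 0, _, Y, e => ⟨Y, e⟩
  | _ + 1, _, _, ⟨K, e, _⟩ => ⟨K, e⟩

/-- Splicing with a conflation on the side of the second argument. -/
def splice : (n : ℕ) → {X Y Y' : E} → NExtension conf (n + 1) X Y → Extension conf Y Y' →
    NExtension conf (n + 2) X Y'
  | 0, _, Y, _, e, f => ⟨Y, e, f⟩
  | n + 1, _, _, _, ⟨K, e, s⟩, f => ⟨K, e, splice n s f⟩

lemma HasInjectiveTerms.splice : ∀ (n : ℕ) {X Y Y' : E} (s : NExtension conf (n + 1) X Y)
    (f : Extension conf Y Y'), HasInjectiveTerms (n + 1) s → injectives conf f.B →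
    HasInjectiveTerms (n + 2) (splice n s f)
  | 0, _, _, _, _, _, hs, hf => ⟨hs, hf⟩
  | n + 1, _, _, _, ⟨_, _, s⟩, f, hs, hf => ⟨hs.1, HasInjectiveTerms.splice n s f hs.2 hf⟩

/-- A morphism factors through the first deflation of an extension. -/
def Factors (n : ℕ) {W X Y : E} (s : NExtension conf (n + 1) X Y) (a : W ⟶ X) : Prop :=
  ∃ g : W ⟶ (head n s).2.B, g ≫ (head n s).2.p = a

lemma factors_splice (n : ℕ) {W X Y Y' : E} (s : NExtension conf (n + 1) X Y)
    (f : Extension conf Y Y') (a : W ⟶ X) :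
    Factors (n + 1) (splice n s f) a ↔ Factors n s a := by
  cases n <;> exact Iff.rfl

lemma Factors.add {n : ℕ} {W X Y : E} {s : NExtension conf (n + 1) X Y} {a b : W ⟶ X}
    (ha : Factors n s a) (hb : Factors n s b) : Factors n s (a + b) := by
  obtain ⟨g, hg⟩ := ha
  obtain ⟨g', hg'⟩ := hb
  exact ⟨g + g', by rw [Preadditive.add_comp, hg, hg']⟩

lemma Rel.comp : ∀ {n : ℕ} {X X' X'' Y : E} {a : X ⟶ X'} {b : X' ⟶ X''}
    {s : NExtension conf n X Y} {s' : NExtension conf n X' Y} {s'' : NExtension conf n X'' Y},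
    Rel conf n a s s' → Rel conf n b s' s'' → Rel conf n (a ≫ b) s s''
  | 0, _, _, _, _, a, b, s, s', s'', h₁, h₂ => by
    change a ≫ s'.down = s.down at h₁
    change b ≫ s''.down = s'.down at h₂
    change (a ≫ b) ≫ s''.down = s.down
    rw [Category.assoc, h₂, h₁]
  | 1, _, _, _, _, a, b, s, s', s'', ⟨β, h₁, h₂⟩, ⟨β', h₁', h₂'⟩ =>
    ⟨β ≫ β', by rw [reassoc_of% h₁, h₁'], by rw [Category.assoc, h₂', reassoc_of% h₂]⟩
  | n + 2, _, _, _, _, a, b, ⟨_, e, s⟩, ⟨_, e', s'⟩, ⟨_, e'', s''⟩, ⟨γ, β, h₁, h₂, h₃⟩,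
      ⟨γ', β', h₁', h₂', h₃'⟩ =>
    ⟨γ ≫ γ', β ≫ β', by rw [reassoc_of% h₁, h₁', Category.assoc],
      by rw [Category.assoc, h₂', reassoc_of% h₂], h₃.comp h₃'⟩

/-- Only the component next to `X` changes, by `e.p ≫ g`, which vanishes after `e.i`. -/
lemma Rel.add_of_factors : ∀ {n : ℕ} {X X' Y : E} {a b : X ⟶ X'}
    {s : NExtension conf (n + 1) X Y} {s' : NExtension conf (n + 1) X' Y},
    Rel conf (n + 1) a s s' → Factors n s' b → Rel conf (n + 1) (a + b) s s'
  | 0, X, _, _, _, b, e, e', ⟨β, h₁, h₂⟩, hf => by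
    obtain ⟨g, hg⟩ : ∃ g : X ⟶ Extension.B e', g ≫ Extension.p e' = b := hf
    refine ⟨β + Extension.p e ≫ g, ?_, ?_⟩
    · rw [Preadditive.comp_add, h₁, reassoc_of% Extension.zero e, zero_comp, add_zero]
    · rw [Preadditive.add_comp, Preadditive.comp_add, h₂, Category.assoc, hg]
  | n + 1, X, _, _, _, b, ⟨_, e, s⟩, ⟨_, e', s'⟩, ⟨γ, β, h₁, h₂, h₃⟩, hf => by
    obtain ⟨g, hg⟩ : ∃ g : X ⟶ e'.B, g ≫ e'.p = b := hf
    refine ⟨γ, β + e.p ≫ g, ?_, ?_, h₃⟩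
    · rw [Preadditive.comp_add, h₁, reassoc_of% e.zero, zero_comp, add_zero]
    · rw [Preadditive.add_comp, Preadditive.comp_add, h₂, Category.assoc, hg]

variable (h : IsExactStructure conf)

include h

/-- Comparison theorem: the components are extended from `Y` onwards along inflations into the
injective terms, and the last one induces `a` on the quotients. -/
lemma exists_rel : ∀ {n : ℕ} {X X' Y : E} (s : NExtension conf (n + 1) X Y)
    (t : NExtension conf (n + 1) X' Y), HasInjectiveTerms (n + 1) t →
    ∃ a : X ⟶ X', Rel conf (n + 1) a s t
  | 0, _, _, _, e, e', ht => by
    obtain ⟨b, hb⟩ := ht _ (Extension.isConflation e).isInflation (Extension.i e')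
    obtain ⟨a, ha⟩ := (Extension.isConflation e).exists_desc h (b ≫ Extension.p e')
      (by rw [reassoc_of% hb, Extension.zero e'])
    exact ⟨a, b, hb, ha.symm⟩
  | n + 1, _, _, _, ⟨_, e, s⟩, ⟨_, e', s'⟩, ⟨ht, ht'⟩ => by
    obtain ⟨c, hc⟩ := exists_rel s s' ht'
    obtain ⟨b, hb⟩ := ht _ e.isConflation.isInflation (c ≫ e'.i)
    obtain ⟨a, ha⟩ := e.isConflation.exists_desc h (b ≫ e'.p)
      (by rw [reassoc_of% hb, e'.zero, comp_zero])
    exact ⟨a, c, b, hb, ha.symm, hc⟩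

/-- Two comparison morphisms into injective terms are homotopic, and the end of the homotopy
provides the factorization. -/
lemma Rel.factors_sub : ∀ {n : ℕ} {X X' Y : E} {s : NExtension conf (n + 1) X Y}
    {t : NExtension conf (n + 1) X' Y}, HasInjectiveTerms (n + 1) t → ∀ {a b : X ⟶ X'},
    Rel conf (n + 1) a s t → Rel conf (n + 1) b s t → Factors n t (a - b)
  | 0, _, _, _, e, e', ht, a, b, ⟨β, h₁, h₂⟩, ⟨β', h₁', h₂'⟩ => by
    have hc := Extension.isConflation e
    have := hc.epi h
    obtain ⟨g, hg⟩ := hc.exists_desc h (β - β') (by rw [Preadditive.comp_sub, h₁, h₁', sub_self])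
    refine ⟨g, ?_⟩
    change g ≫ Extension.p e' = _
    rw [← cancel_epi (Extension.p e), reassoc_of% hg, Preadditive.sub_comp, h₂, h₂',
      Preadditive.comp_sub]
  | n + 1, _, _, _, ⟨_, e, s⟩, ⟨_, e', s'⟩, ⟨ht, ht'⟩, a, b, ⟨γ, β, h₁, h₂, h₃⟩,
      ⟨γ', β', h₁', h₂', h₃'⟩ => by
    have hc := e.isConflation
    have := hc.epi h
    obtain ⟨f, hf⟩ := Rel.factors_sub ht' h₃ h₃'
    have hinj : injectives conf (head n s').2.B := by
      cases n
      · exact ht'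
      · exact ht'.1
    obtain ⟨f', hf'⟩ := hinj _ hc.isInflation f
    obtain ⟨g, hg⟩ := hc.exists_desc h (β - β' - f' ≫ (head n s').2.p ≫ e'.i) (by
      simp only [Preadditive.comp_sub, h₁, h₁', reassoc_of% hf', reassoc_of% hf,
        Preadditive.sub_comp, sub_self])
    refine ⟨g, ?_⟩
    change g ≫ e'.p = _
    rw [← cancel_epi e.p, reassoc_of% hg, Preadditive.sub_comp, Preadditive.sub_comp, h₂, h₂',
      Preadditive.comp_sub, Category.assoc, Category.assoc, e'.zero, comp_zero, comp_zero, sub_zero]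

/-- Only the first conflation is pulled back; the universal property of the pullback square makes
the new extension cartesian over `a`. -/
lemma exists_pullback : ∀ {n : ℕ} {X X' Y : E} (t : NExtension conf (n + 1) X' Y) (a : X ⟶ X'),
    ∃ s : NExtension conf (n + 1) X Y, Rel conf (n + 1) a s t ∧
      ∀ {W : E} (w : W ⟶ X) (s' : NExtension conf (n + 1) W Y),
        Rel conf (n + 1) (w ≫ a) s' t → Rel conf (n + 1) w s' s
  | 0, _, _, _, e, a => by
    obtain ⟨B, b, i, p, hB, hc, hb⟩ := h.exists_pullback (Extension.isConflation e) a
    refine ⟨hc.extension, ⟨b, hb, hB.w⟩, fun {W} w s' ⟨β, h₁, h₂⟩ => ?_⟩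
    have hw : β ≫ Extension.p e = (Extension.p s' ≫ w) ≫ a := by rw [h₂, Category.assoc]
    have hi : Extension.i s' ≫ hB.lift β _ hw = i := by
      refine hB.hom_ext ?_ ?_
      · rw [Category.assoc, hB.lift_fst, h₁, hb]
      · rw [Category.assoc, hB.lift_snd, reassoc_of% (Extension.zero s'), zero_comp, hc.zero]
    exact ⟨hB.lift β _ hw, hi, hB.lift_snd _ _ _⟩
  | n + 1, _, _, _, ⟨K, e, t⟩, a => by
    obtain ⟨B, b, i, p, hB, hc, hb⟩ := h.exists_pullback e.isConflation a
    have hid : ∀ {m : ℕ} {X Y : E} (t : NExtension conf m X Y), Rel conf m (𝟙 X) t t := by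
      intro m
      induction m using Nat.twoStepInduction with
      | zero => exact fun t => Category.id_comp _
      | one => exact fun t => ⟨𝟙 _, by simp, by simp⟩
      | more m _ ih => exact fun t => ⟨𝟙 _, 𝟙 _, by simp, by simp, ih _⟩
    refine ⟨⟨K, hc.extension, t⟩, ⟨𝟙 K, b, ?_, hB.w, hid t⟩, fun {W} w s' => ?_⟩
    · rw [Category.id_comp]
      exact hb
    obtain ⟨_, e', s'⟩ := s'
    rintro ⟨γ, β, h₁, h₂, h₃⟩
    have hw : β ≫ e.p = (e'.p ≫ w) ≫ a := by rw [h₂, Category.assoc]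
    have hi : e'.i ≫ hB.lift β _ hw = γ ≫ i := by
      refine hB.hom_ext ?_ ?_
      · rw [Category.assoc, hB.lift_fst, h₁, Category.assoc, hb]
      · rw [Category.assoc, hB.lift_snd, reassoc_of% e'.zero, zero_comp, Category.assoc, hc.zero,
          comp_zero]
    exact ⟨γ, hB.lift β _ hw, hi, hB.lift_snd _ _ _, h₃⟩

end NExtension

open NExtension

variable (h : IsExactStructure conf)

include h

/-- Here `Z` is the `(n + 1)`-st cosyzygy of `Y`, and `Ext^(n+1)(X, Y)` is `Hom(X, Z)` modulo the
morphisms which factor through the last injective term. The argument works on Yoneda classes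
directly, without a group structure. -/
lemma extVanishes_iff_factors {n : ℕ} {X Y Z : E} (t : NExtension conf (n + 1) Z Y)
    (ht : HasInjectiveTerms (n + 1) t) :
    ExtVanishes conf (n + 1) X Y ↔ ∀ a : X ⟶ Z, Factors n t a := by
  constructor
  · intro hX a
    obtain ⟨s, hs, -⟩ := exists_pullback h t a
    obtain ⟨s₀, hs₀, -⟩ := exists_pullback h t (0 : X ⟶ Z)
    -- Whether a comparison morphism to `t` factors depends only on the Yoneda class. This is
    -- applied to the pullbacks of `t` along `0` and along `a`.
    have key : ∀ s s' : NExtension conf (n + 1) X Y,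
        Relation.EqvGen (Rel conf (n + 1) (𝟙 X)) s s' →
        ((∃ g, Rel conf (n + 1) g s t ∧ Factors n t g) ↔
          ∃ g, Rel conf (n + 1) g s' t ∧ Factors n t g) := by
      intro s s' hss'
      induction hss' with
      | rel s s' hss' =>
        constructor
        · rintro ⟨g, hg, hg'⟩
          obtain ⟨g₁, hg₁⟩ := exists_rel h s' t ht
          have := (hss'.comp hg₁).factors_sub h ht hg
          rw [Category.id_comp] at this
          exact ⟨g₁, hg₁, by simpa using this.add hg'⟩
        · rintro ⟨g, hg, hg'⟩
          exact ⟨𝟙 X ≫ g, hss'.comp hg, by rwa [Category.id_comp]⟩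
      | refl => rfl
      | symm _ _ _ ih => exact ih.symm
      | trans _ _ _ _ _ ih ih' => exact ih.trans ih'
    have e : Relation.EqvGen (Rel conf (n + 1) (𝟙 X)) s₀ s :=
      Quot.eqvGen_exact (hX.elim (Quot.mk _ s₀) (Quot.mk _ s))
    obtain ⟨g, hg, hg'⟩ := (key _ _ e).1 ⟨0, hs₀, 0, zero_comp⟩
    have := (hs.factors_sub h ht hg).add hg'
    rwa [sub_add_cancel] at this
  · intro hX
    obtain ⟨s₀, hs₀, hs₀'⟩ := exists_pullback h t (0 : X ⟶ Z)
    -- The comparison map of `s` can be corrected to `0`, and then `s` maps to the pullback along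
    -- `0`.
    have key : ∀ s, Quot.mk (Rel conf (n + 1) (𝟙 X)) s = Quot.mk _ s₀ := by
      intro s
      obtain ⟨a, ha⟩ := exists_rel h s t ht
      refine Quot.sound (hs₀' _ _ ?_)
      simpa using ha.add_of_factors (hX (-a))
    refine ⟨fun x y => ?_⟩
    obtain ⟨s, rfl⟩ := Quot.exists_rep x
    obtain ⟨s', rfl⟩ := Quot.exists_rep y
    rw [key s, key s']

/-- Being split is invariant under morphisms of extensions, in both directions, and any two split
extensions are related by a morphism. -/
lemma extVanishes_one_iff_isSplit {X Y : E} : ExtVanishes conf 1 X Y ↔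
    ∀ (B : E) (i : Y ⟶ B) (p : B ⟶ X), IsConflation conf i p → ∃ s : X ⟶ B, s ≫ p = 𝟙 X := by
  have retr : ∀ {B : E} {i : Y ⟶ B} {p : B ⟶ X} (hc : IsConflation conf i p) (s : X ⟶ B),
      s ≫ p = 𝟙 X → ∃ r : B ⟶ Y, i ≫ r = 𝟙 Y ∧ r ≫ i = 𝟙 B - p ≫ s := by
    intro B i p hc s hs
    have := hc.mono h
    obtain ⟨r, hr⟩ := hc.exists_lift h (𝟙 B - p ≫ s)
      (by rw [Preadditive.sub_comp, Category.assoc, hs, Category.comp_id, Category.id_comp,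
        sub_self])
    refine ⟨r, ?_, hr⟩
    rw [← cancel_mono i, Category.assoc, hr, Preadditive.comp_sub, reassoc_of% hc.zero, zero_comp,
      sub_zero, Category.comp_id, Category.id_comp]
  constructor
  · intro hX B i p hc
    have := h.hasBinaryBiproducts
    have key : ∀ e e' : NExtension conf 1 X Y, Relation.EqvGen (Rel conf 1 (𝟙 X)) e e' →
        ((∃ s, s ≫ Extension.p e = 𝟙 X) ↔ ∃ s, s ≫ Extension.p e' = 𝟙 X) := by
      intro e e' hee'
      induction hee' with
      | rel e e' hee' =>
        obtain ⟨b, h₁, h₂⟩ := hee'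
        rw [Category.comp_id] at h₂
        constructor
        · rintro ⟨s, hs⟩
          exact ⟨s ≫ b, by rw [Category.assoc, h₂, hs]⟩
        · rintro ⟨s, hs⟩
          obtain ⟨r, hr, hr'⟩ := retr (Extension.isConflation e') s hs
          have hc := Extension.isConflation e
          have := hc.epi h
          obtain ⟨s', hs'⟩ := hc.exists_desc h (𝟙 _ - (b ≫ r) ≫ Extension.i e)
            (by rw [Preadditive.comp_sub, Category.assoc, reassoc_of% h₁, reassoc_of% hr,
              Category.comp_id, sub_self])
          refine ⟨s', ?_⟩
          rw [← cancel_epi (Extension.p e), reassoc_of% hs', Preadditive.sub_comp,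
            Category.assoc, Category.assoc, Extension.zero e, comp_zero, comp_zero, sub_zero, Category.id_comp,
            Category.comp_id]
      | refl => rfl
      | symm _ _ _ ih => exact ih.symm
      | trans _ _ _ _ _ ih ih' => exact ih.trans ih'
    exact (key (h.isConflation_biprod Y X).extension hc.extension
      (Quot.eqvGen_exact (hX.elim _ _))).1 ⟨biprod.inr, biprod.inr_snd⟩
  · intro hX
    refine ⟨fun x y => ?_⟩
    obtain ⟨e, rfl⟩ := Quot.exists_rep x
    obtain ⟨e', rfl⟩ := Quot.exists_rep y
    obtain ⟨s, hs⟩ := hX _ _ _ (Extension.isConflation e)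
    obtain ⟨s', hs'⟩ := hX _ _ _ (Extension.isConflation e')
    obtain ⟨r, hr, -⟩ := retr (Extension.isConflation e) s hs
    refine Quot.sound ⟨r ≫ Extension.i e' + Extension.p e ≫ s', ?_, ?_⟩
    · rw [Preadditive.comp_add, reassoc_of% hr, reassoc_of% (Extension.zero e), zero_comp, add_zero]
    · rw [Preadditive.add_comp, Category.assoc, Category.assoc, hs', Extension.zero e', comp_zero,
        zero_add]

lemma ExtVanishes.exists_lift {N A B C : E} {i : A ⟶ B} {p : B ⟶ C} (hN : ExtVanishes conf 1 N A)
    (hc : IsConflation conf i p) (g : N ⟶ C) : ∃ l : N ⟶ B, l ≫ p = g := by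
  obtain ⟨B', b, i', p', hB, hc', -⟩ := h.exists_pullback hc g
  obtain ⟨s, hs⟩ := (extVanishes_one_iff_isSplit h).1 hN _ _ _ hc'
  exact ⟨s ≫ b, by rw [Category.assoc, hB.w, reassoc_of% hs]⟩

/-- Extensions of `N` by the kernel of a deflation inducing a surjection on `Hom(N, -)` vanish if
those by its source do. -/
lemma extVanishes_one_of_exists_lift {N A B C : E} {i : A ⟶ B} {p : B ⟶ C}
    (hN : ExtVanishes conf 1 N B) (hc : IsConflation conf i p)
    (hl : ∀ g : N ⟶ C, ∃ l : N ⟶ B, l ≫ p = g) : ExtVanishes conf 1 N A := by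
  rw [extVanishes_one_iff_isSplit h] at hN ⊢
  intro W j q hW
  have hqe := hW.epi h
  have him := hc.mono h
  obtain ⟨W', b, i', p', hP, hc', hb⟩ := h.exists_pushout hW i
  obtain ⟨s, hs⟩ := hN _ _ _ hc'
  obtain ⟨r, hr⟩ := hc'.exists_lift h (𝟙 _ - p' ≫ s)
    (by rw [Preadditive.sub_comp, Category.assoc, hs, Category.comp_id, Category.id_comp, sub_self])
  have hir : i' ≫ r = 𝟙 _ := by
    have := hc'.mono h
    rw [← cancel_mono i', Category.assoc, hr, Preadditive.comp_sub, reassoc_of% hc'.zero,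
      zero_comp, sub_zero, Category.comp_id, Category.id_comp]
  have hjb : j ≫ b ≫ r = i := by rw [hP.w_assoc, hir, Category.comp_id]
  -- The morphism `b ≫ r` extends `i` to `W`. Subtracting a lift to `B` of the map `c` it induces on
  -- quotients makes it land in `A`, where it is a retraction of `j`.
  obtain ⟨c, hcc⟩ := hW.exists_desc h ((b ≫ r) ≫ p)
    (by rw [← Category.assoc, hjb, hc.zero])
  obtain ⟨l, rfl⟩ := hl c
  obtain ⟨ρ, hρ⟩ := hc.exists_lift h (b ≫ r - q ≫ l)
    (by rw [Preadditive.sub_comp, ← hcc, Category.assoc, sub_self])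
  have hjρ : j ≫ ρ = 𝟙 _ := by
    rw [← cancel_mono i, Category.assoc, hρ, Preadditive.comp_sub, hjb, reassoc_of% hW.zero,
      zero_comp, sub_zero, Category.id_comp]
  obtain ⟨σ, hσ⟩ := hW.exists_desc h (𝟙 _ - ρ ≫ j)
    (by rw [Preadditive.comp_sub, reassoc_of% hjρ, Category.comp_id, sub_self])
  refine ⟨σ, ?_⟩
  rw [← cancel_epi q, reassoc_of% hσ, Preadditive.sub_comp, Category.assoc, hW.zero, comp_zero,
    sub_zero, Category.id_comp, Category.comp_id]

/-- The deflation `W ⟶ N` is split in two stages: its pushout, an extension of `N` by `C`, has a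
section, which then lifts along a deflation with kernel `A`. -/
lemma extVanishes_one_middle {N A B C : E} {i : A ⟶ B} {p : B ⟶ C}
    (hc : IsConflation conf i p) (hA : ExtVanishes conf 1 N A) (hC : ExtVanishes conf 1 N C) :
    ExtVanishes conf 1 N B := by
  rw [extVanishes_one_iff_isSplit h] at hC ⊢
  intro W j q hW
  obtain ⟨A', u, s, t, -, h₁, h₂, hut⟩ := h.exists_rotation hc hW
  obtain ⟨σ, hσ⟩ := hC _ _ _ h₂
  obtain ⟨l, hl⟩ := hA.exists_lift h h₁ σ
  exact ⟨l, by rw [← hut, reassoc_of% hl, hσ]⟩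

omit h in
lemma exists_hasInjectiveTerms (hinj : EnoughInjectives conf) (n : ℕ) (Y : E) :
    ∃ (Z : E) (t : NExtension conf (n + 1) Z Y), HasInjectiveTerms (n + 1) t := by
  induction n generalizing Y with
  | zero =>
    obtain ⟨J, i, hJ, hi⟩ := hinj Y
    obtain ⟨Z, p, hc⟩ := hi.exists_conflation
    exact ⟨Z, hc.extension, hJ⟩
  | succ n ih =>
    obtain ⟨J, i, hJ, hi⟩ := hinj Y
    obtain ⟨Y', p, hc⟩ := hi.exists_conflation
    obtain ⟨Z, t, ht⟩ := ih Y'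
    exact ⟨Z, t.splice n hc.extension, ht.splice n _ _ hJ⟩

/-- Dimension shift: splicing on the side of `X` leaves the first conflation unchanged, so both
sides are the same factorization condition. -/
lemma extVanishes_succ_iff (hinj : EnoughInjectives conf) {n : ℕ} (hn : 1 ≤ n) {N X J X' : E}
    {i : X ⟶ J} {p : J ⟶ X'} (hc : IsConflation conf i p) (hJ : injectives conf J) :
    ExtVanishes conf (n + 1) N X ↔ ExtVanishes conf n N X' := by
  obtain ⟨n, rfl⟩ := Nat.exists_eq_add_of_le' hn
  obtain ⟨Z, t, ht⟩ := exists_hasInjectiveTerms hinj n X'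
  rw [extVanishes_iff_factors h t ht,
    extVanishes_iff_factors h (t.splice n hc.extension) (ht.splice n _ _ hJ)]
  simp only [factors_splice]

lemma extVanishes_one_of_injective {N J : E} (hJ : injectives conf J) : ExtVanishes conf 1 N J := by
  rw [extVanishes_one_iff_isSplit h]
  intro B i p hc
  obtain ⟨r, hr⟩ := hJ i hc.isInflation (𝟙 J)
  have := hc.epi h
  obtain ⟨s, hs⟩ := hc.exists_desc h (𝟙 _ - r ≫ i)
    (by rw [Preadditive.comp_sub, reassoc_of% hr, Category.comp_id, sub_self])
  refine ⟨s, ?_⟩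
  rw [← cancel_epi p, reassoc_of% hs, Preadditive.sub_comp, Category.assoc, hc.zero, comp_zero,
    sub_zero, Category.id_comp, Category.comp_id]

lemma extVanishes_of_injective (hinj : EnoughInjectives conf) {N J : E} (hJ : injectives conf J)
    {n : ℕ} (hn : 1 ≤ n) : ExtVanishes conf n N J := by
  induction n, hn using Nat.le_induction generalizing J with
  | base => exact extVanishes_one_of_injective h hJ
  | succ n hn ih =>
    have := h.hasZeroObject
    obtain ⟨Z, hZ⟩ := HasZeroObject.zero (C := E)
    rw [extVanishes_succ_iff h hinj hn (h.isConflation_id_zero hZ) hJ]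
    exact ih fun _ _ _ => ⟨0, hZ.eq_of_tgt _ _⟩

/-- Two consequences of the long exact sequence of Yoneda extensions. -/
lemma extVanishes_middle_and_right (hinj : EnoughInjectives conf) {N : E} {n : ℕ} (hn : 1 ≤ n)
    {A B C : E} {i : A ⟶ B} {p : B ⟶ C} (hc : IsConflation conf i p) :
    (ExtVanishes conf n N A → ExtVanishes conf n N C → ExtVanishes conf n N B) ∧
      (ExtVanishes conf n N B → ExtVanishes conf (n + 1) N A → ExtVanishes conf n N C) := by
  induction n, hn using Nat.le_induction generalizing A B C with
  | base =>
    obtain ⟨J, j, hJ, hj⟩ := hinj B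
    obtain ⟨D, q, hj⟩ := hj.exists_conflation
    obtain ⟨A', u, s, t, -, h₁, h₂, hut⟩ := h.exists_rotation hc hj
    refine ⟨extVanishes_one_middle h hc, fun hB hA => ?_⟩
    rw [extVanishes_succ_iff h hinj le_rfl h₁ hJ] at hA
    refine extVanishes_one_of_exists_lift h hA h₂ fun g => ?_
    obtain ⟨l, hl⟩ := hB.exists_lift h hj g
    exact ⟨l ≫ u, by rw [Category.assoc, hut, hl]⟩
  | succ n hn ih =>
    obtain ⟨J, j, hJ, hj⟩ := hinj B
    obtain ⟨D, q, hj⟩ := hj.exists_conflation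
    obtain ⟨A', u, s, t, -, h₁, h₂, -⟩ := h.exists_rotation hc hj
    rw [extVanishes_succ_iff h hinj hn h₁ hJ, extVanishes_succ_iff h hinj hn hj hJ,
      extVanishes_succ_iff h hinj (Nat.le_succ_of_le hn) h₁ hJ]
    -- Since `A'` and `D` are cosyzygies of `A` and `B`, the first claim is the second one in degree
    -- `n` for `C ⟶ A' ⟶ D`. One more rotation reduces the second claim to the first, whence the
    -- joint induction.
    refine ⟨fun hA hC => (ih h₂).2 hA hC, fun hB hA => ?_⟩
    obtain ⟨J', j', hJ', hj'⟩ := hinj A'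
    obtain ⟨D', q', hj'⟩ := hj'.exists_conflation
    obtain ⟨C', u', s', t', -, h₁', h₂', -⟩ := h.exists_rotation h₂ hj'
    rw [extVanishes_succ_iff h hinj hn h₁' hJ']
    rw [extVanishes_succ_iff h hinj hn hj' hJ'] at hA
    exact (ih h₂').1 hB hA

end YonedaExtensions

/-! ### Acyclic complexes in an exact category. -/

section AcyclicResolutions

variable {E : Type u} [Category.{v} E] [Preadditive E] {conf : ObjectProperty (ShortComplex E)}

/-- In terms of the cosyzygies `A'` and `D` of `A` and `B`, this is the middle term of `C ⟶ A' ⟶ D`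
in degree `n`. -/
lemma extVanishes_left (h : IsExactStructure conf) (hinj : EnoughInjectives conf) {N : E} {n : ℕ}
    (hn : 1 ≤ n) {A B C : E} {i : A ⟶ B} {p : B ⟶ C} (hc : IsConflation conf i p)
    (hC : ExtVanishes conf n N C) (hB : ExtVanishes conf (n + 1) N B) :
    ExtVanishes conf (n + 1) N A := by
  obtain ⟨J, j, hJ, hj⟩ := hinj B
  obtain ⟨D, q, hj⟩ := hj.exists_conflation
  obtain ⟨A', u, s, t, -, h₁, h₂, -⟩ := h.exists_rotation hc hj
  rw [extVanishes_succ_iff h hinj hn h₁ hJ]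
  rw [extVanishes_succ_iff h hinj hn hj hJ] at hB
  exact (extVanishes_middle_and_right h hinj hn h₂).1 hC hB

/-- The sequence `⋯ ⟶ X 1 ⟶ X 0 ⟶ L ⟶ 0` is an acyclic complex with `X j = 0` for `j > n`, that
is, it is spliced from conflations. -/
def IsAcyclicResolution (conf : ObjectProperty (ShortComplex E)) :
    ℕ → (X : ℕ → E) → (∀ j, X (j + 1) ⟶ X j) → {L : E} → (X 0 ⟶ L) → Prop
  | 0, X, _, _, p => IsIso p ∧ ∀ j, 1 ≤ j → IsZero (X j)
  | n + 1, X, d, _, p => ∃ (L' : E) (p' : X 1 ⟶ L') (i : L' ⟶ X 0), p' ≫ i = d 0 ∧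
      IsConflation conf i p ∧ IsAcyclicResolution conf n (fun j => X (j + 1)) (fun j => d (j + 1)) p'

/-- The sequence obtained by adding a term to a sequence. -/
def consObj {C : Type*} (A : C) (X : ℕ → C) : ℕ → C
  | 0 => A
  | j + 1 => X j

/-- The differentials of a sequence to which a term has been added. -/
def consMap {C : Type*} [Category* C] {A : C} {X : ℕ → C} (f : X 0 ⟶ A) (d : ∀ j, X (j + 1) ⟶ X j) :
    ∀ j, consObj A X (j + 1) ⟶ consObj A X j
  | 0 => f
  | j + 1 => d j

namespace IsAcyclicResolution

variable {n : ℕ} {X : ℕ → E} {d : ∀ j, X (j + 1) ⟶ X j} {L : E} {p : X 0 ⟶ L}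
  (h : IsExactStructure conf)

include h

lemma isDeflation (hX : IsAcyclicResolution conf n X d p) : IsDeflation conf p := by
  cases n with
  | zero =>
    have := hX.1
    exact h.isDeflation_of_isIso p
  | succ n =>
    obtain ⟨L', p', i, -, hc, -⟩ := hX
    exact hc.isDeflation

lemma epi (hX : IsAcyclicResolution conf n X d p) : Epi p := by
  obtain ⟨A, i, hc⟩ := (hX.isDeflation h).exists_conflation
  exact hc.epi h

omit h in
lemma zero (hX : IsAcyclicResolution conf n X d p) : d 0 ≫ p = 0 := by
  cases n with
  | zero => exact (hX.2 1 le_rfl).eq_of_src _ _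
  | succ n =>
    obtain ⟨L', p', i, e, hc, -⟩ := hX
    rw [← e, Category.assoc, hc.zero, comp_zero]

lemma exists_desc (hX : IsAcyclicResolution conf n X d p) {T : E} (k : X 0 ⟶ T)
    (hk : d 0 ≫ k = 0) : ∃ l, p ≫ l = k := by
  cases n with
  | zero =>
    have := hX.1
    exact ⟨inv p ≫ k, by simp⟩
  | succ n =>
    obtain ⟨L', p', i, e, hc, hX'⟩ := hX
    have := hX'.epi h
    refine hc.exists_desc h k ?_
    rw [← cancel_epi p', ← Category.assoc, e, hk, comp_zero]

omit h in
lemma d_comp_d (hX : IsAcyclicResolution conf n X d p) (j : ℕ) : d (j + 1) ≫ d j = 0 := by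
  induction j generalizing n X L with
  | zero =>
    cases n with
    | zero => exact (hX.2 2 (by omega)).eq_of_src _ _
    | succ n =>
      obtain ⟨L', p', i, e, hc, hX'⟩ := hX
      rw [← e, reassoc_of% hX'.zero, zero_comp]
  | succ j ih =>
    cases n with
    | zero => exact (hX.2 (j + 3) (by omega)).eq_of_src _ _
    | succ n =>
      obtain ⟨L', p', i, e, hc, hX'⟩ := hX
      exact ih hX'

omit h in
lemma isZero (hX : IsAcyclicResolution conf n X d p) (j : ℕ) (hj : n < j) : IsZero (X j) := by
  induction n generalizing X L j with
  | zero => exact hX.2 j hj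
  | succ n ih =>
    obtain ⟨L', p', i, e, hc, hX'⟩ := hX
    obtain ⟨j, rfl⟩ := Nat.exists_eq_add_of_le' (Nat.one_le_of_lt hj)
    exact ih hX' j (by omega)

/-- The morphism `g` descends to the image of the differential, which sits in the next term by an
inflation. -/
lemma exists_extension (hX : IsAcyclicResolution conf n X d p) {J : E} (hJ : injectives conf J)
    (j : ℕ) (g : X (j + 1) ⟶ J) (hg : d (j + 1) ≫ g = 0) : ∃ k : X j ⟶ J, d j ≫ k = g := by
  induction j generalizing n X L with
  | zero =>
    cases n with
    | zero => exact ⟨0, (hX.2 1 le_rfl).eq_of_src _ _⟩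
    | succ n =>
      obtain ⟨L', p', i, e, hc, hX'⟩ := hX
      obtain ⟨l, hl⟩ := hX'.exists_desc h g hg
      obtain ⟨k, rfl⟩ := hJ i hc.isInflation l
      exact ⟨k, by rw [← e, Category.assoc, hl]⟩
  | succ j ih =>
    cases n with
    | zero => exact ⟨0, (hX.2 (j + 2) (by omega)).eq_of_src _ _⟩
    | succ n =>
      obtain ⟨L', p', i, e, hc, hX'⟩ := hX
      exact ih hX' g hg

lemma isAdmissible (hX : IsAcyclicResolution conf (n + 1) X d p) : IsAdmissible conf (d 0) := by
  obtain ⟨L', p', i, e, hc, hX'⟩ := hX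
  exact ⟨L', p', i, hX'.isDeflation h, hc.isInflation, e⟩

end IsAcyclicResolution

/-- A bounded complex of which the duals with respect to the injectives are exact is acyclic. -/
lemma exists_isAcyclicResolution (h : IsExactStructure conf) (hwic : IsWeaklyIdempotentComplete E)
    (hinj : EnoughInjectives conf) (n : ℕ) (X : ℕ → E) (d : ∀ j, X (j + 1) ⟶ X j)
    (hd : ∀ j, d (j + 1) ≫ d j = 0) (hX : ∀ j, n < j → IsZero (X j))
    (hJ : ∀ J, injectives conf J → ∀ j (g : X (j + 1) ⟶ J), d (j + 1) ≫ g = 0 →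
      ∃ k : X j ⟶ J, d j ≫ k = g) :
    ∃ (L : E) (p : X 0 ⟶ L), IsAcyclicResolution conf n X d p := by
  induction n generalizing X with
  | zero => exact ⟨X 0, 𝟙 _, inferInstance, hX⟩
  | succ n ih =>
    obtain ⟨L', p', hX'⟩ := ih (fun j => X (j + 1)) (fun j => d (j + 1)) (fun j => hd _)
      (fun j hj => hX _ (by omega)) (fun J hJ' j g hg => hJ J hJ' _ g hg)
    obtain ⟨i, hi⟩ := hX'.exists_desc h (d 0) (hd 0)
    have := hX'.epi h
    -- The inflation `s` extends over `X 0` by exactness of the dual complex. So `i ≫ k` is an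
    -- inflation, and therefore `i` is one too.
    obtain ⟨J, s, hJ', hs⟩ := hinj L'
    obtain ⟨k, hk⟩ := hJ J hJ' 0 (p' ≫ s) (by rw [reassoc_of% hX'.zero, zero_comp])
    have his : i ≫ k = s := by rw [← cancel_epi p', ← Category.assoc, hi, hk]
    obtain ⟨L, p, hc⟩ := (h.isInflation_of_comp hwic i k (by rwa [his])).exists_conflation
    exact ⟨L, p, L', p', i, hi, hc, hX'⟩

end AcyclicResolutions

/-! ### Complexes over a cluster tilting subcategory. -/

section ClusterTilting

variable {E : Type u} [Category.{v} E] [Preadditive E] {conf : ObjectProperty (ShortComplex E)}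

lemma injectives_of_isZero {Z : E} (hZ : IsZero Z) : injectives conf Z :=
  fun _ _ _ => ⟨0, hZ.eq_of_tgt _ _⟩

lemma injectives_biprod [HasBinaryBiproducts E] {X Y : E} (hX : injectives conf X)
    (hY : injectives conf Y) : injectives conf (X ⊞ Y) := by
  intro A B i hi f
  obtain ⟨g, hg⟩ := hX i hi (f ≫ biprod.fst)
  obtain ⟨g', hg'⟩ := hY i hi (f ≫ biprod.snd)
  exact ⟨biprod.lift g g', by ext <;> simp [hg, hg']⟩

lemma injectives_of_retract {X Y : E} (r : Retract X Y) (hY : injectives conf Y) :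
    injectives conf X := by
  intro A B i hi f
  obtain ⟨g, hg⟩ := hY i hi (f ≫ r.i)
  exact ⟨g ≫ r.r, by rw [reassoc_of% hg, r.retract, Category.comp_id]⟩

variable (h : IsExactStructure conf) (hinj : EnoughInjectives conf)

include h hinj

lemma extVanishes_of_iso {N X Y : E} (f : X ⟶ Y) [IsIso f] {n : ℕ} (hn : 1 ≤ n)
    (hX : ExtVanishes conf n N X) : ExtVanishes conf n N Y := by
  have := h.hasZeroObject
  obtain ⟨Z, hZ⟩ := HasZeroObject.zero (C := E)
  have hc : IsConflation conf (0 : Z ⟶ X) f :=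
    h.isConflation_of_iso (h.isConflation_zero_id hZ) (Iso.refl _) (Iso.refl _) (asIso f)
      (by simp) (by simp)
  exact (extVanishes_middle_and_right h hinj hn hc).2 hX
    (extVanishes_of_injective h hinj (injectives_of_isZero hZ) (by omega))

namespace IsClusterTilting

variable {d : ℕ} {M : ObjectProperty E} (hM : IsClusterTilting conf d M)

include hM

lemma injectives_le : injectives conf ≤ M := fun J hJ =>
  (hM.mem_iff_right J).2 fun _ _ _ hi _ => extVanishes_of_injective h hinj hJ hi

lemma prop_biprod [HasBinaryBiproducts E] {X Y : E} (hX : M X) (hY : M Y) : M (X ⊞ Y) :=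
  (hM.mem_iff_right _).2 fun N hN i hi hi' =>
    (extVanishes_middle_and_right h hinj hi (h.isConflation_biprod X Y)).1
      ((hM.mem_iff_right X).1 hX N hN i hi hi') ((hM.mem_iff_right Y).1 hY N hN i hi hi')

/-- Each conflation costs one degree: `Ext^i(N, L)` lies between `Ext^i(N, X 0)` and `Ext^(i+1)(N,
L')`. -/
lemma extVanishes_of_isAcyclicResolution {n : ℕ} {X : ℕ → E} {δ : ∀ j, X (j + 1) ⟶ X j} {L : E}
    {p : X 0 ⟶ L} (hX : IsAcyclicResolution conf n X δ p) (hXM : ∀ j, M (X j)) {N : E} (hN : M N)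
    {i : ℕ} (hi : 1 ≤ i) (hin : i + n < d) : ExtVanishes conf i N L := by
  induction n generalizing X L i with
  | zero =>
    have := hX.1
    exact extVanishes_of_iso h hinj p hi ((hM.mem_iff_right _).1 (hXM 0) N hN i hi hin)
  | succ n ih =>
    obtain ⟨L', p', s, e, hc, hX'⟩ := hX
    exact (extVanishes_middle_and_right h hinj hi hc).2
      ((hM.mem_iff_right _).1 (hXM 0) N hN i hi (by omega))
      (ih hX' (fun j => hXM _) (by omega) (by omega))

/-- The obstruction lies in `Ext¹` of `N` by the kernel of `p`, whose resolution is shorter by one.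
-/
lemma exists_lift_of_isAcyclicResolution {n : ℕ} {X : ℕ → E} {δ : ∀ j, X (j + 1) ⟶ X j} {L : E}
    {p : X 0 ⟶ L} (hX : IsAcyclicResolution conf n X δ p) (hXM : ∀ j, M (X j)) {N : E} (hN : M N)
    (hn : n < d) (g : N ⟶ L) : ∃ k, k ≫ p = g := by
  cases n with
  | zero =>
    have := hX.1
    exact ⟨g ≫ inv p, by simp⟩
  | succ n =>
    obtain ⟨L', p', s, e, hc, hX'⟩ := hX
    exact (hM.extVanishes_of_isAcyclicResolution h hinj hX' (fun j => hXM _) hN le_rfl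
      (by omega)).exists_lift h hc g

/-- As `g` factors through the kernel of `p`, only the shorter resolution of this kernel matters.
This gains one in the bound on `n`. -/
lemma exists_lift_of_comp_eq_zero {n : ℕ} {X : ℕ → E} {δ : ∀ j, X (j + 1) ⟶ X j} {L : E}
    {p : X 0 ⟶ L} (hX : IsAcyclicResolution conf n X δ p) (hXM : ∀ j, M (X j)) {N : E} (hN : M N)
    (hn : n ≤ d) (g : N ⟶ X 0) (hg : g ≫ p = 0) : ∃ k, k ≫ δ 0 = g := by
  cases n with
  | zero =>
    have := hX.1
    exact ⟨0, by rw [zero_comp, ← cancel_mono p, hg, zero_comp]⟩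
  | succ n =>
    obtain ⟨L', p', s, e, hc, hX'⟩ := hX
    obtain ⟨l, rfl⟩ := hc.exists_lift h g hg
    obtain ⟨k, rfl⟩ := hM.exists_lift_of_isAcyclicResolution h hinj hX' (fun j => hXM _) hN hn l
    exact ⟨k, by rw [← e, Category.assoc]⟩

/-- The functors `Hom(N, -)` with `N` in `M` are exact on acyclic complexes over `M` with at most
`d + 2` terms, except on the right. -/
lemma exists_lift_of_comp_d_eq_zero {n : ℕ} {X : ℕ → E} {δ : ∀ j, X (j + 1) ⟶ X j} {L : E}
    {p : X 0 ⟶ L} (hX : IsAcyclicResolution conf n X δ p) (hXM : ∀ j, M (X j)) {N : E} (hN : M N)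
    (hn : n ≤ d + 1) (j : ℕ) (g : N ⟶ X (j + 1)) (hg : g ≫ δ j = 0) : ∃ k, k ≫ δ (j + 1) = g := by
  induction j generalizing n X L with
  | zero =>
    cases n with
    | zero => exact ⟨0, (hX.2 1 le_rfl).eq_of_tgt _ _⟩
    | succ n =>
      obtain ⟨L', p', s, e, hc, hX'⟩ := hX
      have := hc.mono h
      refine hM.exists_lift_of_comp_eq_zero h hinj hX' (fun j => hXM _) hN (by omega) g ?_
      rw [← cancel_mono s, Category.assoc, e, hg, zero_comp]
  | succ j ih =>
    cases n with
    | zero => exact ⟨0, (hX.2 (j + 2) (by omega)).eq_of_tgt _ _⟩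
    | succ n =>
      obtain ⟨L', p', s, e, hc, hX'⟩ := hX
      exact ih hX' (fun j => hXM _) (by omega) g hg

/-- The kernel of a right approximation of `L` has vanishing `Ext¹(N, -)` by the lifting property,
and its higher extensions are those of `L` shifted by one. Each approximation gains one degree of
vanishing, and after `n` of them the kernel lies in `M`. -/
lemma exists_resolution (n : ℕ) (hn : n < d) (L : E)
    (hL : ∀ N, M N → ∀ i, 1 ≤ i → i + n < d → ExtVanishes conf i N L) :
    ∃ (X : ℕ → E) (δ : ∀ j, X (j + 1) ⟶ X j) (p : X 0 ⟶ L),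
      (∀ j, M (X j)) ∧ IsAcyclicResolution conf n X δ p := by
  induction n generalizing L with
  | zero =>
    have := h.hasZeroObject
    obtain ⟨Z, hZ⟩ := HasZeroObject.zero (C := E)
    refine ⟨consObj L fun _ => Z, consMap 0 fun _ => 0, 𝟙 L, ?_, ?_, ?_⟩
    · rintro (_ | j)
      · exact (hM.mem_iff_right L).2 hL
      · exact hM.injectives_le h hinj _ (injectives_of_isZero hZ)
    · change IsIso (𝟙 L)
      infer_instance
    · rintro (_ | j) hj
      · omega
      · exact hZ
  | succ n ih =>
    obtain ⟨N₀, p, hN₀, hp, hp'⟩ := hM.right_approximation L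
    obtain ⟨L', i, hc⟩ := hp.exists_conflation
    obtain ⟨X, δ, p', hX, hX'⟩ := ih (by omega) L' fun N hN j hj hjn => by
      obtain rfl | ⟨j, hj', rfl⟩ : j = 1 ∨ ∃ j', 1 ≤ j' ∧ j = j' + 1 := by
        obtain rfl | hj := eq_or_lt_of_le hj
        · exact Or.inl rfl
        · exact Or.inr ⟨j - 1, by omega, by omega⟩
      · exact extVanishes_one_of_exists_lift h
          ((hM.mem_iff_right _).1 hN₀ N hN 1 le_rfl (by omega)) hc (hp' N hN)
      · exact extVanishes_left h hinj hj' hc (hL N hN j hj' (by omega))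
          ((hM.mem_iff_right _).1 hN₀ N hN (j + 1) (by omega) (by omega))
    refine ⟨consObj N₀ X, consMap (p' ≫ i) δ, p, ?_, L', p', i, rfl, hc, hX'⟩
    rintro (_ | j)
    · exact hN₀
    · exact hX j

/-- Every admissible morphism between objects of `M` is the last differential of an acyclic
complex over `M`. -/
lemma exists_resolution_of_isAdmissible (hd : 1 ≤ d) {X Y : E} (f : X ⟶ Y)
    (hf : IsAdmissible conf f) :
    ∃ (V : ℕ → E) (δ : ∀ j, V (j + 1) ⟶ V j) (k : V 0 ⟶ X) (L : E) (p : Y ⟶ L), (∀ j, M (V j)) ∧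
      IsAcyclicResolution conf (d + 1) (consObj Y (consObj X V)) (consMap f (consMap k δ)) p := by
  obtain ⟨d, rfl⟩ := Nat.exists_eq_add_of_le' hd
  obtain ⟨J, q, i, hq, hi, rfl⟩ := hf
  obtain ⟨K, s, hs⟩ := hq.exists_conflation
  obtain ⟨L, p, hp⟩ := hi.exists_conflation
  -- Now `d` is one less than the original integer, and the range of required vanishing is empty, so
  -- every `K` is allowed.
  obtain ⟨V, δ, r, hV, hV'⟩ := hM.exists_resolution h hinj d (by omega) K fun _ _ _ _ _ => by omega
  exact ⟨V, δ, r ≫ s, L, p, hV, J, q, i, rfl, hp, K, r, s, rfl, hs, hV'⟩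

end IsClusterTilting

end ClusterTilting

/-! ### Exact structures on extension-closed subcategories of abelian categories. -/

section ExtensionClosed

/-- The sequences of `C` which a functor to an abelian category maps to short exact sequences. -/
def shortExactInverseImage {C A : Type*} [Category* C] [HasZeroMorphisms C] [Category* A]
    [Preadditive A] (F : C ⥤ A) [F.PreservesZeroMorphisms] : ObjectProperty (ShortComplex C) :=
  fun S => (S.map F).ShortExact

section

variable {A : Type*} [Category* A] [Abelian A]

lemma shortExact_of_isPushout {X Y Z X' Y' : A} {f : X ⟶ Y} {g : Y ⟶ Z} (w : f ≫ g = 0)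
    (hS : (ShortComplex.mk f g w).ShortExact) {a : X ⟶ X'} {b : Y ⟶ Y'} {f' : X' ⟶ Y'}
    (h : IsPushout f a b f') :
    ∃ (g' : Y' ⟶ Z) (w' : f' ≫ g' = 0), (ShortComplex.mk f' g' w').ShortExact ∧ b ≫ g' = g := by
  have : Mono f := hS.mono_f
  have : Epi g := hS.epi_g
  have hf' : Mono f' := (MorphismProperty.monomorphisms A).of_isPushout h.flip ‹Mono f›
  have hw : f ≫ g = a ≫ (0 : X' ⟶ Z) := by rw [w, comp_zero]
  have hg' : b ≫ h.desc g 0 hw = g := h.inl_desc _ _ _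
  have w' : f' ≫ h.desc g 0 hw = 0 := h.inr_desc _ _ _
  have hepi : Epi (h.desc g 0 hw) := epi_of_epi_fac hg'
  refine ⟨h.desc g 0 hw, w', ?_, hg'⟩
  have hex : (ShortComplex.mk f' (h.desc g 0 hw) w').Exact := by
    refine ShortComplex.exact_of_g_is_cokernel _ (CokernelCofork.IsColimit.ofπ' _ _ fun k hk => ?_)
    have hk' : f ≫ b ≫ k = 0 := by rw [h.w_assoc, hk, comp_zero]
    refine ⟨hS.exact.desc (b ≫ k) hk', h.hom_ext ?_ ?_⟩
    · rw [reassoc_of% hg']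
      exact hS.exact.g_desc _ _
    · rw [reassoc_of% w', zero_comp, hk]
  exact { exact := hex }

lemma shortExact_of_isPullback {X Y Z Y' Z' : A} {f : X ⟶ Y} {g : Y ⟶ Z} (w : f ≫ g = 0)
    (hS : (ShortComplex.mk f g w).ShortExact) {c : Z' ⟶ Z} {b : Y' ⟶ Y} {g' : Y' ⟶ Z'}
    (h : IsPullback b g' g c) :
    ∃ (f' : X ⟶ Y') (w' : f' ≫ g' = 0), (ShortComplex.mk f' g' w').ShortExact ∧ f' ≫ b = f := by
  have : Mono f := hS.mono_f
  have : Epi g := hS.epi_g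
  have hg' : Epi g' := (MorphismProperty.epimorphisms A).of_isPullback h ‹Epi g›
  have hw : f ≫ g = (0 : X ⟶ Z') ≫ c := by rw [w, zero_comp]
  have hf' : h.lift f 0 hw ≫ b = f := h.lift_fst _ _ _
  have w' : h.lift f 0 hw ≫ g' = 0 := h.lift_snd _ _ _
  have hmono : Mono (h.lift f 0 hw) := mono_of_mono_fac hf'
  refine ⟨h.lift f 0 hw, w', ?_, hf'⟩
  have hex : (ShortComplex.mk (h.lift f 0 hw) g' w').Exact := by
    refine ShortComplex.exact_of_f_is_kernel _ (KernelFork.IsLimit.ofι' _ _ fun k hk => ?_)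
    have hk' : (k ≫ b) ≫ g = 0 := by rw [Category.assoc, h.w, reassoc_of% hk, zero_comp]
    refine ⟨hS.exact.lift (k ≫ b) hk', h.hom_ext ?_ ?_⟩
    · rw [Category.assoc, hf']
      exact hS.exact.lift_f _ _
    · rw [Category.assoc, w', comp_zero, hk]
  exact { exact := hex }

lemma shortExact_of_iso' {X Y Z X' Y' Z' : A} {f : X ⟶ Y} {g : Y ⟶ Z} {w : f ≫ g = 0}
    (hS : (ShortComplex.mk f g w).ShortExact) {f' : X' ⟶ Y'} {g' : Y' ⟶ Z'} (w' : f' ≫ g' = 0)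
    (a : X ≅ X') (b : Y ≅ Y') (c : Z ≅ Z') (hf : a.hom ≫ f' = f ≫ b.hom)
    (hg : b.hom ≫ g' = g ≫ c.hom) : (ShortComplex.mk f' g' w').ShortExact :=
  ShortComplex.shortExact_of_iso (ShortComplex.isoMk a b c hf hg) hS

lemma shortExact_of_isZero {X Z : A} (hZ : IsZero Z) :
    (ShortComplex.mk (𝟙 X) (0 : X ⟶ Z) comp_zero).ShortExact := by
  have : Epi (0 : X ⟶ Z) := ⟨fun _ _ _ => hZ.eq_of_src _ _⟩
  refine { exact := ShortComplex.exact_of_g_is_cokernel _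
            (CokernelCofork.IsColimit.ofπ' _ _ fun k hk => ⟨0, ?_⟩) }
  simpa using hk.symm

lemma shortExact_of_isZero' {X Z : A} (hZ : IsZero Z) :
    (ShortComplex.mk (0 : Z ⟶ X) (𝟙 X) zero_comp).ShortExact := by
  have : Mono (0 : Z ⟶ X) := ⟨fun _ _ _ => hZ.eq_of_tgt _ _⟩
  refine { exact := ShortComplex.exact_of_f_is_kernel _
            (KernelFork.IsLimit.ofι' _ _ fun k hk => ⟨0, ?_⟩) }
  simpa using hk.symm

end

variable {C A : Type*} [Category* C] [Preadditive C] [Category* A] [Abelian A]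

/-- A full subcategory `C` of an abelian category `A` which is closed under extensions, at least
under those with middle term in a class `L ⊇ C` closed under subobjects, quotients and finite
sums, is an exact category. -/
theorem isExactStructure_shortExactInverseImage (F : C ⥤ A) [F.Full] [F.Faithful] [F.Additive]
    (L : ObjectProperty A) (hLF : ∀ X, L (F.obj X))
    (hLbiprod : ∀ X Y, L X → L Y → L (X ⊞ Y))
    (hLsub : ∀ {X Y : A} (f : X ⟶ Y) [Mono f], L Y → L X)
    (hLquot : ∀ {X Y : A} (f : X ⟶ Y) [Epi f], L X → L Y)
    (hzero : ∃ X : C, IsZero (F.obj X))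
    (hext : ∀ S : ShortComplex A, S.ShortExact → L S.X₂ → F.essImage S.X₁ → F.essImage S.X₃ →
      F.essImage S.X₂) :
    IsExactStructure (shortExactInverseImage F) := by
  obtain ⟨Z₀, hZ₀⟩ := hzero
  have pushout' : ∀ {X Y Z X' : C} (f : X ⟶ Y) (g : Y ⟶ Z) (w : f ≫ g = 0) (a : X ⟶ X'),
      shortExactInverseImage F (ShortComplex.mk f g w) →
      ∃ (Y' : C) (b : Y ⟶ Y') (f' : X' ⟶ Y') (g' : Y' ⟶ Z) (w' : f' ≫ g' = 0),
        IsPushout f a b f' ∧ shortExactInverseImage F (ShortComplex.mk f' g' w') ∧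
          b ≫ g' = g ∧ IsPushout (F.map f) (F.map a) (F.map b) (F.map f') := by
    intro X Y Z X' f g w a hS
    have hP := IsPushout.of_hasPushout (F.map f) (F.map a)
    obtain ⟨g', w', hS', hg'⟩ := shortExact_of_isPushout (by rw [← F.map_comp, w, F.map_zero])
      hS hP
    -- The pushout is a quotient of a biproduct, hence in `L`. Being an extension of `F.obj Z` by
    -- `F.obj X'`, it comes from `C`.
    have : Epi (biprod.desc (pushout.inl (F.map f) (F.map a)) (pushout.inr _ _)) :=
      ⟨fun u v huv => by
        have h₁ := biprod.inl ≫= huv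
        have h₂ := biprod.inr ≫= huv
        simp only [biprod.inl_desc_assoc, biprod.inr_desc_assoc] at h₁ h₂
        exact hP.hom_ext h₁ h₂⟩
    obtain ⟨Y', ⟨e⟩⟩ := hext _ hS' (hLquot (biprod.desc (pushout.inl (F.map f) (F.map a))
      (pushout.inr _ _)) (hLbiprod _ _ (hLF _) (hLF _))) ⟨X', ⟨Iso.refl _⟩⟩ ⟨Z, ⟨Iso.refl _⟩⟩
    obtain ⟨b, hb⟩ := F.map_surjective (pushout.inl (F.map f) (F.map a) ≫ e.inv)
    obtain ⟨f', hf'⟩ := F.map_surjective (pushout.inr (F.map f) (F.map a) ≫ e.inv)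
    obtain ⟨g'', hg''⟩ := F.map_surjective (e.hom ≫ g')
    have hP' : IsPushout (F.map f) (F.map a) (F.map b) (F.map f') :=
      hP.of_iso (Iso.refl _) (Iso.refl _) (Iso.refl _) e.symm (by simp) (by simp) (by simp [hb])
        (by simp [hf'])
    have w'' : f' ≫ g'' = 0 := F.map_injective (by simp [hf', hg'', w'])
    refine ⟨Y', b, f', g'', w'', IsPushout.of_map F (F.map_injective ?_) hP', ?_,
      F.map_injective (by simp [hb, hg'', hg']), hP'⟩
    · simpa using hP'.w
    · exact shortExact_of_iso' hS' _ (Iso.refl _) e.symm (Iso.refl _) (by simp [hf'])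
        (by simp [hg''])
  have pullback' : ∀ {X Y Z Z' : C} (f : X ⟶ Y) (g : Y ⟶ Z) (w : f ≫ g = 0) (c : Z' ⟶ Z),
      shortExactInverseImage F (ShortComplex.mk f g w) →
      ∃ (Y' : C) (b : Y' ⟶ Y) (f' : X ⟶ Y') (g' : Y' ⟶ Z') (w' : f' ≫ g' = 0),
        IsPullback b g' g c ∧ shortExactInverseImage F (ShortComplex.mk f' g' w') ∧
          f' ≫ b = f ∧ IsPullback (F.map b) (F.map g') (F.map g) (F.map c) := by
    intro X Y Z Z' f g w c hS
    have hP := IsPullback.of_hasPullback (F.map g) (F.map c)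
    obtain ⟨f', w', hS', hf'⟩ := shortExact_of_isPullback (by rw [← F.map_comp, w, F.map_zero])
      hS hP
    have : Mono (biprod.lift (pullback.fst (F.map g) (F.map c)) (pullback.snd _ _)) :=
      ⟨fun u v huv => by
        have h₁ := huv =≫ biprod.fst
        have h₂ := huv =≫ biprod.snd
        simp only [Category.assoc, biprod.lift_fst, biprod.lift_snd] at h₁ h₂
        exact hP.hom_ext h₁ h₂⟩
    obtain ⟨Y', ⟨e⟩⟩ := hext _ hS' (hLsub (biprod.lift (pullback.fst (F.map g) (F.map c))
      (pullback.snd _ _)) (hLbiprod _ _ (hLF _) (hLF _))) ⟨X, ⟨Iso.refl _⟩⟩ ⟨Z', ⟨Iso.refl _⟩⟩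
    obtain ⟨b, hb⟩ := F.map_surjective (e.hom ≫ pullback.fst (F.map g) (F.map c))
    obtain ⟨g', hg'⟩ := F.map_surjective (e.hom ≫ pullback.snd (F.map g) (F.map c))
    obtain ⟨f'', hf''⟩ := F.map_surjective (f' ≫ e.inv)
    have hP' : IsPullback (F.map b) (F.map g') (F.map g) (F.map c) :=
      hP.of_iso e.symm (Iso.refl _) (Iso.refl _) (Iso.refl _) (by simp [hb]) (by simp [hg'])
        (by simp) (by simp)
    have w'' : f'' ≫ g' = 0 := F.map_injective (by simp [hf'', hg', w'])
    refine ⟨Y', b, f'', g', w'', IsPullback.of_map F (F.map_injective ?_) hP', ?_,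
      F.map_injective (by simp [hb, hf'', hf']), hP'⟩
    · simpa using hP'.w
    · exact shortExact_of_iso' hS' _ (Iso.refl _) e.symm (Iso.refl _) (by simp [hf''])
        (by simp [hg'])
  exact
  { hasZeroObject := ⟨Z₀, (IsZero.iff_id_eq_zero _).2 (F.map_injective (hZ₀.eq_of_src _ _))⟩
    hasBinaryBiproducts := by
      refine ⟨fun X Y => ?_⟩
      have hS : (ShortComplex.mk (biprod.inl : F.obj X ⟶ F.obj X ⊞ F.obj Y) biprod.snd
        (by simp)).ShortExact :=
        (ShortComplex.Splitting.ofHasBinaryBiproduct (F.obj X) (F.obj Y)).shortExact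
      obtain ⟨W, ⟨e⟩⟩ := hext _ hS (hLbiprod _ _ (hLF _) (hLF _)) ⟨X, ⟨Iso.refl _⟩⟩
        ⟨Y, ⟨Iso.refl _⟩⟩
      let b : BinaryBicone X Y :=
        { pt := W
          fst := F.preimage (e.hom ≫ biprod.fst)
          snd := F.preimage (e.hom ≫ biprod.snd)
          inl := F.preimage (biprod.inl ≫ e.inv)
          inr := F.preimage (biprod.inr ≫ e.inv)
          inl_fst := F.map_injective (by simp)
          inl_snd := F.map_injective (by simp)
          inr_fst := F.map_injective (by simp)
          inr_snd := F.map_injective (by simp) }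
      refine HasBinaryBiproduct.mk ⟨b, isBinaryBilimitOfTotal b (F.map_injective ?_)⟩
      simp only [b, F.map_add, F.map_comp, F.map_preimage, F.map_id, Category.assoc]
      rw [← cancel_epi e.inv, ← cancel_mono e.hom]
      simp [-biprod.total, ← biprod.total]
    of_iso := fun e hS => ShortComplex.shortExact_of_iso (F.mapShortComplex.mapIso e) hS
    isKernel := fun {S} hS => by
      have hm : Mono (S.map F).f := hS.mono_f
      have hm' : Mono S.f := F.mono_of_mono_map hm
      have key : ∀ {T : C} (k : T ⟶ S.X₂), k ≫ S.g = 0 → ∃ l, l ≫ S.f = k := fun {T} k hk => by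
        have hk' : F.map k ≫ F.map S.g = 0 := by rw [← F.map_comp, hk, F.map_zero]
        obtain ⟨l, hl⟩ : ∃ l : F.obj T ⟶ F.obj S.X₁, l ≫ F.map S.f = F.map k :=
          ⟨hS.exact.lift (F.map k) hk', hS.exact.lift_f _ _⟩
        obtain ⟨l, rfl⟩ := F.map_surjective l
        exact ⟨l, F.map_injective (by rw [F.map_comp, hl])⟩
      exact ⟨KernelFork.IsLimit.ofι' _ _ fun k hk => ⟨_, (key k hk).choose_spec⟩⟩
    isCokernel := fun {S} hS => by
      have hm : Epi (S.map F).g := hS.epi_g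
      have hm' : Epi S.g := F.epi_of_epi_map hm
      have key : ∀ {T : C} (k : S.X₂ ⟶ T), S.f ≫ k = 0 → ∃ l, S.g ≫ l = k := fun {T} k hk => by
        have hk' : F.map S.f ≫ F.map k = 0 := by rw [← F.map_comp, hk, F.map_zero]
        obtain ⟨l, hl⟩ : ∃ l : F.obj S.X₃ ⟶ F.obj T, F.map S.g ≫ l = F.map k :=
          ⟨hS.exact.desc (F.map k) hk', hS.exact.g_desc _ _⟩
        obtain ⟨l, rfl⟩ := F.map_surjective l
        exact ⟨l, F.map_injective (by rw [F.map_comp, hl])⟩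
      exact ⟨CokernelCofork.IsColimit.ofπ' _ _ fun k hk => ⟨_, (key k hk).choose_spec⟩⟩
    inflation_id := fun X => ⟨Z₀, 0, comp_zero, shortExact_of_iso'
      (shortExact_of_isZero (X := F.obj X) hZ₀) _ (Iso.refl _) (Iso.refl _) (Iso.refl _)
      (by simp) (by simp)⟩
    deflation_id := fun X => ⟨Z₀, 0, zero_comp, shortExact_of_iso'
      (shortExact_of_isZero' (X := F.obj X) hZ₀) _ (Iso.refl _) (Iso.refl _) (Iso.refl _)
      (by simp) (by simp)⟩
    inflation_comp := by
      rintro X Y Z i j ⟨Z₁, p, w, hi⟩ ⟨W, q, w', hj⟩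
      -- The pushout `b` of the cokernel `p` of `i` along `j` is a cokernel of `i ≫ j`.
      obtain ⟨P, b, f', g', w'', -, hS, -, hP⟩ := pushout' j q w' p hj
      have : Epi (F.map p) := hi.epi_g
      have : Mono (F.map i) := hi.mono_f
      have : Mono (F.map j) := hj.mono_f
      have hb : Epi (F.map b) := (MorphismProperty.epimorphisms A).of_isPushout hP ‹_›
      have hz : (i ≫ j) ≫ b = 0 := F.map_injective (by
        rw [F.map_comp, F.map_comp, Category.assoc, hP.w, ← F.map_comp_assoc, w]; simp)
      refine ⟨P, b, hz, ?_⟩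
      have hz' : (F.map i ≫ F.map j) ≫ F.map b = 0 := by
        rw [← F.map_comp, ← F.map_comp, hz, F.map_zero]
      have hex : (ShortComplex.mk _ _ hz').Exact := by
        refine ShortComplex.exact_of_g_is_cokernel _
          (CokernelCofork.IsColimit.ofπ' _ _ fun k hk => ?_)
        have hk' : F.map i ≫ F.map j ≫ k = 0 := by rw [← Category.assoc, hk]
        have : Epi ((ShortComplex.mk i p w).map F).g := hi.epi_g
        exact ⟨hP.desc k (hi.exact.desc (F.map j ≫ k) hk') (hi.exact.g_desc _ _).symm,
          hP.inl_desc _ _ _⟩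
      exact shortExact_of_iso' { exact := hex } _ (Iso.refl _) (Iso.refl _) (Iso.refl _) (by simp)
        (by simp)
    deflation_comp := by
      rintro X Y Z p q ⟨W, i, w, hp⟩ ⟨Z₁, j, w', hq⟩
      obtain ⟨P, b, f', g', w'', -, hS, -, hP⟩ := pullback' i p w j hp
      have : Epi (F.map p) := hp.epi_g
      have : Epi (F.map q) := hq.epi_g
      have : Mono (F.map j) := hq.mono_f
      have hb : Mono (F.map b) := (MorphismProperty.monomorphisms A).of_isPullback hP.flip ‹_›
      have hz : b ≫ p ≫ q = 0 := F.map_injective (by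
        rw [F.map_comp, F.map_comp, ← Category.assoc, hP.w, Category.assoc, ← F.map_comp, w']; simp)
      refine ⟨P, b, hz, ?_⟩
      have hz' : F.map b ≫ F.map p ≫ F.map q = 0 := by
        rw [← F.map_comp, ← F.map_comp, hz, F.map_zero]
      have hex : (ShortComplex.mk _ _ hz').Exact := by
        refine ShortComplex.exact_of_f_is_kernel _ (KernelFork.IsLimit.ofι' _ _ fun k hk => ?_)
        have hk' : (k ≫ F.map p) ≫ F.map q = 0 := by rw [Category.assoc, hk]
        have : Mono ((ShortComplex.mk j q w').map F).f := hq.mono_f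
        exact ⟨hP.lift k (hq.exact.lift (k ≫ F.map p) hk') (hq.exact.lift_f _ _).symm,
          hP.lift_fst _ _ _⟩
      exact shortExact_of_iso' { exact := hex } _ (Iso.refl _) (Iso.refl _) (Iso.refl _) (by simp)
        (by simp)
    inflation_pushout := by
      rintro X Y X' i a ⟨Z, p, w, hi⟩
      obtain ⟨Y', b, f', g', w', hP, hS, -, -⟩ := pushout' i p w a hi
      exact ⟨Y', b, f', hP, Z, g', w', hS⟩
    deflation_pullback := by
      rintro Y Z Z' p c ⟨X, i, w, hp⟩
      obtain ⟨Y', b, f', g', w', hP, hS, -, -⟩ := pullback' i p w c hp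
      exact ⟨Y', b, g', hP, X, f', w', hS⟩ }

end ExtensionClosed

/-! ### Vanishing of graded morphisms along distinguished triangles. -/

section HomZero

open Pretriangulated

variable {T : Type u} [Category.{v} T] [Preadditive T] [HasZeroObject T] [HasShift T ℤ]
  [∀ n : ℤ, (shiftFunctor T n).Additive] [Pretriangulated T]

/-- All morphisms `A ⟶ B⟦i⟧` vanish. -/
def HomZero (A B : T) (i : ℤ) : Prop := ∀ f : A ⟶ B⟦i⟧, f = 0

omit [HasZeroObject T] [∀ n : ℤ, (shiftFunctor T n).Additive] [Pretriangulated T] in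
lemma HomZero.of_iso_right {A B B' : T} {i : ℤ} (h : HomZero A B i) (e : B ≅ B') :
    HomZero A B' i := fun f => by
  rw [← cancel_mono (e.inv⟦i⟧'), zero_comp]
  exact h _

omit [HasZeroObject T] [∀ n : ℤ, (shiftFunctor T n).Additive] [Pretriangulated T] in
lemma HomZero.of_iso_left {A A' B : T} {i : ℤ} (h : HomZero A B i) (e : A ≅ A') :
    HomZero A' B i := fun f => by
  rw [← cancel_epi e.hom, comp_zero]
  exact h _

omit [HasZeroObject T] [∀ n : ℤ, (shiftFunctor T n).Additive] [Pretriangulated T] in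
lemma homZero_shift_right_iff {A B : T} (a i j : ℤ) (hj : a + i = j) :
    HomZero A (B⟦a⟧) i ↔ HomZero A B j := by
  let e := (shiftFunctorAdd' T a i j hj).app B
  constructor
  · intro h f
    rw [← cancel_mono e.hom, zero_comp]
    exact h _
  · intro h f
    rw [← cancel_mono e.inv, zero_comp]
    exact h _

omit [HasZeroObject T] [Pretriangulated T] in
lemma homZero_shift_left_iff {A B : T} (a i j : ℤ) (hj : i + a = j) :
    HomZero (A⟦a⟧) B j ↔ HomZero A B i := by
  let e := (shiftFunctorAdd' T i a j hj).app B
  constructor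
  · intro h f
    apply (shiftFunctor T a).map_injective
    rw [← cancel_mono e.inv]
    exact (h _).trans (by simp)
  · intro h f
    obtain ⟨g, hg⟩ := (shiftFunctor T a).map_surjective (f ≫ e.hom)
    rw [← cancel_mono e.hom, ← hg, h g, Functor.map_zero, zero_comp]

omit [HasZeroObject T] [∀ n : ℤ, (shiftFunctor T n).Additive] [Pretriangulated T] in
lemma homZero_zero_iff {A B : T} : HomZero A B 0 ↔ ∀ f : A ⟶ B, f = 0 := by
  let e := (shiftFunctorZero T ℤ).app B
  constructor
  · intro h f
    rw [← cancel_mono e.inv, zero_comp]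
    exact h _
  · intro h f
    rw [← cancel_mono e.hom, zero_comp]
    exact h _

omit [HasZeroObject T] [Pretriangulated T] in
lemma HomZero.eq_zero_of_shift {A B : T} {a : ℤ} (h : HomZero A B (-a)) (f : A⟦a⟧ ⟶ B) : f = 0 :=
  homZero_zero_iff.1 ((homZero_shift_left_iff a (-a) 0 (by simp)).2 h) f

variable {X Y Z : T} {f : X ⟶ Y} {g : Y ⟶ Z} {δ : Z ⟶ X⟦(1 : ℤ)⟧}
  (hT : Triangle.mk f g δ ∈ distTriang T)

include hT

lemma distTriang_of_iso {X' Y' Z' : T} {f' : X' ⟶ Y'} {g' : Y' ⟶ Z'} {δ' : Z' ⟶ X'⟦(1 : ℤ)⟧}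
    (a : X ≅ X') (b : Y ≅ Y') (c : Z ≅ Z') (hf : f ≫ b.hom = a.hom ≫ f')
    (hg : g ≫ c.hom = b.hom ≫ g') (hδ : δ ≫ a.hom⟦(1 : ℤ)⟧' = c.hom ≫ δ') :
    Triangle.mk f' g' δ' ∈ distTriang T :=
  isomorphic_distinguished _ hT _ (Triangle.isoMk _ _ a b c hf hg hδ).symm

lemma distTriang_comp₁₂ : f ≫ g = 0 := comp_distTriang_mor_zero₁₂ _ hT

lemma distTriang_desc₂ {B : T} (a : Y ⟶ B) (ha : f ≫ a = 0) : ∃ b : Z ⟶ B, g ≫ b = a := by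
  obtain ⟨b, hb⟩ := Triangle.yoneda_exact₂ _ hT a ha
  exact ⟨b, hb.symm⟩

lemma distTriang_desc₃ {B : T} (a : Z ⟶ B) (ha : g ≫ a = 0) : ∃ b : X⟦(1 : ℤ)⟧ ⟶ B, δ ≫ b = a := by
  obtain ⟨b, hb⟩ := Triangle.yoneda_exact₃ _ hT a ha
  exact ⟨b, hb.symm⟩

lemma distTriang_lift₂ {A : T} (a : A ⟶ Y) (ha : a ≫ g = 0) : ∃ b : A ⟶ X, b ≫ f = a := by
  obtain ⟨b, hb⟩ := Triangle.coyoneda_exact₂ _ hT a ha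
  exact ⟨b, hb.symm⟩

lemma distTriang_lift₃ {A : T} (a : A ⟶ Z) (ha : a ≫ δ = 0) : ∃ b : A ⟶ Y, b ≫ g = a := by
  obtain ⟨b, hb⟩ := Triangle.coyoneda_exact₃ _ hT a ha
  exact ⟨b, hb.symm⟩

lemma exists_invRotate_distinguished :
    ∃ (u : Z⟦(-1 : ℤ)⟧ ⟶ X) (w : Y ⟶ (Z⟦(-1 : ℤ)⟧)⟦(1 : ℤ)⟧), Triangle.mk u f w ∈ distTriang T :=
  ⟨_, _, inv_rot_of_distTriang _ hT⟩

lemma HomZero.right₂ {A : T} {i : ℤ} (hX : HomZero A X i) (hZ : HomZero A Z i) :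
    HomZero A Y i := fun a => by
  obtain ⟨b, rfl⟩ := Triangle.coyoneda_exact₂ _ (Triangle.shift_distinguished _ hT i) a (hZ _)
  exact (congrArg (· ≫ _) (hX b)).trans zero_comp

lemma HomZero.right₃ {A : T} {i : ℤ} (hY : HomZero A Y i) (hX : HomZero A X (i + 1)) :
    HomZero A Z i :=
  HomZero.right₂ (rot_of_distTriang _ hT) hY
    ((homZero_shift_right_iff 1 i (i + 1) (by ring)).2 hX)

lemma HomZero.left₂ {B : T} {i : ℤ} (hX : HomZero X B i) (hZ : HomZero Z B i) :
    HomZero Y B i := fun a => by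
  obtain ⟨b, rfl⟩ := distTriang_desc₂ hT a (hX _)
  rw [hZ b, comp_zero]

lemma HomZero.left₃ {B : T} {i : ℤ} (hY : HomZero Y B i) (hX : HomZero X B (i - 1)) :
    HomZero Z B i :=
  HomZero.left₂ (rot_of_distTriang _ hT) hY
    ((homZero_shift_left_iff 1 (i - 1) i (by ring)).2 hX)

lemma HomZero.left₁ {B : T} {i : ℤ} (hY : HomZero Y B i) (hZ : HomZero Z B (i + 1)) :
    HomZero X B i :=
  HomZero.left₂ (inv_rot_of_distTriang _ hT)
    ((homZero_shift_left_iff (-1) (i + 1) i (by ring)).2 hZ) hY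

end HomZero

/-! ### Totalizations of bounded complexes as iterated cones. -/

section Postnikov

open Pretriangulated

variable {P : Type*} [Category* P] [Preadditive P]
  {T : Type u} [Category.{v} T] [Preadditive T] [HasZeroObject T] [HasShift T ℤ]
  [∀ n : ℤ, (shiftFunctor T n).Additive] [Pretriangulated T] (S : P ⥤ T)

/-- The object `Y` is the totalization of the bounded complex
`⋯ ⟶ S (X 1) ⟶ S (X 0)` in degrees `≤ n`. -/
def IsTotalization :
    ℕ → (X : ℕ → P) → (∀ j, X (j + 1) ⟶ X j) → {Y : T} → (S.obj (X 0) ⟶ Y) → Prop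
  | 0, X, _, _, q => IsIso q ∧ ∀ j, 1 ≤ j → IsZero (X j)
  | n + 1, X, d, Y, q => ∃ (Y' : T) (q' : S.obj (X 1) ⟶ Y') (r : Y' ⟶ S.obj (X 0))
      (δ : Y ⟶ Y'⟦(1 : ℤ)⟧), q' ≫ r = S.map (d 0) ∧ Triangle.mk r q δ ∈ distTriang T ∧
        IsTotalization n (fun j => X (j + 1)) (fun j => d (j + 1)) q'

/-- There are no nonzero morphisms between objects of the image of `S` in nonzero degrees. -/
def IsConcentrated : Prop := ∀ X Y i, i ≠ 0 → HomZero (S.obj X) (S.obj Y) i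

variable {S}

namespace IsTotalization

variable {n : ℕ} {X : ℕ → P} {d : ∀ j, X (j + 1) ⟶ X j} {Y : T} {q : S.obj (X 0) ⟶ Y}

lemma map_d_comp [S.PreservesZeroMorphisms] (hY : IsTotalization S n X d q) :
    S.map (d 0) ≫ q = 0 := by
  cases n with
  | zero => exact (S.map_isZero (hY.2 1 le_rfl)).eq_of_src _ _
  | succ n =>
    obtain ⟨Y', q', r, δ, e, hT, -⟩ := hY
    rw [← e, Category.assoc, distTriang_comp₁₂ hT, comp_zero]

omit [Preadditive P] in
lemma isZero (hY : IsTotalization S n X d q) (j : ℕ) (hj : n < j) : IsZero (X j) := by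
  induction n generalizing X Y j with
  | zero => exact hY.2 j hj
  | succ n ih =>
    obtain ⟨Y', q', r, δ, e, hT, hY'⟩ := hY
    obtain ⟨j, rfl⟩ := Nat.exists_eq_add_of_le' (Nat.one_le_of_lt hj)
    exact ih hY' j (by omega)

lemma d_comp_d [S.PreservesZeroMorphisms] [S.Faithful] (hY : IsTotalization S n X d q) (j : ℕ) :
    d (j + 1) ≫ d j = 0 := by
  induction j generalizing n X Y with
  | zero =>
    cases n with
    | zero => exact (hY.2 2 (by omega)).eq_of_src _ _
    | succ n =>
      obtain ⟨Y', q', r, δ, e, hT, hY'⟩ := hY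
      apply S.map_injective
      rw [S.map_comp, ← e, reassoc_of% hY'.map_d_comp, zero_comp, S.map_zero]
  | succ j ih =>
    cases n with
    | zero => exact (hY.2 (j + 3) (by omega)).eq_of_src _ _
    | succ n =>
      obtain ⟨Y', q', r, δ, e, hT, hY'⟩ := hY
      exact ih hY'

-- `Y` is built from the `j`-fold suspensions of `S (X j)` with `j ≥ 0`, so only degrees `≤ i`
-- contribute.
omit [Preadditive P] in
lemma homZero_left (hY : IsTotalization S n X d q) {Q : T} {i : ℤ}
    (hQ : ∀ N j, j ≤ i → HomZero (S.obj N) Q j) : HomZero Y Q i := by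
  induction n generalizing X Y i with
  | zero =>
    have := hY.1
    exact (hQ _ i le_rfl).of_iso_left (asIso q)
  | succ n ih =>
    obtain ⟨Y', q', r, δ, e, hT, hY'⟩ := hY
    exact HomZero.left₃ hT (hQ _ i le_rfl) (ih hY' fun N j hj => hQ N j (by omega))

-- The cone of `q` is built from suspensions of positive order and has no morphisms to `Q`. Together
-- with `exists_desc`, this makes `q` behave, towards such `Q`, like a cokernel of `S.map (d 0)`.
omit [Preadditive P] in
lemma eq_zero (hY : IsTotalization S n X d q) {Q : T} (hQ : ∀ N i, i < 0 → HomZero (S.obj N) Q i)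
    (f : Y ⟶ Q) (hf : q ≫ f = 0) : f = 0 := by
  cases n with
  | zero =>
    have := hY.1
    rwa [← cancel_epi q, comp_zero]
  | succ n =>
    obtain ⟨Y', q', r, δ, e, hT, hY'⟩ := hY
    obtain ⟨f', rfl⟩ := distTriang_desc₃ hT f hf
    rw [HomZero.eq_zero_of_shift (hY'.homZero_left fun N j hj => hQ N j (by omega)) f', comp_zero]

omit [Preadditive P] in
lemma exists_desc (hY : IsTotalization S n X d q) {Q : T}
    (hQ : ∀ N i, i < 0 → HomZero (S.obj N) Q i) (g : S.obj (X 0) ⟶ Q)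
    (hg : S.map (d 0) ≫ g = 0) : ∃ f, q ≫ f = g := by
  cases n with
  | zero =>
    have := hY.1
    exact ⟨inv q ≫ g, by simp⟩
  | succ n =>
    obtain ⟨Y', q', r, δ, e, hT, hY'⟩ := hY
    exact distTriang_desc₂ hT g (hY'.eq_zero hQ (r ≫ g) (by rw [← Category.assoc, e, hg]))

variable (hS : IsConcentrated S)

include hS

omit [Preadditive P] in
lemma homZero_of_pos (hY : IsTotalization S n X d q) (N : P) {i : ℤ} (hi : 0 < i) :
    HomZero (S.obj N) Y i := by
  induction n generalizing X Y i with
  | zero =>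
    have := hY.1
    exact (hS _ _ i hi.ne').of_iso_right (asIso q)
  | succ n ih =>
    obtain ⟨Y', q', r, δ, e, hT, hY'⟩ := hY
    exact HomZero.right₃ hT (hS _ _ i hi.ne') (ih hY' (by omega))

omit [Preadditive P] in
lemma exists_lift [S.Full] (hY : IsTotalization S n X d q) {N : P} (f : S.obj N ⟶ Y) :
    ∃ g : N ⟶ X 0, S.map g ≫ q = f := by
  cases n with
  | zero =>
    have := hY.1
    exact ⟨S.preimage (f ≫ inv q), by simp⟩
  | succ n =>
    obtain ⟨Y', q', r, δ, e, hT, hY'⟩ := hY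
    obtain ⟨g, hg⟩ := distTriang_lift₃ hT f (hY'.homZero_of_pos hS N zero_lt_one _)
    obtain ⟨g, rfl⟩ := S.map_surjective g
    exact ⟨g, hg⟩

lemma exists_lift_of_comp_eq_zero [S.Full] [S.Faithful] [S.PreservesZeroMorphisms]
    (hY : IsTotalization S n X d q) {N : P} (g : N ⟶ X 0)
    (hg : S.map g ≫ q = 0) : ∃ k, k ≫ d 0 = g := by
  cases n with
  | zero =>
    have := hY.1
    refine ⟨0, S.map_injective ?_⟩
    rw [zero_comp, S.map_zero, ← cancel_mono q, hg, zero_comp]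
  | succ n =>
    obtain ⟨Y', q', r, δ, e, hT, hY'⟩ := hY
    obtain ⟨l, hl⟩ := distTriang_lift₂ hT _ hg
    obtain ⟨k, rfl⟩ := hY'.exists_lift hS l
    exact ⟨k, S.map_injective (by rw [← hl, S.map_comp, Category.assoc, e])⟩

/-- The group `Hom(S N, Y⟦-j⟧)`, for `j > 0`, is the homology of `Hom(N, X)` at `X j`; removing `X
0` shifts positions by one. -/
lemma homZero_of_neg [S.Full] [S.Faithful] [S.PreservesZeroMorphisms]
    (hY : IsTotalization S n X d q) {N : P}
    (hN : ∀ j (g : N ⟶ X (j + 1)), g ≫ d j = 0 → ∃ k, k ≫ d (j + 1) = g) {i : ℤ} (hi : i < 0) :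
    HomZero (S.obj N) Y i := by
  induction n generalizing X Y i with
  | zero =>
    have := hY.1
    exact (hS _ _ i hi.ne).of_iso_right (asIso q)
  | succ n ih =>
    obtain ⟨Y', q', r, δ, e, hT, hY'⟩ := hY
    obtain rfl | hi' := eq_or_ne i (-1)
    -- The composite to `Y'` is represented by a cycle `N ⟶ X 1`, thus by a boundary, and vanishes.
    -- So `f` comes from `S (X 0)⟦-1⟧`, where there are no nonzero morphisms.
    · intro f
      obtain ⟨u, w, hT'⟩ := exists_invRotate_distinguished hT
      obtain ⟨u', w', hT''⟩ := exists_invRotate_distinguished hT'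
      have hz : f ≫ u = 0 := by
        obtain ⟨l, hl⟩ := hY'.exists_lift hS (f ≫ u)
        have hl' : l ≫ d 0 = 0 := S.map_injective (by
          rw [S.map_comp, ← e, reassoc_of% hl, distTriang_comp₁₂ hT', comp_zero, S.map_zero])
        obtain ⟨k, rfl⟩ := hN 0 l hl'
        rw [← hl, S.map_comp, Category.assoc, hY'.map_d_comp, comp_zero]
      obtain ⟨b, rfl⟩ := distTriang_lift₂ hT'' f hz
      rw [hS N (X 0) (-1) (by omega) b, zero_comp]
    · exact HomZero.right₃ hT (hS _ _ i hi.ne) (ih hY' (fun j g hg => hN (j + 1) g hg) (by omega))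

/-- For `j = 0` the cocycle `g` extends over `Y'`, and the obstruction to extending it further over
`S (X 0)` is a morphism `Y⟦-1⟧ ⟶ S J`. Larger `j` reduce to `Y'`. -/
lemma exists_extension [S.Full] [S.Faithful] [S.PreservesZeroMorphisms]
    (hY : IsTotalization S n X d q) {J : P}
    (hJ : ∀ i : ℤ, 1 ≤ i → HomZero Y (S.obj J) i) (j : ℕ) (g : X (j + 1) ⟶ J)
    (hg : d (j + 1) ≫ g = 0) : ∃ k, d j ≫ k = g := by
  induction n generalizing X Y j with
  | zero => exact ⟨0, (hY.2 (j + 1) (by omega)).eq_of_src _ _⟩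
  | succ n ih =>
    obtain ⟨Y', q', r, δ, e, hT, hY'⟩ := hY
    cases j with
    | zero =>
      obtain ⟨f, hf⟩ := hY'.exists_desc (fun N i hi => hS N J i hi.ne) (S.map g)
        (by rw [← S.map_comp, hg, S.map_zero])
      obtain ⟨u, w, hT'⟩ := exists_invRotate_distinguished hT
      obtain ⟨k, hk⟩ := distTriang_desc₂ hT' f
        (HomZero.eq_zero_of_shift (by simpa using hJ 1 le_rfl) _)
      obtain ⟨k, rfl⟩ := S.map_surjective k
      exact ⟨k, S.map_injective (by rw [S.map_comp, ← e, Category.assoc, hk, hf])⟩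
    | succ j =>
      exact ih hY' (fun i hi => HomZero.left₁ hT (hS _ _ i (by omega)) (hJ (i + 1) (by omega)))
        j g hg

/-- Converse of `exists_extension`: a morphism of degree `1` comes from a cocycle on `X 1`, and an
extension of the cocycle to `X 0` kills it. -/
lemma homZero_of_exists_extension [S.Full] [S.Faithful] [S.PreservesZeroMorphisms]
    (hY : IsTotalization S n X d q) {J : P}
    (hJ : ∀ j (g : X (j + 1) ⟶ J), d (j + 1) ≫ g = 0 → ∃ k, d j ≫ k = g) {i : ℤ} (hi : 1 ≤ i) :
    HomZero Y (S.obj J) i := by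
  induction n generalizing X Y i with
  | zero =>
    have := hY.1
    exact (hS _ _ i (by omega)).of_iso_left (asIso q)
  | succ n ih =>
    obtain ⟨Y', q', r, δ, e, hT, hY'⟩ := hY
    obtain rfl | hi' := eq_or_ne i 1
    · intro f
      obtain ⟨f', rfl⟩ := distTriang_desc₃ hT f (hS _ _ 1 one_ne_zero _)
      obtain ⟨f', rfl⟩ := (shiftFunctor T (1 : ℤ)).map_surjective f'
      obtain ⟨g, hg⟩ := S.map_surjective (q' ≫ f')
      obtain ⟨k, hk⟩ := hJ 0 g (S.map_injective (by
        rw [S.map_comp, hg, reassoc_of% hY'.map_d_comp, zero_comp, S.map_zero]))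
      have hf' : f' - r ≫ S.map k = 0 := by
        refine hY'.eq_zero (fun N i hi => hS N J i hi.ne) _ ?_
        rw [Preadditive.comp_sub, ← hg, reassoc_of% e, ← S.map_comp, hk, sub_self]
      have hδ : δ ≫ r⟦(1 : ℤ)⟧' = 0 := comp_distTriang_mor_zero₃₁ _ hT
      rw [sub_eq_zero.1 hf', Functor.map_comp, reassoc_of% hδ, zero_comp]
    · exact HomZero.left₃ hT (hS _ _ i (by omega))
        (ih hY' (fun j g hg => hJ (j + 1) g hg) (by omega))

end IsTotalization

end Postnikov

/-! ### The classes `S ∗ S⟦1⟧ ∗ ⋯ ∗ S⟦n⟧` and their closure under extensions. -/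

section IteratedExtensions

open Pretriangulated

variable {P : Type*} [Category* P]
  {T : Type u} [Category.{v} T] [HasShift T ℤ]

/-- The class of objects isomorphic to `(S X)⟦n⟧` for some `X`. -/
def shiftedImage (S : P ⥤ T) (n : ℕ) : ObjectProperty T := fun Y =>
  ∃ Q : P, Nonempty (Y ≅ (S.obj Q)⟦(n : ℤ)⟧)

instance (S : P ⥤ T) (n : ℕ) : (shiftedImage S n).IsClosedUnderIsomorphisms where
  of_iso := by
    rintro Y Y' e ⟨Q, ⟨e'⟩⟩
    exact ⟨Q, ⟨e.symm ≪≫ e'⟩⟩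

/-- The class of objects isomorphic to a suspension of an object of `Q`. -/
def suspension (Q : ObjectProperty T) : ObjectProperty T := fun Y =>
  ∃ Z, Q Z ∧ Nonempty (Y ≅ Z⟦(1 : ℤ)⟧)

lemma suspension_shiftedImage (S : P ⥤ T) (n : ℕ) :
    suspension (shiftedImage S n) = shiftedImage S (n + 1) := by
  have e : ∀ Q : P, ((S.obj Q)⟦(n : ℤ)⟧)⟦(1 : ℤ)⟧ ≅ (S.obj Q)⟦((n + 1 : ℕ) : ℤ)⟧ := fun Q =>
    ((shiftFunctorAdd' T (n : ℤ) 1 ((n + 1 : ℕ) : ℤ) (by simp)).app (S.obj Q)).symm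
  ext Y
  constructor
  · rintro ⟨Z, ⟨Q, ⟨i⟩⟩, ⟨j⟩⟩
    exact ⟨Q, ⟨j ≪≫ (shiftFunctor T (1 : ℤ)).mapIso i ≪≫ e Q⟩⟩
  · rintro ⟨Q, ⟨i⟩⟩
    exact ⟨_, ⟨Q, ⟨Iso.refl _⟩⟩, ⟨i ≪≫ (e Q).symm⟩⟩

variable [Preadditive T] [HasZeroObject T]
  [∀ n : ℤ, (shiftFunctor T n).Additive] [Pretriangulated T]

lemma suspension_extensionProduct (A B : ObjectProperty T) [A.IsClosedUnderIsomorphisms]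
    [B.IsClosedUnderIsomorphisms] :
    suspension (A.extensionProduct B) = (suspension A).extensionProduct (suspension B) := by
  ext Y
  constructor
  · rintro ⟨Z, ⟨X, W, f, g, δ, hT, hX, hW⟩, ⟨e⟩⟩
    exact ObjectProperty.prop_of_iso _ e.symm ⟨_, _, _, _, _, Triangle.shift_distinguished _ hT 1,
      ⟨X, hX, ⟨Iso.refl _⟩⟩, ⟨W, hW, ⟨Iso.refl _⟩⟩⟩
  · rintro ⟨X, W, f, g, δ, hT, ⟨X', hX, ⟨e⟩⟩, ⟨W', hW, ⟨e'⟩⟩⟩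
    have key : ∀ {U U' : T}, (U ≅ U'⟦(1 : ℤ)⟧) → Nonempty (U' ≅ U⟦(-1 : ℤ)⟧) := fun {U U'} i =>
      ⟨(shiftShiftNeg U' (1 : ℤ)).symm ≪≫ (shiftFunctor T (-1 : ℤ)).mapIso i.symm⟩
    obtain ⟨i⟩ := key e
    obtain ⟨j⟩ := key e'
    exact ⟨Y⟦(-1 : ℤ)⟧, ⟨_, _, _, _, _, Triangle.shift_distinguished _ hT (-1),
      A.prop_of_iso i hX, B.prop_of_iso j hW⟩, ⟨(shiftNegShift Y (1 : ℤ)).symm⟩⟩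

/-- The class `S ∗ S⟦1⟧ ∗ ⋯ ∗ S⟦n⟧`. -/
def iterExt (S : P ⥤ T) : ℕ → ObjectProperty T
  | 0 => shiftedImage S 0
  | n + 1 => (iterExt S n).extensionProduct (shiftedImage S (n + 1))

instance (S : P ⥤ T) (n : ℕ) : (iterExt S n).IsClosedUnderIsomorphisms := by
  cases n <;> dsimp [iterExt] <;> infer_instance

variable (S : P ⥤ T)

lemma iterExt_zero_obj (X : P) : iterExt S 0 (S.obj X) :=
  ⟨X, ⟨((shiftFunctorZero' T ((0 : ℕ) : ℤ) rfl).app _).symm⟩⟩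

variable [IsTriangulated T]

/-- Associativity of `∗` allows the degree `0` factor to be split off instead of the top one, as in
`IsTotalization`. -/
lemma iterExt_succ (n : ℕ) :
    iterExt S (n + 1) = (iterExt S 0).extensionProduct (suspension (iterExt S n)) := by
  induction n with
  | zero =>
    change (iterExt S 0).extensionProduct (shiftedImage S 1) = _
    rw [← suspension_shiftedImage]
    rfl
  | succ n ih =>
    calc iterExt S (n + 2)
        = (iterExt S (n + 1)).extensionProduct (shiftedImage S (n + 2)) := rfl
      _ = ((iterExt S 0).extensionProduct (suspension (iterExt S n))).extensionProduct
            (suspension (shiftedImage S (n + 1))) := by rw [ih, suspension_shiftedImage]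
      _ = (iterExt S 0).extensionProduct (suspension ((iterExt S n).extensionProduct
            (shiftedImage S (n + 1)))) := by
          rw [ObjectProperty.extensionProduct_assoc, ← suspension_extensionProduct]

variable [Preadditive P] [S.Additive] [S.Full]

omit [S.Additive] in
lemma exists_isTotalization_of_iterExt [HasZeroObject P] {n : ℕ} {Y : T} (hY : iterExt S n Y) :
    ∃ (X : ℕ → P) (d : ∀ j, X (j + 1) ⟶ X j) (q : S.obj (X 0) ⟶ Y), IsTotalization S n X d q := by
  have stalk : ∀ {Z : T}, iterExt S 0 Z → ∃ Q, Nonempty (S.obj Q ≅ Z) := by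
    rintro Z ⟨Q, ⟨e⟩⟩
    exact ⟨Q, ⟨(e ≪≫ (shiftFunctorZero' T ((0 : ℕ) : ℤ) rfl).app _).symm⟩⟩
  induction n generalizing Y with
  | zero =>
    obtain ⟨Q, ⟨e⟩⟩ := stalk hY
    obtain ⟨Z, hZ⟩ := HasZeroObject.zero (C := P)
    refine ⟨consObj Q fun _ => Z, consMap 0 fun _ => 0, e.hom, ?_, ?_⟩
    · change IsIso e.hom
      infer_instance
    · rintro (_ | j) hj
      · omega
      · exact hZ
  | succ n ih =>
    rw [iterExt_succ] at hY
    obtain ⟨A, B, f, g, δ, hT, hA, ⟨Z, hZ, ⟨e⟩⟩⟩ := hY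
    obtain ⟨Q, ⟨e'⟩⟩ := stalk hA
    obtain ⟨X, d, q, hX⟩ := ih hZ
    -- The connecting morphism is the suspension of some `r : Z ⟶ S.obj Q`; rotating the triangle
    -- introduces a sign, so the attaching map is `-r`.
    obtain ⟨r, hr⟩ := (shiftFunctor T (1 : ℤ)).map_surjective (e.inv ≫ δ ≫ e'.inv⟦(1 : ℤ)⟧')
    have hT' : Triangle.mk (-r) (e'.hom ≫ f) (g ≫ e.hom) ∈ distTriang T := by
      rw [rotate_distinguished_triangle]
      change Triangle.mk (e'.hom ≫ f) (g ≫ e.hom) (-(-r)⟦(1 : ℤ)⟧') ∈ distTriang T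
      refine distTriang_of_iso hT e'.symm (Iso.refl _) e (by simp) (by simp) ?_
      rw [Functor.map_neg, neg_neg, hr]
      simp
    obtain ⟨k, hk⟩ := S.map_surjective (q ≫ (-r))
    exact ⟨consObj Q X, consMap k d, e'.hom ≫ f, Z, q, -r, g ≫ e.hom, hk.symm, hT', hX⟩

omit [S.Full] in
lemma IsConcentrated.exists_isTotalization (hS : IsConcentrated S) (n : ℕ) (X : ℕ → P)
    (d : ∀ j, X (j + 1) ⟶ X j) (hd : ∀ j, d (j + 1) ≫ d j = 0) (hX : ∀ j, n < j → IsZero (X j)) :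
    ∃ (Y : T) (q : S.obj (X 0) ⟶ Y), IsTotalization S n X d q ∧ iterExt S n Y := by
  induction n generalizing X with
  | zero => exact ⟨S.obj (X 0), 𝟙 _, ⟨inferInstance, hX⟩, iterExt_zero_obj S _⟩
  | succ n ih =>
    obtain ⟨Y', q', hY', hY''⟩ := ih (fun j => X (j + 1)) (fun j => d (j + 1)) (fun j => hd _)
      fun j hj => hX _ (by omega)
    obtain ⟨r, hr⟩ := hY'.exists_desc (fun N i hi => hS N (X 0) i hi.ne) (S.map (d 0))
      (by rw [← S.map_comp, hd, S.map_zero])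
    obtain ⟨Y, q, δ, hT⟩ := distinguished_cocone_triangle r
    refine ⟨Y, q, ⟨Y', q', r, δ, hr, hT, hY'⟩, ?_⟩
    rw [iterExt_succ]
    exact ⟨_, _, _, _, _, rot_of_distTriang _ hT, iterExt_zero_obj S _, Y', hY'', ⟨Iso.refl _⟩⟩

section

variable {S} (hS : IsConcentrated S)

include hS

omit [HasZeroObject T] [Pretriangulated T] [IsTriangulated T] [Preadditive P] [S.Additive]
  [S.Full] in
lemma IsConcentrated.homZero_shiftedImage {i j : ℕ} (hij : i ≠ j + 1) {A B : T}
    (hA : shiftedImage S i A) (hB : shiftedImage S j B) (f : A ⟶ B⟦(1 : ℤ)⟧) : f = 0 := by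
  obtain ⟨Q, ⟨e⟩⟩ := hA
  obtain ⟨Q', ⟨e'⟩⟩ := hB
  have h₁ : HomZero ((S.obj Q)⟦(i : ℤ)⟧) (S.obj Q') ((j : ℤ) + 1) :=
    (homZero_shift_left_iff (i : ℤ) ((j : ℤ) + 1 - i) ((j : ℤ) + 1) (by ring)).2
      (hS _ _ _ (by omega))
  exact (((homZero_shift_right_iff (j : ℤ) 1 ((j : ℤ) + 1) rfl).2 h₁).of_iso_left
    e.symm).of_iso_right e'.symm f

-- The connecting morphism goes from degree `i` to degree `j + 1`, so it vanishes; the triangle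
-- splits and the summands can be exchanged.
omit [IsTriangulated T] [Preadditive P] [S.Additive] [S.Full] in
lemma IsConcentrated.extensionProduct_shiftedImage_le_swap {i j : ℕ} (hij : i ≠ j + 1) :
    (shiftedImage S j).extensionProduct (shiftedImage S i) ≤
      (shiftedImage S i).extensionProduct (shiftedImage S j) := by
  rintro Y ⟨A, B, f, g, δ, hT, hA, hB⟩
  obtain ⟨e, -⟩ := exists_iso_binaryBiproduct_of_distTriang _ hT
    (hS.homZero_shiftedImage hij hB hA δ)
  exact ObjectProperty.prop_of_iso _ (e ≪≫ biprod.braiding A B).symm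
    ⟨_, _, _, _, _, binaryBiproductTriangle_distinguished B A, hB, hA⟩

omit [IsTriangulated T] [S.Full] in
lemma IsConcentrated.extensionProduct_shiftedImage_le [HasBinaryBiproducts P] (i : ℕ) :
    (shiftedImage S i).extensionProduct (shiftedImage S i) ≤ shiftedImage S i := by
  rintro Y ⟨A, B, f, g, δ, hT, hA, hB⟩
  obtain ⟨e, -⟩ := exists_iso_binaryBiproduct_of_distTriang _ hT
    (hS.homZero_shiftedImage (by omega) hB hA δ)
  obtain ⟨Q, ⟨e'⟩⟩ := hA
  obtain ⟨Q', ⟨e''⟩⟩ := hB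
  have := preservesBinaryBiproducts_of_preservesBiproducts (S ⋙ shiftFunctor T (i : ℤ))
  exact ⟨Q ⊞ Q', ⟨e ≪≫ biprod.mapIso e' e'' ≪≫
    ((S ⋙ shiftFunctor T (i : ℤ)).mapBiprod Q Q').symm⟩⟩

-- The factor of degree `i` moves to the left past all factors of higher degree and is absorbed, by
-- direct sums, in the factor of its own degree.
omit [S.Full] in
lemma IsConcentrated.iterExt_extensionProduct_shiftedImage_le [HasBinaryBiproducts P] {n i : ℕ}
    (hi : i ≤ n) : (iterExt S n).extensionProduct (shiftedImage S i) ≤ iterExt S n := by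
  induction n with
  | zero =>
    obtain rfl : i = 0 := by omega
    exact hS.extensionProduct_shiftedImage_le 0
  | succ n ih =>
    change ((iterExt S n).extensionProduct (shiftedImage S (n + 1))).extensionProduct _ ≤
      (iterExt S n).extensionProduct (shiftedImage S (n + 1))
    rw [ObjectProperty.extensionProduct_assoc]
    obtain rfl | hi' := eq_or_ne i (n + 1)
    · exact ObjectProperty.monotone_extensionProduct_right _
        (hS.extensionProduct_shiftedImage_le (n + 1))
    · refine (ObjectProperty.monotone_extensionProduct_right _
        (hS.extensionProduct_shiftedImage_le_swap (by omega))).trans ?_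
      rw [← ObjectProperty.extensionProduct_assoc]
      exact ObjectProperty.monotone_extensionProduct_left _ (ih (by omega))

omit [S.Full] in
lemma IsConcentrated.iterExt_extensionProduct_le [HasBinaryBiproducts P] {n i : ℕ} (hi : i ≤ n) :
    (iterExt S n).extensionProduct (iterExt S i) ≤ iterExt S n := by
  induction i with
  | zero => exact hS.iterExt_extensionProduct_shiftedImage_le hi
  | succ i ih =>
    change (iterExt S n).extensionProduct ((iterExt S i).extensionProduct (shiftedImage S (i + 1)))
      ≤ _
    rw [← ObjectProperty.extensionProduct_assoc]
    exact (ObjectProperty.monotone_extensionProduct_left _ (ih (by omega))).trans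
      (hS.iterExt_extensionProduct_shiftedImage_le hi)

end

end IteratedExtensions

/-! ### Exactness and linearity in categories of functors. -/

section FunctorCategories

variable (k : Type w) [CommRing k]

lemma functor_exact_iff {C : Type*} [Category* C] (S : ShortComplex (C ⥤ ModuleCat.{v} k)) :
    S.Exact ↔ ∀ (X : C) (x : S.X₂.obj X), S.g.app X x = 0 → ∃ y, S.f.app X y = x := by
  have h : S.Exact ↔ ∀ X : C, (S.map ((evaluation C (ModuleCat.{v} k)).obj X)).Exact := by
    constructor
    · intro hS X
      exact hS.map _
    · intro hS
      rw [ShortComplex.exact_iff_isZero_homology, Functor.isZero_iff]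
      intro X
      exact ((ShortComplex.exact_iff_isZero_homology _).1 (hS X)).of_iso
        (S.mapHomologyIso ((evaluation C (ModuleCat.{v} k)).obj X)).symm
  rw [h]
  exact forall_congr' fun X => ShortComplex.moduleCat_exact_iff _

lemma functor_mono_iff {C : Type*} [Category* C] {F G : C ⥤ ModuleCat.{v} k} (f : F ⟶ G) :
    Mono f ↔ ∀ (X : C) (x : F.obj X), f.app X x = 0 → x = 0 := by
  rw [NatTrans.mono_iff_mono_app]
  refine forall_congr' fun X => ?_
  rw [ModuleCat.mono_iff_injective]
  exact injective_iff_map_eq_zero _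

lemma functor_epi_iff {C : Type*} [Category* C] {F G : C ⥤ ModuleCat.{v} k} (f : F ⟶ G) :
    Epi f ↔ ∀ (X : C) (y : G.obj X), ∃ x, f.app X x = y := by
  rw [NatTrans.epi_iff_epi_app]
  refine forall_congr' fun X => ?_
  rw [ModuleCat.epi_iff_surjective]
  rfl

variable {P : Type u} [Category.{v} P] [Preadditive P] [Linear k P]

lemma linearModules_of_mono {F G : Pᵒᵖ ⥤ ModuleCat.{v} k} (f : F ⟶ G) [Mono f]
    (hG : linearModules k P G) : linearModules k P F := by
  have inj : ∀ X, Mono (f.app X) := (NatTrans.mono_iff_mono_app f).1 ‹_›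
  have := hG.1
  refine ⟨⟨fun {X Y a b} => ?_⟩, fun {X Y} r a => ?_⟩
  · rw [← cancel_mono (f.app Y), f.naturality, Functor.map_add, Preadditive.comp_add,
      Preadditive.add_comp, f.naturality, f.naturality]
  · rw [← cancel_mono (f.app _), f.naturality, hG.2, Linear.comp_smul, Linear.smul_comp,
      f.naturality]

lemma linearModules_of_epi {F G : Pᵒᵖ ⥤ ModuleCat.{v} k} (f : F ⟶ G) [Epi f]
    (hF : linearModules k P F) : linearModules k P G := by
  have surj : ∀ X, Epi (f.app X) := (NatTrans.epi_iff_epi_app f).1 ‹_›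
  have := hF.1
  refine ⟨⟨fun {X Y a b} => ?_⟩, fun {X Y} r a => ?_⟩
  · rw [← cancel_epi (f.app X), ← f.naturality, Functor.map_add, Preadditive.add_comp,
      Preadditive.comp_add, f.naturality, f.naturality]
  · rw [← cancel_epi (f.app _), ← f.naturality, hF.2, Linear.smul_comp, Linear.comp_smul,
      f.naturality]

lemma linearModules_biprod {F G : Pᵒᵖ ⥤ ModuleCat.{v} k} (hF : linearModules k P F)
    (hG : linearModules k P G) : linearModules k P (F ⊞ G) := by
  have := hF.1
  have := hG.1
  have hom_ext : ∀ {Y : Pᵒᵖ} {Z : ModuleCat.{v} k} {a b : Z ⟶ (F ⊞ G).obj Y},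
      a ≫ (biprod.fst : F ⊞ G ⟶ F).app Y = b ≫ (biprod.fst : F ⊞ G ⟶ F).app Y →
      a ≫ (biprod.snd : F ⊞ G ⟶ G).app Y = b ≫ (biprod.snd : F ⊞ G ⟶ G).app Y → a = b := by
    intro Y Z a b h₁ h₂
    have e : (biprod.fst : F ⊞ G ⟶ F).app Y ≫ (biprod.inl : F ⟶ F ⊞ G).app Y +
        (biprod.snd : F ⊞ G ⟶ G).app Y ≫ (biprod.inr : G ⟶ F ⊞ G).app Y = 𝟙 _ := by
      have := congr_app (biprod.total (X := F) (Y := G)) Y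
      exact this
    rw [← Category.comp_id a, ← Category.comp_id b, ← e, Preadditive.comp_add,
      Preadditive.comp_add, reassoc_of% h₁, reassoc_of% h₂]
  refine ⟨⟨fun {X Y a b} => hom_ext ?_ ?_⟩, fun {X Y} r a => hom_ext ?_ ?_⟩
  · simp only [NatTrans.naturality, Functor.map_add, Preadditive.comp_add, Preadditive.add_comp]
  · simp only [NatTrans.naturality, Functor.map_add, Preadditive.comp_add, Preadditive.add_comp]
  · simp only [NatTrans.naturality, hF.2, Linear.comp_smul, Linear.smul_comp]
  · simp only [NatTrans.naturality, hG.2, Linear.comp_smul, Linear.smul_comp]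

/-- The morphism from a representable module determined by an element. -/
def linearYonedaDesc {F : Pᵒᵖ ⥤ ModuleCat.{v} k} (hF : linearModules k P F) {X : P}
    (x : F.obj (Opposite.op X)) : (linearYoneda k P).obj X ⟶ F where
  app Y := ModuleCat.ofHom
    { toFun := fun (f : Y.unop ⟶ X) => F.map f.op x
      map_add' := fun f g => by
        have := hF.1
        change F.map (f.op + g.op) x = _
        rw [Functor.map_add]
        rfl
      map_smul' := fun r f => by
        rw [hF.2 r f]
        rfl }
  naturality Y Z g := by
    ext f
    change F.map (f.op ≫ g) x = F.map g (F.map f.op x)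
    rw [F.map_comp]
    rfl

end FunctorCategories

/-! ### The restricted Yoneda functor. -/

section ModuleFunctor

open Pretriangulated Opposite

variable (k : Type w) [CommRing k] {P : Type*} [Category.{v} P]
  {T : Type u} [Category.{v} T] [Preadditive T] [Linear k T] (S : P ⥤ T)

/-- The functor which maps an object `Y` to the module `Hom(S -, Y)`. -/
def moduleFunctor : T ⥤ Pᵒᵖ ⥤ ModuleCat.{v} k :=
  linearYoneda k T ⋙ (Functor.whiskeringLeft _ _ _).obj S.op

instance : (moduleFunctor k S).Additive where
  map_add {X Y f g} := by
    ext N x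
    exact Preadditive.comp_add _ _ _ x f g

instance : (moduleFunctor k S).Linear k where
  map_smul {X Y} f r := by
    ext N x
    exact Linear.comp_smul _ _ _ x r f

variable [Preadditive P] [Linear k P] [S.Additive] [S.Linear k]

lemma linearModules_moduleFunctor (Y : T) : linearModules k P ((moduleFunctor k S).obj Y) := by
  refine ⟨⟨fun {N N' a b} => ?_⟩, fun {N N'} r a => ?_⟩
  · ext x
    change S.map (a.unop + b.unop) ≫ x = S.map a.unop ≫ x + S.map b.unop ≫ x
    exact (congrArg (· ≫ (x : S.obj N.unop ⟶ Y)) S.map_add).trans (Preadditive.add_comp _ _ _ _ _ _)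
  · ext x
    change S.map (r • a) ≫ x = r • (S.map a ≫ x)
    exact (congrArg (· ≫ (x : S.obj N' ⟶ Y)) (S.map_smul r a)).trans (Linear.smul_comp _ _ _ _ _ _)

end ModuleFunctor

/-! ### Morphisms out of a quotient of a direct sum of two functors. -/

section JointlySurjective

variable (k : Type w) [CommRing k] {C : Type*} [Category* C] {F G H K : C ⥤ ModuleCat.{v} k}
  (a : F ⟶ H) (b : G ⟶ H)

lemma hom_ext_of_jointly_surjective
    (hab : ∀ (X : C) (x : H.obj X), ∃ y z, a.app X y + b.app X z = x) {φ ψ : H ⟶ K}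
    (ha : a ≫ φ = a ≫ ψ) (hb : b ≫ φ = b ≫ ψ) : φ = ψ := by
  ext X x
  obtain ⟨y, z, rfl⟩ := hab X x
  rw [map_add, map_add]
  have h₁ := congr(($ha).app X y)
  have h₂ := congr(($hb).app X z)
  exact congrArg₂ (· + ·) h₁ h₂

lemma exists_desc_of_jointly_surjective (a' : F ⟶ K) (b' : G ⟶ K)
    (hab : ∀ (X : C) (x : H.obj X), ∃ y z, a.app X y + b.app X z = x)
    (h : ∀ (X : C) y z, a.app X y + b.app X z = 0 → a'.app X y + b'.app X z = 0) :
    ∃ φ : H ⟶ K, a ≫ φ = a' ∧ b ≫ φ = b' := by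
  have app_desc : ∀ {L : C ⥤ ModuleCat.{v} k} (u : F ⟶ L) (v : G ⟶ L) (X : C)
      (t : (F ⊞ G : C ⥤ ModuleCat.{v} k).obj X), (biprod.desc u v).app X t =
        u.app X ((biprod.fst : F ⊞ G ⟶ F).app X t) +
          v.app X ((biprod.snd : F ⊞ G ⟶ G).app X t) := by
    intro L u v X t
    have e : biprod.desc u v = biprod.fst ≫ u + biprod.snd ≫ v :=
      biprod.hom_ext' _ _ (by simp) (by simp)
    rw [e]
    rfl
  have : Epi (biprod.desc a b) := (functor_epi_iff k _).2 fun X x => by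
    obtain ⟨y, z, rfl⟩ := hab X x
    refine ⟨(biprod.inl : F ⟶ F ⊞ G).app X y + (biprod.inr : G ⟶ F ⊞ G).app X z, ?_⟩
    rw [map_add]
    exact congrArg₂ (· + ·) congr(($(biprod.inl_desc a b)).app X y)
      congr(($(biprod.inr_desc a b)).app X z)
  have hker : kernel.ι (biprod.desc a b) ≫ biprod.desc a' b' = 0 := by
    ext X t
    refine (app_desc a' b' X _).trans (h X _ _ ?_)
    rw [← app_desc]
    exact congr(($(kernel.condition (biprod.desc a b))).app X t)
  obtain ⟨φ, hφ⟩ := CokernelCofork.IsColimit.desc'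
    (Abelian.epiIsCokernelOfKernel _ (kernelIsKernel (biprod.desc a b))) _ hker
  replace hφ : biprod.desc a b ≫ φ = biprod.desc a' b' := hφ
  exact ⟨φ, by rw [← biprod.inl_desc a b, Category.assoc, hφ, biprod.inl_desc],
    by rw [← biprod.inr_desc a b, Category.assoc, hφ, biprod.inr_desc]⟩

end JointlySurjective

/-! ### Distinguished triangles versus short exact sequences of modules. -/

section TriangleModules

open Pretriangulated Opposite

section Cone

variable {T : Type u} [Category.{v} T] [Preadditive T] [HasZeroObject T] [HasShift T ℤ]
  [∀ n : ℤ, (shiftFunctor T n).Additive] [Pretriangulated T]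
  {X Y Z : T} {f : X ⟶ Y} {g : Y ⟶ Z} {δ : Z ⟶ X⟦(1 : ℤ)⟧}
  (hT : Triangle.mk f g δ ∈ distTriang T)

include hT

lemma eq_zero_of_comp_mor₁_eq_zero {A : T} (hZ : HomZero A Z (-1)) (x : A ⟶ X) (hx : x ≫ f = 0) :
    x = 0 := by
  obtain ⟨u, w, hT'⟩ := exists_invRotate_distinguished hT
  obtain ⟨b, rfl⟩ := distTriang_lift₂ hT' x hx
  rw [hZ b, zero_comp]

lemma homZero_neg_one_of_mono {A : T} (hY : HomZero A Y (-1))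
    (hf : ∀ x : A ⟶ X, x ≫ f = 0 → x = 0) : HomZero A Z (-1) := by
  intro z
  obtain ⟨u, w, hT'⟩ := exists_invRotate_distinguished hT
  obtain ⟨u', w', hT''⟩ := exists_invRotate_distinguished hT'
  obtain ⟨b, rfl⟩ := distTriang_lift₂ hT'' z
    (hf _ (by rw [Category.assoc, distTriang_comp₁₂ hT', comp_zero]))
  rw [hY b, zero_comp]

lemma homZero_zero_of_epi {A : T} (hX : HomZero A X 1)
    (hf : ∀ y : A ⟶ Y, ∃ x : A ⟶ X, x ≫ f = y) : HomZero A Z 0 := by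
  rw [homZero_zero_iff]
  intro z
  obtain ⟨y, rfl⟩ := distTriang_lift₃ hT z (hX _)
  obtain ⟨x, rfl⟩ := hf y
  rw [Category.assoc, distTriang_comp₁₂ hT, comp_zero]

lemma homZero_cone_of_bijective {A : T} (hX : ∀ i ≠ 0, HomZero A X i) (hY : ∀ i ≠ 0, HomZero A Y i)
    (hf : ∀ x : A ⟶ X, x ≫ f = 0 → x = 0) (hf' : ∀ y : A ⟶ Y, ∃ x : A ⟶ X, x ≫ f = y) (i : ℤ) :
    HomZero A Z i := by
  obtain rfl | h0 := eq_or_ne i 0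
  · exact homZero_zero_of_epi hT (hX 1 one_ne_zero) hf'
  · obtain rfl | h1 := eq_or_ne i (-1)
    · exact homZero_neg_one_of_mono hT (hY _ h0) hf
    · exact HomZero.right₃ hT (hY i h0) (hX (i + 1) (by omega))

lemma isIso_mor₁_of_homZero (hX : HomZero X Z (-1)) (hY : HomZero Y Z 0) : IsIso f := by
  have hZ : HomZero Z Z 0 := HomZero.left₃ hT hY (by simpa using hX)
  refine (Triangle.isZero₃_iff_isIso₁ _ hT).1 ?_
  rw [IsZero.iff_id_eq_zero]
  exact homZero_zero_iff.1 hZ _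

end Cone

variable (k : Type w) [CommRing k] {P : Type*} [Category.{v} P]
  {T : Type u} [Category.{v} T] [Preadditive T] [Linear k T] (S : P ⥤ T)
  [HasZeroObject T] [HasShift T ℤ]
  [∀ n : ℤ, (shiftFunctor T n).Additive] [Pretriangulated T]

/-- The long exact sequence of `Hom(S N, -)` is cut off at both ends by the vanishing hypotheses. -/
lemma shortExact_moduleFunctor_of_distTriang {X Y Z : T} {f : X ⟶ Y} {g : Y ⟶ Z}
    {δ : Z ⟶ X⟦(1 : ℤ)⟧} (hT : Triangle.mk f g δ ∈ distTriang T) (zero : f ≫ g = 0)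
    (hX : ∀ N, HomZero (S.obj N) X 1) (hZ : ∀ N, HomZero (S.obj N) Z (-1)) :
    ((ShortComplex.mk f g zero).map (moduleFunctor k S)).ShortExact := by
  have hmono : Mono ((moduleFunctor k S).map f) := (functor_mono_iff k _).2 fun N x hx =>
    eq_zero_of_comp_mor₁_eq_zero hT (hZ N.unop) x hx
  have hepi : Epi ((moduleFunctor k S).map g) := (functor_epi_iff k _).2 fun N z =>
    distTriang_lift₃ hT z (hX N.unop _)
  exact { exact := (functor_exact_iff k _).2 fun N y hy => distTriang_lift₂ hT y hy
          mono_f := hmono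
          epi_g := hepi }

variable {S}

/-- The cone `C` of `f` maps to `Z` by some `c`, bijectively on graded morphisms out of the `S N`.
The cone of `c` thus receives nothing from the `S N`, hence by `hleft` nothing from `X`, `Y` or `Z`,
and `c` is an isomorphism. -/
lemma exists_distTriang_of_shortExact_moduleFunctor {X Y Z : T} {f : X ⟶ Y} {g : Y ⟶ Z}
    (zero : f ≫ g = 0)
    (hX : ∀ N, ∀ i ≠ 0, HomZero (S.obj N) X i) (hY : ∀ N, ∀ i ≠ 0, HomZero (S.obj N) Y i)
    (hZ : ∀ N, ∀ i ≠ 0, HomZero (S.obj N) Z i)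
    (hleft : ∀ Q : T, (∀ N i, HomZero (S.obj N) Q i) →
      ∀ i, HomZero X Q i ∧ HomZero Y Q i ∧ HomZero Z Q i)
    (h : ((ShortComplex.mk f g zero).map (moduleFunctor k S)).ShortExact) :
    ∃ δ : Z ⟶ X⟦(1 : ℤ)⟧, Triangle.mk f g δ ∈ distTriang T := by
  have hmono : ∀ {N : P} (x : S.obj N ⟶ X), x ≫ f = 0 → x = 0 := fun {N} x hx =>
    (functor_mono_iff k _).1 h.mono_f (op N) x hx
  have hepi : ∀ {N : P} (z : S.obj N ⟶ Z), ∃ y : S.obj N ⟶ Y, y ≫ g = z := fun {N} z =>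
    (functor_epi_iff k _).1 h.epi_g (op N) z
  have hexact : ∀ {N : P} (y : S.obj N ⟶ Y), y ≫ g = 0 → ∃ x : S.obj N ⟶ X, x ≫ f = y :=
    fun {N} y hy => (functor_exact_iff k _).1 h.exact (op N) y hy
  obtain ⟨C, p, e, hC⟩ := distinguished_cocone_triangle f
  obtain ⟨c, hc⟩ := distTriang_desc₂ hC g zero
  have hC' : ∀ N, ∀ i ≠ 0, HomZero (S.obj N) C i := by
    intro N i hi
    obtain rfl | h1 := eq_or_ne i (-1)
    · exact homZero_neg_one_of_mono hC (hY N _ hi) hmono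
    · exact HomZero.right₃ hC (hY N i hi) (hX N (i + 1) (by omega))
  obtain ⟨D, p', e', hD⟩ := distinguished_cocone_triangle c
  have hD' : ∀ N i, HomZero (S.obj N) D i := by
    intro N i
    refine homZero_cone_of_bijective hD (hC' N) (hZ N) ?_ ?_ i
    · intro a ha
      obtain ⟨y, rfl⟩ := distTriang_lift₃ hC a (hX N 1 one_ne_zero _)
      obtain ⟨x, rfl⟩ := hexact y (by rw [← hc, ← Category.assoc, ha])
      rw [Category.assoc, distTriang_comp₁₂ hC, comp_zero]
    · intro z
      obtain ⟨y, rfl⟩ := hepi z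
      exact ⟨y ≫ p, by rw [Category.assoc, hc]⟩
  have hl := hleft D hD'
  have : IsIso c := isIso_mor₁_of_homZero hD
    (HomZero.left₃ hC (hl _).2.1 (hl _).1) (hl 0).2.2
  exact ⟨inv c ≫ e, distTriang_of_iso hC (Iso.refl _) (Iso.refl _) (asIso c) (by simp)
    (by simp [hc]) (by simp)⟩

variable [Preadditive P] [Linear k P] [S.Additive] [S.Linear k] [S.Full] [S.Faithful]
  (hS : IsConcentrated S)

section Presentation

variable {k}

/-- The morphism from a representable module to `Hom(S -, Y)` determined by a morphism
`S N ⟶ Y`. -/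
abbrev representableDesc {N : P} {Y : T} (q : S.obj N ⟶ Y) :
    (linearYoneda k P).obj N ⟶ (moduleFunctor k S).obj Y :=
  linearYonedaDesc k (linearModules_moduleFunctor k S Y) (X := N) q

end Presentation

variable {n : ℕ} {X : ℕ → P} {d : ∀ j, X (j + 1) ⟶ X j} {Y : T} {q : S.obj (X 0) ⟶ Y}

namespace IsTotalization

omit [S.Full] [S.Faithful] in
lemma map_d_comp_representableDesc (hY : IsTotalization S n X d q) :
    (linearYoneda k P).map (d 0) ≫ representableDesc (k := k) q = 0 := by
  have key : ∀ {N : P} (g : N ⟶ X 1), S.map (g ≫ d 0) ≫ q = 0 := fun g => by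
    rw [S.map_comp, Category.assoc, hY.map_d_comp, comp_zero]
  ext N g
  exact key (N := N.unop) g

include hS

omit [S.Faithful] in
lemma epi_representableDesc (hY : IsTotalization S n X d q) :
    Epi (representableDesc (k := k) q) :=
  (functor_epi_iff k _).2 fun N f => hY.exists_lift hS (N := N.unop) f

lemma exact_representableDesc (hY : IsTotalization S n X d q) :
    (ShortComplex.mk _ _ (hY.map_d_comp_representableDesc k)).Exact :=
  (functor_exact_iff k _).2 fun N f hf => hY.exists_lift_of_comp_eq_zero hS (N := N.unop) f hf

-- Both sides are the morphisms `S (X 0) ⟶ Q` killed by `S.map (d 0)`: on one side `q` acts as a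
-- cokernel, on the other Yoneda applies to the presentation of the module.
omit [S.Faithful] [Linear k P] [S.Linear k] in
lemma bijective_moduleFunctor_map (hY : IsTotalization S n X d q) {Q : T}
    (hQ : ∀ N i, i < 0 → HomZero (S.obj N) Q i) :
    Function.Bijective (fun f : Y ⟶ Q => (moduleFunctor k S).map f) := by
  constructor
  · intro f f' hff
    rw [← sub_eq_zero]
    refine hY.eq_zero hQ _ ?_
    rw [Preadditive.comp_sub, sub_eq_zero]
    have := congrArg (fun φ : (moduleFunctor k S).obj Y ⟶ (moduleFunctor k S).obj Q =>
      φ.app (op (X 0)) q) hff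
    exact this
  · intro φ
    have nat : ∀ {N N' : P} (a : N ⟶ N') (x : S.obj N' ⟶ Y),
        (φ.app (op N) (S.map a ≫ x) : S.obj N ⟶ Q) = S.map a ≫ φ.app (op N') x := fun a x =>
      congr($(φ.naturality a.op) x)
    obtain ⟨f, hf⟩ := hY.exists_desc hQ (φ.app (op (X 0)) q) (by
      rw [← nat, hY.map_d_comp]
      exact map_zero _)
    refine ⟨f, ?_⟩
    ext N x
    obtain ⟨m, hm⟩ := hY.exists_lift hS (N := N.unop) x
    change x ≫ f = φ.app N x
    rw [← hm]
    exact (Category.assoc _ _ _).trans ((congrArg (S.map m ≫ ·) hf).trans (nat m q).symm)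

end IsTotalization

include hS in
/-- An extension of `Hom(S -, Z)` by `Hom(S -, A)` comes from a triangle `A ⟶ Y ⟶ Z ⟶ A⟦1⟧`. -/
lemma IsTotalization.exists_distTriang_of_extension {Z : T} {q : S.obj (X 0) ⟶ Z}
    (hZ : IsTotalization S (n + 1) X d q) (hZ' : ∀ N, HomZero (S.obj N) Z (-1)) {A : T}
    (hA : ∀ N, ∀ i ≠ 0, HomZero (S.obj N) A i) {G : Pᵒᵖ ⥤ ModuleCat.{v} k}
    (hG : linearModules k P G) {α : (moduleFunctor k S).obj A ⟶ G}
    {β : G ⟶ (moduleFunctor k S).obj Z} {zero : α ≫ β = 0}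
    (h : (ShortComplex.mk α β zero).ShortExact) :
    ∃ (Y : T) (a : A ⟶ Y) (b : Y ⟶ Z) (δ : Z ⟶ A⟦(1 : ℤ)⟧), Triangle.mk a b δ ∈ distTriang T ∧
      Nonempty ((moduleFunctor k S).obj Y ≅ G) := by
  have hmono : ∀ {N : P} (x : S.obj N ⟶ A), α.app (op N) x = 0 → x = 0 := fun {N} x hx =>
    (functor_mono_iff k _).1 h.mono_f (op N) x hx
  have hexact : ∀ {N : P} (y : G.obj (op N)), β.app (op N) y = 0 →
      ∃ x : S.obj N ⟶ A, α.app (op N) x = y :=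
    fun {N} y hy => (functor_exact_iff k _).1 h.exact (op N) y hy
  have natα : ∀ {N N' : P} (m : N ⟶ N') (x : S.obj N' ⟶ A),
      α.app (op N) (S.map m ≫ x) = G.map m.op (α.app (op N') x) := fun m x =>
    congr($(α.naturality m.op) x)
  have natβ : ∀ {N N' : P} (m : N ⟶ N') (x : G.obj (op N')),
      (β.app (op N) (G.map m.op x) : S.obj N ⟶ Z) = S.map m ≫ β.app (op N') x := fun m x =>
    congr($(β.naturality m.op) x)
  -- By Yoneda, `γ` lifts `q` to `G`. Its restriction along `d 0` lies in the submodule and yields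
  -- `x : S (X 1) ⟶ A`, which is a cocycle since `α` is a monomorphism.
  obtain ⟨γ, hγ⟩ : ∃ γ : G.obj (op (X 0)), (β.app (op (X 0)) γ : S.obj (X 0) ⟶ Z) = q :=
    (functor_epi_iff k _).1 h.epi_g (op (X 0)) q
  obtain ⟨x, hx⟩ := hexact (G.map (d 0).op γ) (by
    refine (natβ _ _).trans ?_
    rw [hγ, hZ.map_d_comp]
    rfl)
  have hdx : S.map (d 1) ≫ x = 0 := by
    apply hmono
    rw [natα, hx]
    have := hG.1
    have e : G.map (d 0).op ≫ G.map (d 1).op = 0 := by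
      rw [← G.map_comp, ← op_comp, hZ.d_comp_d 0, op_zero, G.map_zero]
    exact congr($e γ)
  have hlift : ∀ {N : P} (f : S.obj N ⟶ Z), ∃ g : N ⟶ X 0, S.map g ≫ q = f :=
    fun f => hZ.exists_lift hS f
  have hlift' : ∀ {N : P} (g : N ⟶ X 0), S.map g ≫ q = 0 → ∃ l, l ≫ d 0 = g :=
    fun g hg => hZ.exists_lift_of_comp_eq_zero hS g hg
  obtain ⟨Z', q', r, δ, e, hT, hY'⟩ := hZ
  -- The cocycle `x` extends over the totalization `Y'` of the truncated complex. The triangle `Y' ⟶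
  -- S (X 0) ⟶ Z` is then pushed out along `w`.
  obtain ⟨w, hw⟩ := hY'.exists_desc (fun N i hi => hA N i hi.ne) x hdx
  obtain ⟨Y, a, b, hT'⟩ := distinguished_cocone_triangle₂ (δ ≫ w⟦(1 : ℤ)⟧')
  obtain ⟨y, hy, hy'⟩ : ∃ y : S.obj (X 0) ⟶ Y, r ≫ y = w ≫ a ∧ q = y ≫ b := by
    obtain ⟨y, hy, hy'⟩ := complete_distinguished_triangle_morphism₂ _ _ hT hT' w (𝟙 Z)
      (Category.id_comp _).symm
    exact ⟨y, hy, (Category.comp_id _).symm.trans hy'⟩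
  have hab : a ≫ b = 0 := distTriang_comp₁₂ hT'
  have hY := shortExact_moduleFunctor_of_distTriang k S hT' hab
    (fun N => hA N 1 one_ne_zero) hZ'
  -- The module of `Y` is generated by `y` and the image of `a`. Every relation between them holds
  -- between `γ` and `α` by `hker`, so there is a comparison `θ` to `G`; it is the identity on the
  -- ends of the extensions, hence an isomorphism.
  have hsurj : ∀ {N : P} (f : S.obj N ⟶ Y), ∃ (m : N ⟶ X 0) (x' : S.obj N ⟶ A),
      S.map m ≫ y + x' ≫ a = f := by
    intro N f
    obtain ⟨m, hm⟩ := hlift (f ≫ b)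
    obtain ⟨x', hx'⟩ := distTriang_lift₂ hT' (f - S.map m ≫ y) (by
      rw [Preadditive.sub_comp, Category.assoc, ← hy', hm, sub_self])
    exact ⟨m, x', by rw [hx', add_sub_cancel]⟩
  have hker : ∀ {N : P} (m : N ⟶ X 0) (x' : S.obj N ⟶ A), S.map m ≫ y + x' ≫ a = 0 →
      G.map m.op γ + α.app (op N) x' = 0 := by
    intro N m x' hm
    have hmq : S.map m ≫ q = 0 := by
      have := congrArg (· ≫ b) hm
      simpa only [Preadditive.add_comp, Category.assoc, hab, comp_zero, add_zero, zero_comp,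
        ← hy'] using this
    obtain ⟨l, rfl⟩ := hlift' m hmq
    have hl : S.map l ≫ x + x' = 0 := by
      refine eq_zero_of_comp_mor₁_eq_zero hT' (hZ' N) _ ?_
      rw [← hm, S.map_comp, ← e, Preadditive.add_comp, ← hw]
      simp only [Category.assoc, hy]
    have hl' : G.map (l ≫ d 0).op γ = α.app (op N) (S.map l ≫ x) := by
      rw [natα, hx, op_comp, G.map_comp]
      rfl
    rw [hl']
    refine ((α.app (op N)).hom.map_add (S.map l ≫ x) x').symm.trans ?_
    exact (congrArg (α.app (op N)).hom hl).trans (map_zero _)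
  obtain ⟨θ, hθ₁, hθ₂⟩ := exists_desc_of_jointly_surjective k (representableDesc y)
    ((moduleFunctor k S).map a) (linearYonedaDesc k hG γ) α (fun N f => hsurj (N := N.unop) f)
    (fun N m x' => hker (N := N.unop) m x')
  have hθ : θ ≫ β = (moduleFunctor k S).map b := by
    refine hom_ext_of_jointly_surjective k (representableDesc y)
      ((moduleFunctor k S).map a) (fun N f => hsurj (N := N.unop) f) ?_ ?_
    · rw [← Category.assoc, hθ₁]
      have key : ∀ {N : P} (m : N ⟶ X 0), β.app (op N) (G.map m.op γ) = (S.map m ≫ y) ≫ b := by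
        intro N m
        refine (natβ m γ).trans ?_
        exact (congrArg (S.map m ≫ ·) (hγ.trans hy')).trans (Category.assoc _ _ _).symm
      ext N m
      exact key (N := N.unop) m
    · rw [← Category.assoc, hθ₂, zero, ← (moduleFunctor k S).map_comp a b, hab, Functor.map_zero]
  let φ : (ShortComplex.mk a b hab).map (moduleFunctor k S) ⟶ ShortComplex.mk α β zero :=
    { τ₁ := 𝟙 _
      τ₂ := θ
      τ₃ := 𝟙 _
      comm₁₂ := (Category.id_comp _).trans hθ₂.symm
      comm₂₃ := hθ.trans (Category.comp_id _).symm }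
  have h₁ : IsIso φ.τ₁ := inferInstanceAs (IsIso (𝟙 _))
  have h₃ : IsIso φ.τ₃ := inferInstanceAs (IsIso (𝟙 _))
  have : IsIso θ := ShortComplex.isIso₂_of_shortExact_of_isIso₁₃ φ hY h
  exact ⟨Y, a, b, _, hT', ⟨asIso θ⟩⟩

end TriangleModules

/-! ### Stalk complexes in the homotopy category. -/

section Stalks

open Pretriangulated

variable {P : Type u} [Category.{v} P] [Preadditive P] [HasZeroObject P]

instance (n : ℤ) : (HomotopyCategory.singleFunctor P n).Full :=
  inferInstanceAs (CochainComplex.singleFunctor P n ⋙ HomotopyCategory.quotient _ _).Full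

instance (n : ℤ) : (HomotopyCategory.singleFunctor P n).Faithful where
  map_injective {X Y f g} hfg := by
    apply (CochainComplex.singleFunctor P n).map_injective
    -- The differentials of stalk complexes vanish, so homotopic morphisms between them are equal.
    have e := HomotopyCategory.homotopyOfEq _ _ hfg
    apply HomologicalComplex.from_single_hom_ext
    rw [e.comm n]
    simp [dNext, prevD]
    rfl

variable [HasBinaryBiproducts P]

-- Up to the shift isomorphism, such a morphism is represented by a chain map between stalks in
-- different degrees.
omit [HasBinaryBiproducts P] in
lemma isConcentrated_singleFunctor :
    IsConcentrated (HomotopyCategory.singleFunctor P 0) := by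
  intro X Y i hi f
  let e := ((HomotopyCategory.singleFunctors P).shiftIso i (-i) 0 (by simp)).app Y
  rw [← cancel_mono e.hom, zero_comp]
  obtain ⟨g, hg⟩ := (HomotopyCategory.quotient P (ComplexShape.up ℤ)).map_surjective
    (X := (CochainComplex.singleFunctor P 0).obj X)
    (Y := (CochainComplex.singleFunctor P (-i)).obj Y) (f ≫ e.hom)
  have hg0 : g = 0 := by
    apply HomologicalComplex.from_single_hom_ext
    exact (HomologicalComplex.isZero_single_obj_X _ (-i) Y 0 (by omega)).eq_of_tgt _ _
  exact hg.symm.trans ((congrArg (HomotopyCategory.quotient P (ComplexShape.up ℤ)).map hg0).trans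
    (Functor.map_zero _ _ _))

lemma iteratedExtension_eq_iterExt (n : ℕ) :
    iteratedExtension P n = iterExt (HomotopyCategory.singleFunctor P 0) n := by
  induction n with
  | zero => rfl
  | succ n ih =>
    change (iteratedExtension P n).extensionProduct _ = _
    rw [ih]
    rfl

end Stalks

/-! ### The pair formed by `M` and the injectives: part (a). -/

section ClusterTiltingPairs

lemma hasBinaryBiproducts_fullSubcategory {C : Type u} [Category.{v} C] [Preadditive C]
    [HasBinaryBiproducts C] {M : ObjectProperty C} (hM : ∀ X Y, M X → M Y → M (X ⊞ Y)) :
    HasBinaryBiproducts M.FullSubcategory where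
  has_binary_biproduct X Y := hasBinaryBiproduct_of_total
    { pt := ⟨X.obj ⊞ Y.obj, hM _ _ X.2 Y.2⟩
      fst := ObjectProperty.homMk biprod.fst
      snd := ObjectProperty.homMk biprod.snd
      inl := ObjectProperty.homMk biprod.inl
      inr := ObjectProperty.homMk biprod.inr
      inl_fst := ObjectProperty.hom_ext _ biprod.inl_fst
      inl_snd := ObjectProperty.hom_ext _ biprod.inl_snd
      inr_fst := ObjectProperty.hom_ext _ biprod.inr_fst
      inr_snd := ObjectProperty.hom_ext _ biprod.inr_snd }
    (ObjectProperty.hom_ext _ biprod.total)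

namespace IsClusterTilting

variable {E : Type u} [Category.{v} E] [Preadditive E] {conf : ObjectProperty (ShortComplex E)}
  (h : IsExactStructure conf) (hwic : IsWeaklyIdempotentComplete E)
  (hinj : EnoughInjectives conf) {d : ℕ} {M : ObjectProperty E} (hM : IsClusterTilting conf d M)

include hM h hinj

lemma hasZeroObject_fullSubcategory : HasZeroObject M.FullSubcategory := by
  have := h.hasZeroObject
  obtain ⟨Z, hZ⟩ := HasZeroObject.zero (C := E)
  have : M.ContainsZero := ⟨Z, hZ, hM.injectives_le h hinj _ (injectives_of_isZero hZ)⟩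
  infer_instance

lemma hasBinaryBiproducts_fullSubcategory : HasBinaryBiproducts M.FullSubcategory := by
  have := h.hasBinaryBiproducts
  exact ExactCT.hasBinaryBiproducts_fullSubcategory fun X Y => hM.prop_biprod h hinj

variable [HasZeroObject M.FullSubcategory] [HasBinaryBiproducts M.FullSubcategory]

omit hM h hinj in
lemma classA_iff {P : Type u} [Category.{v} P] [Preadditive P] [HasZeroObject P]
    [HasBinaryBiproducts P] {I : ObjectProperty P} {n : ℕ}
    {Y : HomotopyCategory P (ComplexShape.up ℤ)} :
    classA I n Y ↔ iterExt (HomotopyCategory.singleFunctor P 0) n Y ∧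
      ∀ J, I J → ∀ i : ℤ, 1 ≤ i → HomZero Y (stalk J) i := by
  rw [classA, iteratedExtension_eq_iterExt]
  refine and_congr_right fun _ => forall₂_congr fun J _ => ⟨fun hY i hi => ?_, fun hY i hi => ?_⟩
  · lift i to ℕ using by omega
    exact hY i (by omega)
  · exact hY i (by omega)

-- This turns the vanishing of `Ext^i(Y, J)` for `i ≥ 1` in the homotopy category into acyclicity in
-- `E`.
include hwic in
lemma exists_isAcyclicResolution_of_isTotalization {n : ℕ} {X : ℕ → M.FullSubcategory}
    {δ : ∀ j, X (j + 1) ⟶ X j} {Y : HomotopyCategory M.FullSubcategory (ComplexShape.up ℤ)}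
    {q : stalk (X 0) ⟶ Y}
    (hY : IsTotalization (HomotopyCategory.singleFunctor M.FullSubcategory 0) n X δ q)
    (hJ : ∀ J : M.FullSubcategory, injectives conf J.obj → ∀ i : ℤ, 1 ≤ i →
      HomZero Y (stalk J) i) :
    ∃ (L : E) (p : (X 0).obj ⟶ L),
      IsAcyclicResolution conf n (fun j => (X j).obj) (fun j => (δ j).hom) p := by
  refine exists_isAcyclicResolution h hwic hinj n (fun j => (X j).obj)
    (fun j => (δ j).hom) (fun j => ?_) (fun j hj => ?_) ?_
  · exact congrArg (fun f => f.hom) (hY.d_comp_d j)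
  · exact M.ι.map_isZero (hY.isZero j hj)
  · intro J hJ' j g hg
    obtain ⟨l, hl⟩ := hY.exists_extension isConcentrated_singleFunctor
      (J := ⟨J, hM.injectives_le h hinj _ hJ'⟩) (hJ _ hJ') j (ObjectProperty.homMk g)
      (ObjectProperty.hom_ext _ hg)
    exact ⟨l.hom, congrArg (fun f => f.hom) hl⟩

include hwic in
lemma isClusterTiltingPair :
    IsClusterTiltingPair d ((injectives conf).inverseImage M.ι) where
  zero_mem X hX := injectives_of_isZero (M.ι.map_isZero hX)
  biprod_mem X Y hX hY := by
    have := h.hasBinaryBiproducts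
    have := preservesBinaryBiproducts_of_preservesBiproducts M.ι
    have e : Retract (M.ι.obj (X ⊞ Y)) (X.obj ⊞ Y.obj) := Retract.ofIso (M.ι.mapBiprod X Y)
    change injectives conf (M.ι.obj (X ⊞ Y))
    exact injectives_of_retract e (injectives_biprod hX hY)
  retract_mem X Y r hY := injectives_of_retract (r.map M.ι) hY
  covariantly_finite Y hY := by
    obtain ⟨hY, hY'⟩ := classA_iff.1 hY
    obtain ⟨X, δ, q, hX⟩ := exists_isTotalization_of_iterExt _ hY
    obtain ⟨L, p, hp⟩ := hM.exists_isAcyclicResolution_of_isTotalization h hwic hinj hX hY'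
    -- The approximation is induced by `X 0 ⟶ L ⟶ J`. A morphism from `Y` to an injective stalk is
    -- determined by its restriction to `X 0`, which factors through `L` and then extends along `i`.
    obtain ⟨J, i, hJ, hi⟩ := hinj L
    have hneg : ∀ (J N : M.FullSubcategory) (i : ℤ), i < 0 → HomZero (stalk N) (stalk J) i :=
      fun J N i hi => isConcentrated_singleFunctor N J i hi.ne
    let S := HomotopyCategory.singleFunctor M.FullSubcategory 0
    let J' : M.FullSubcategory := ⟨J, hM.injectives_le h hinj _ hJ⟩
    let u : X 0 ⟶ J' := ObjectProperty.homMk (p ≫ i)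
    obtain ⟨g, hg⟩ := hX.exists_desc (hneg J') (S.map u) (by
      have : δ 0 ≫ u = 0 := ObjectProperty.hom_ext _ (by
        change (δ 0).hom ≫ p ≫ i = 0
        have : (δ 0).hom ≫ p = 0 := hp.zero
        rw [reassoc_of% this, zero_comp])
      rw [← S.map_comp, this, S.map_zero])
    refine ⟨J', g, hJ, fun J'' hJ'' f => ?_⟩
    obtain ⟨w, hw⟩ := S.map_surjective (q ≫ f)
    have hδw : δ 0 ≫ w = 0 := S.map_injective (by
      rw [S.map_comp, hw, ← Category.assoc, hX.map_d_comp, zero_comp, S.map_zero])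
    obtain ⟨l, hl⟩ := hp.exists_desc h w.hom (congrArg (fun f => f.hom) hδw)
    obtain ⟨m, hm⟩ := hJ'' i hi l
    refine ⟨S.map (ObjectProperty.homMk m), ?_⟩
    rw [← sub_eq_zero]
    refine hX.eq_zero (hneg J'') _ ?_
    rw [Preadditive.comp_sub, ← hw, ← Category.assoc, hg, ← S.map_comp, sub_eq_zero]
    congr 1
    apply ObjectProperty.hom_ext
    change (p ≫ i) ≫ m = w.hom
    rw [Category.assoc, hm, hl]

include hwic in
lemma satisfiesQuillenConditions (k : Type w) [CommRing k] [Linear k E] :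
    SatisfiesQuillenConditions k M.FullSubcategory d ((injectives conf).inverseImage M.ι) where
  concentrated := isConcentrated_singleFunctor
  mono X := by
    obtain ⟨J, i, hJ, hi⟩ := hinj X.obj
    obtain ⟨_, _, hi⟩ := hi.exists_conflation
    have := hi.mono h
    refine ⟨⟨J, hM.injectives_le h hinj _ hJ⟩,
      (linearYoneda k M.FullSubcategory).map (ObjectProperty.homMk i), hJ,
      (functor_mono_iff k _).2 fun N f hf => ?_⟩
    have key : ∀ {N : M.FullSubcategory} (f : N ⟶ X),
        f ≫ ObjectProperty.homMk (Y := ⟨J, hM.injectives_le h hinj _ hJ⟩) i = 0 → f = 0 := by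
      intro N f hf
      apply ObjectProperty.hom_ext
      rw [← cancel_mono i]
      exact (congrArg (fun f => f.hom) hf).trans zero_comp.symm
    exact key (N := N.unop) f hf
  exact K hK hJ j hj := by
    obtain ⟨L, p, hp⟩ := exists_isAcyclicResolution h hwic hinj (d + 1)
      (fun j => (K.X j).obj) (fun j => (K.d (j + 1) j).hom)
      (fun j => congrArg (fun f => f.hom) (K.d_comp_d (j + 2) (j + 1) j))
      (fun j hj => M.ι.map_isZero (hK j hj)) (by
        intro J hJ' j g hg
        -- The hypothesis covers `j ≤ d`; beyond that, `K.X (j + 1)` is zero.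
        obtain hj | hj := le_or_gt j d
        · obtain ⟨l, hl⟩ := hJ ⟨J, hM.injectives_le h hinj _ hJ'⟩ hJ' j hj (ObjectProperty.homMk g)
            (ObjectProperty.hom_ext _ hg)
          exact ⟨l.hom, congrArg (fun f => f.hom) hl⟩
        · exact ⟨0, (M.ι.map_isZero (hK (j + 1) (by omega))).eq_of_src _ _⟩)
    refine (functor_exact_iff k _).2 fun N f hf => ?_
    have key : ∀ {N : M.FullSubcategory} (f : N ⟶ K.X (j + 1)), f ≫ K.d (j + 1) j = 0 →
        ∃ l, l ≫ K.d (j + 2) (j + 1) = f := by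
      intro N f hf
      obtain ⟨l, hl⟩ := hM.exists_lift_of_comp_d_eq_zero h hinj hp (fun j => (K.X j).2) N.2 le_rfl
        j f.hom (congrArg (fun f => f.hom) hf)
      exact ⟨ObjectProperty.homMk l, ObjectProperty.hom_ext _ hl⟩
    exact key (N := N.unop) f hf

end IsClusterTilting

end ClusterTiltingPairs

/-! ### The equivalence with `mod_adm(M)`: part (b). -/

section Equivalence

open Pretriangulated Opposite

namespace IsClusterTilting

variable (k : Type w) [CommRing k] {E : Type u} [Category.{v} E] [Preadditive E] [Linear k E]
  {conf : ObjectProperty (ShortComplex E)} (h : IsExactStructure conf)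
  (hwic : IsWeaklyIdempotentComplete E) (hinj : EnoughInjectives conf) {d : ℕ}
  {M : ObjectProperty E} (hM : IsClusterTilting conf d M)
  [HasZeroObject M.FullSubcategory] [HasBinaryBiproducts M.FullSubcategory]

variable (M) in
/-- The functor `Hom(stalk -, ?)` from the homotopy category of complexes over `M` to modules
over `M`. -/
abbrev stalkModule : HomotopyCategory M.FullSubcategory (ComplexShape.up ℤ) ⥤
    M.FullSubcategoryᵒᵖ ⥤ ModuleCat.{v} k :=
  moduleFunctor k (HomotopyCategory.singleFunctor M.FullSubcategory 0)

variable (conf M d) in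
/-- The objects of `H⁰(𝒜^(d+1))`. -/
abbrev resolvable := classA ((injectives conf).inverseImage M.ι) (d + 1)

section

include hM h hwic hinj

omit [Linear k E] in
lemma exists_resolution_of_resolvable
    {Y : HomotopyCategory M.FullSubcategory (ComplexShape.up ℤ)} (hY : resolvable conf d M Y) :
    ∃ (X : ℕ → M.FullSubcategory) (δ : ∀ j, X (j + 1) ⟶ X j) (q : stalk (X 0) ⟶ Y) (L : E)
      (p : (X 0).obj ⟶ L),
      IsTotalization (HomotopyCategory.singleFunctor M.FullSubcategory 0) (d + 1) X δ q ∧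
      IsAcyclicResolution conf (d + 1) (fun j => (X j).obj) (fun j => (δ j).hom) p := by
  obtain ⟨hY, hY'⟩ := classA_iff.1 hY
  obtain ⟨X, δ, q, hX⟩ := exists_isTotalization_of_iterExt _ hY
  obtain ⟨L, p, hp⟩ := hM.exists_isAcyclicResolution_of_isTotalization h hwic hinj hX hY'
  exact ⟨X, δ, q, L, p, hX, hp⟩

-- In negative degrees the length `d + 1` is critical: `Hom(N, -)` is exact, up to the right end, on
-- acyclic complexes over `M` of this length.
omit [Linear k E] in
lemma homZero_of_resolvable
    {Y : HomotopyCategory M.FullSubcategory (ComplexShape.up ℤ)} (hY : resolvable conf d M Y)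
    (N : M.FullSubcategory) (i : ℤ) (hi : i ≠ 0) : HomZero (stalk N) Y i := by
  obtain ⟨X, δ, q, L, p, hX, hp⟩ := hM.exists_resolution_of_resolvable h hwic hinj hY
  obtain hi | hi := hi.lt_or_gt
  · refine hX.homZero_of_neg isConcentrated_singleFunctor (fun j g hg => ?_) hi
    obtain ⟨l, hl⟩ := hM.exists_lift_of_comp_d_eq_zero h hinj hp (fun j => (X j).2) N.2 le_rfl
      j g.hom (congrArg (fun f => f.hom) hg)
    exact ⟨ObjectProperty.homMk l, ObjectProperty.hom_ext _ hl⟩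
  · exact hX.homZero_of_pos isConcentrated_singleFunctor N hi

lemma modAdm_stalkModule
    {Y : HomotopyCategory M.FullSubcategory (ComplexShape.up ℤ)} (hY : resolvable conf d M Y) :
    modAdm k conf M ((stalkModule k M).obj Y) := by
  obtain ⟨X, δ, q, L, p, hX, hp⟩ := hM.exists_resolution_of_resolvable h hwic hinj hY
  exact ⟨linearModules_moduleFunctor k _ Y, X 1, X 0, δ 0, representableDesc q,
    hX.map_d_comp_representableDesc k, hp.isAdmissible h,
    hX.exact_representableDesc k isConcentrated_singleFunctor,
    hX.epi_representableDesc k isConcentrated_singleFunctor⟩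

end

omit [Linear k E] in
/-- The totalization of a bounded complex whose duals with respect to the injectives are exact. -/
lemma exists_resolvable_isTotalization (X : ℕ → M.FullSubcategory)
    (δ : ∀ j, X (j + 1) ⟶ X j) (hδ : ∀ j, δ (j + 1) ≫ δ j = 0)
    (hX : ∀ j, d + 1 < j → IsZero (X j))
    (hJ : ∀ J : M.FullSubcategory, injectives conf J.obj → ∀ j (g : X (j + 1) ⟶ J),
      δ (j + 1) ≫ g = 0 → ∃ l, δ j ≫ l = g) :
    ∃ (Y : HomotopyCategory M.FullSubcategory (ComplexShape.up ℤ)) (q : stalk (X 0) ⟶ Y),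
      resolvable conf d M Y ∧
      IsTotalization (HomotopyCategory.singleFunctor M.FullSubcategory 0) (d + 1) X δ q := by
  obtain ⟨Y, q, hY, hY'⟩ := isConcentrated_singleFunctor.exists_isTotalization _ (d + 1) X δ hδ hX
  exact ⟨Y, q, classA_iff.2 ⟨hY', fun J hJ' i hi =>
    hY.homZero_of_exists_extension isConcentrated_singleFunctor (hJ J hJ') hi⟩, hY⟩

-- The admissible morphism presenting `F` is completed on the left to an acyclic complex over `M`.
-- The module of its totalization and `F` are cokernels of the same morphism.
include hM h hinj in
lemma exists_iso_stalkModule_of_modAdm (hd : 1 ≤ d)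
    {F : M.FullSubcategoryᵒᵖ ⥤ ModuleCat.{v} k} (hF : modAdm k conf M F) :
    ∃ Y, resolvable conf d M Y ∧ Nonempty ((stalkModule k M).obj Y ≅ F) := by
  obtain ⟨-, X, Y, f, π, zero, hf, hex, hπ⟩ := hF
  obtain ⟨V, δ, l, L, p, hV, hp⟩ := hM.exists_resolution_of_isAdmissible h hinj hd f.hom hf
  let V' : ℕ → M.FullSubcategory := fun j => ⟨V j, hV j⟩
  let δ' : ∀ j, V' (j + 1) ⟶ V' j := fun j => ObjectProperty.homMk (δ j)
  let l' : V' 0 ⟶ X := ObjectProperty.homMk l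
  have hd₀ := hp.d_comp_d
  have hz := hp.isZero
  have hJ : ∀ J, injectives conf J → _ := fun J hJ => hp.exists_extension h (J := J) hJ
  let W := consObj Y (consObj X V')
  let ε : ∀ j, W (j + 1) ⟶ W j := consMap f (consMap l' δ')
  have hε : ∀ j, ε (j + 1) ≫ ε j = 0 := by
    rintro (_ | _ | j)
    · exact ObjectProperty.hom_ext _ (hd₀ 0)
    · exact ObjectProperty.hom_ext _ (hd₀ 1)
    · exact ObjectProperty.hom_ext _ (hd₀ (j + 2))
  have hW : ∀ j, d + 1 < j → IsZero (W j) := by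
    rintro (_ | _ | j) hj
    · omega
    · omega
    · exact IsZero.of_full_of_faithful_of_isZero M.ι _ (hz (j + 2) hj)
  obtain ⟨Z, q, hZ, hZ'⟩ := exists_resolvable_isTotalization (conf := conf) W ε hε hW (by
    rintro J hJ' (_ | _ | j) g hg
    · obtain ⟨m, hm⟩ := hJ _ hJ' 0 g.hom (congrArg (fun f => f.hom) hg)
      exact ⟨ObjectProperty.homMk m, ObjectProperty.hom_ext _ hm⟩
    · obtain ⟨m, hm⟩ := hJ _ hJ' 1 g.hom (congrArg (fun f => f.hom) hg)
      exact ⟨ObjectProperty.homMk m, ObjectProperty.hom_ext _ hm⟩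
    · obtain ⟨m, hm⟩ := hJ _ hJ' (j + 2) g.hom (congrArg (fun f => f.hom) hg)
      exact ⟨ObjectProperty.homMk m, ObjectProperty.hom_ext _ hm⟩)
  have hepi := hZ'.epi_representableDesc k isConcentrated_singleFunctor
  have hex' := hZ'.exact_representableDesc k isConcentrated_singleFunctor
  exact ⟨Z, hZ, ⟨(hex'.gIsCokernel).coconePointUniqueUpToIso hex.gIsCokernel⟩⟩

variable (conf d M) in
lemma exists_resolvable_isZero :
    ∃ Y, resolvable conf d M Y ∧ IsZero ((stalkModule k M).obj Y) := by
  obtain ⟨Z, hZ⟩ := HasZeroObject.zero (C := M.FullSubcategory)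
  obtain ⟨Y, q, hY, hY'⟩ := exists_resolvable_isTotalization (conf := conf) (d := d) (fun _ => Z)
    (fun _ => 0) (fun _ => comp_zero) (fun _ _ => hZ) fun _ _ _ g _ => ⟨0, hZ.eq_of_src _ _⟩
  have := hY'.epi_representableDesc k isConcentrated_singleFunctor
  exact ⟨Y, hY, ((linearYoneda k M.FullSubcategory).map_isZero hZ).of_epi (representableDesc q)⟩

variable (conf d M) in
/-- The functor from `H⁰(𝒜^(d+1))` to modules over `M`. -/
abbrev resolvableModule : HA ((injectives conf).inverseImage M.ι) (d + 1) ⥤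
    M.FullSubcategoryᵒᵖ ⥤ ModuleCat.{v} k :=
  (resolvable conf d M).ι ⋙ stalkModule k M

include hM h hwic hinj

lemma full_resolvableModule : (resolvableModule k conf d M).Full where
  map_surjective {Y Z} φ := by
    obtain ⟨X, δ, q, L, p, hX, hp⟩ := hM.exists_resolution_of_resolvable h hwic hinj Y.2
    obtain ⟨f, hf⟩ := (hX.bijective_moduleFunctor_map k isConcentrated_singleFunctor
      fun N i hi => hM.homZero_of_resolvable h hwic hinj Z.2 N i hi.ne).2 φ
    exact ⟨ObjectProperty.homMk f, hf⟩

lemma faithful_resolvableModule : (resolvableModule k conf d M).Faithful where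
  map_injective {Y Z f g} hfg := by
    obtain ⟨X, δ, q, L, p, hX, hp⟩ := hM.exists_resolution_of_resolvable h hwic hinj Y.2
    exact ObjectProperty.hom_ext _ ((hX.bijective_moduleFunctor_map k isConcentrated_singleFunctor
      fun N i hi => hM.homZero_of_resolvable h hwic hinj Z.2 N i hi.ne).1 hfg)

lemma conflationsHA_eq : conflationsHA ((injectives conf).inverseImage M.ι) (d + 1) =
    shortExactInverseImage (resolvableModule k conf d M) := by
  have hz : ∀ Y : HA ((injectives conf).inverseImage M.ι) (d + 1), ∀ N, ∀ i ≠ 0,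
      HomZero ((HomotopyCategory.singleFunctor M.FullSubcategory 0).obj N) Y.obj i := fun Y =>
    hM.homZero_of_resolvable h hwic hinj Y.2
  have hleft : ∀ (Y : HA ((injectives conf).inverseImage M.ι) (d + 1))
      (Q : HomotopyCategory M.FullSubcategory (ComplexShape.up ℤ)),
      (∀ N i, HomZero ((HomotopyCategory.singleFunctor M.FullSubcategory 0).obj N) Q i) →
      ∀ i, HomZero Y.obj Q i := by
    intro Y Q hQ i
    obtain ⟨X, δ, q, L, p, hX, hp⟩ := hM.exists_resolution_of_resolvable h hwic hinj Y.2
    exact hX.homZero_left fun N j _ => hQ N j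
  ext S
  have zero : S.f.hom ≫ S.g.hom = 0 := congrArg (fun f => f.hom) S.zero
  constructor
  · rintro ⟨δ, hT⟩
    exact shortExact_moduleFunctor_of_distTriang k _ hT zero (fun N => hz S.X₁ N 1 one_ne_zero)
      fun N => hz S.X₃ N (-1) (by omega)
  · intro hS
    exact exists_distTriang_of_shortExact_moduleFunctor k zero (hz S.X₁) (hz S.X₂) (hz S.X₃)
      (fun Q hQ i => ⟨hleft _ Q hQ i, hleft _ Q hQ i, hleft _ Q hQ i⟩) hS

/-- The extension is realized by a triangle `A ⟶ Y ⟶ Z`, and both conditions defining the class of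
`A` and `Z` are closed under extensions. -/
lemma essImage_resolvableModule_of_extension
    (S : ShortComplex (M.FullSubcategoryᵒᵖ ⥤ ModuleCat.{v} k)) (hS : S.ShortExact)
    (hL : linearModules k M.FullSubcategory S.X₂) (h₁ : (resolvableModule k conf d M).essImage S.X₁)
    (h₃ : (resolvableModule k conf d M).essImage S.X₃) :
    (resolvableModule k conf d M).essImage S.X₂ := by
  obtain ⟨A, ⟨e₁⟩⟩ := h₁
  obtain ⟨Z, ⟨e₃⟩⟩ := h₃
  have w : (e₁.hom ≫ S.f) ≫ S.g ≫ e₃.inv = 0 := by simp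
  have hS' : (ShortComplex.mk _ _ w).ShortExact :=
    shortExact_of_iso' (w := S.zero) hS w e₁.symm (Iso.refl _) e₃.symm (by simp) (by simp)
  obtain ⟨X, δ, q, L, p, hX, hp⟩ := hM.exists_resolution_of_resolvable h hwic hinj Z.2
  obtain ⟨Y, a, b, δ', hT, ⟨e⟩⟩ := hX.exists_distTriang_of_extension k isConcentrated_singleFunctor
    (fun N => hM.homZero_of_resolvable h hwic hinj Z.2 N (-1) (by omega))
    (fun N i hi => hM.homZero_of_resolvable h hwic hinj A.2 N i hi) hL hS'
  have hA := classA_iff.1 A.2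
  have hZ := classA_iff.1 Z.2
  refine ⟨⟨Y, classA_iff.2 ⟨isConcentrated_singleFunctor.iterExt_extensionProduct_le le_rfl _
    ⟨_, _, _, _, _, hT, hA.1, hZ.1⟩, fun J hJ i hi => ?_⟩⟩, ⟨e⟩⟩
  exact HomZero.left₂ hT (hA.2 J hJ i hi) (hZ.2 J hJ i hi)

include k in
lemma isExactStructure_conflationsHA :
    IsExactStructure (conflationsHA ((injectives conf).inverseImage M.ι) (d + 1)) := by
  -- The conflations do not involve `k`; modules over it serve to recognize them. Extensions are
  -- only considered among linear functors inside the abelian category of all functors, hence the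
  -- class `linearModules` below.
  rw [hM.conflationsHA_eq k h hwic hinj]
  have := hM.full_resolvableModule k h hwic hinj
  have := hM.faithful_resolvableModule k h hwic hinj
  refine isExactStructure_shortExactInverseImage _ (linearModules k M.FullSubcategory)
    (fun Y => linearModules_moduleFunctor k _ _) (fun F G => linearModules_biprod k)
    (fun f _ => linearModules_of_mono k f) (fun f _ => linearModules_of_epi k f) ?_
    (hM.essImage_resolvableModule_of_extension k h hwic hinj)
  obtain ⟨Y, hY, hY'⟩ := exists_resolvable_isZero k conf d M
  exact ⟨⟨Y, hY⟩, hY'⟩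

lemma isExactStructure_conflationsModAdm (hd : 1 ≤ d) :
    IsExactStructure (conflationsModAdm k conf M) := by
  refine isExactStructure_shortExactInverseImage (modAdm k conf M).ι
    (linearModules k M.FullSubcategory)
    (fun Y => Y.2.1) (fun F G => linearModules_biprod k)
    (fun f _ => linearModules_of_mono k f) (fun f _ => linearModules_of_epi k f) ?_ ?_
  · obtain ⟨Y, hY, hY'⟩ := exists_resolvable_isZero k conf d M
    exact ⟨⟨_, hM.modAdm_stalkModule k h hwic hinj hY⟩, hY'⟩
  · have key : ∀ F, (modAdm k conf M).ι.essImage F → (resolvableModule k conf d M).essImage F := by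
      rintro F ⟨G, ⟨e⟩⟩
      obtain ⟨Y, hY, ⟨e'⟩⟩ := hM.exists_iso_stalkModule_of_modAdm k h hinj hd G.2
      exact ⟨⟨Y, hY⟩, ⟨e' ≪≫ e⟩⟩
    intro S hS hL h₁ h₃
    obtain ⟨Y, ⟨e⟩⟩ := hM.essImage_resolvableModule_of_extension k h hwic hinj S hS hL (key _ h₁)
      (key _ h₃)
    exact ⟨⟨_, hM.modAdm_stalkModule k h hwic hinj Y.2⟩, ⟨e⟩⟩

lemma exactEquivalent (hd : 1 ≤ d) :
    ExactEquivalent k (conflationsHA ((injectives conf).inverseImage M.ι) (d + 1))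
      (conflationsModAdm k conf M) := by
  have hfull := hM.full_resolvableModule k h hwic hinj
  have hfaithful := hM.faithful_resolvableModule k h hwic hinj
  let F : HA ((injectives conf).inverseImage M.ι) (d + 1) ⥤ ModAdm k conf M :=
    (modAdm k conf M).lift (resolvableModule k conf d M)
      fun Y => hM.modAdm_stalkModule k h hwic hinj Y.2
  have : F.Additive := ⟨fun {X Y f g} => ObjectProperty.hom_ext _
    ((resolvableModule k conf d M).map_add)⟩
  have : F.Full := ⟨fun {X Y} φ => by
    obtain ⟨f, hf⟩ := hfull.map_surjective φ.hom
    exact ⟨f, ObjectProperty.hom_ext _ hf⟩⟩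
  have : F.Faithful := ⟨fun {X Y f g} hfg =>
    hfaithful.map_injective (congrArg (fun f => f.hom) hfg)⟩
  have : F.EssSurj := ⟨fun G => by
    obtain ⟨Y, hY, ⟨e⟩⟩ := hM.exists_iso_stalkModule_of_modAdm k h hinj hd G.2
    exact ⟨⟨Y, hY⟩, ⟨ObjectProperty.isoMk _ e⟩⟩⟩
  have : F.IsEquivalence := { }
  refine ⟨F.asEquivalence, ‹F.Additive›, ⟨fun {X Y} f r => ObjectProperty.hom_ext _
    ((stalkModule k M).map_smul r f.hom)⟩, fun S => ?_⟩
  rw [hM.conflationsHA_eq k h hwic hinj]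
  rfl

end IsClusterTilting

end Equivalence

end ExactCT

end

/-! ### Conclusion. -/

theorem proposition4p4 {k : Type*} [CommRing k] {E : Type*} [Category* E] [Preadditive E]
    [Linear k E] (conf : ObjectProperty (ShortComplex E)) (hE : ExactCT.IsExactStructure conf)
    (hwic : ExactCT.IsWeaklyIdempotentComplete E) (hinj : ExactCT.EnoughInjectives conf)
    (d : ℕ) (hd : 1 ≤ d) (M : ObjectProperty E) (hM : ExactCT.IsClusterTilting conf d M) :
    -- `M` is an additive category which contains the injectives of `E`, and
    ∃ (_ : HasZeroObject M.FullSubcategory) (_ : HasBinaryBiproducts M.FullSubcategory),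
      ExactCT.injectives conf ≤ M ∧
      -- (a) the pair `(M, I)` is `d`-cluster tilting and satisfies the conditions 1), 2), 3);
      (ExactCT.IsClusterTiltingPair d ((ExactCT.injectives conf).inverseImage M.ι) ∧
        ExactCT.SatisfiesQuillenConditions k M.FullSubcategory d
          ((ExactCT.injectives conf).inverseImage M.ι)) ∧
      -- (b) `H⁰(𝒜^(d+1)_{M,I})` and `mod_adm(M)` are equivalent exact categories.
      (ExactCT.IsExactStructure
          (ExactCT.conflationsHA ((ExactCT.injectives conf).inverseImage M.ι) (d + 1)) ∧
        ExactCT.IsExactStructure (ExactCT.conflationsModAdm k conf M) ∧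
        ExactCT.ExactEquivalent k
          (ExactCT.conflationsHA ((ExactCT.injectives conf).inverseImage M.ι) (d + 1))
          (ExactCT.conflationsModAdm k conf M)) := by
  have h₁ := hM.hasZeroObject_fullSubcategory hE hinj
  have h₂ := hM.hasBinaryBiproducts_fullSubcategory hE hinj
  exact ⟨h₁, h₂, hM.injectives_le hE hinj,
    ⟨hM.isClusterTiltingPair hE hwic hinj, hM.satisfiesQuillenConditions hE hwic hinj k⟩,
    hM.isExactStructure_conflationsHA k hE hwic hinj,
    hM.isExactStructure_conflationsModAdm k hE hwic hinj hd,
    hM.exactEquivalent k hE hwic hinj hd⟩
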